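/- **Setting.** For $\alpha,t_c>0$ and an interval $I\subset\mathbb R$ (possibly a single point), $F_{\alpha,t_c}(I)$ is the set of $f\in C^\infty(I)$ (smooth in a neighbourhood of each point of $I$) with $$\sup_{t\in I}\sup_{k\ge0}|f^{(k)}(t)|\,\frac{t_c^{\alpha+k}}{\Gamma(\alpha+k)}<\infty .$$ *Assumption XZ.* $X,Z$ are meromorphic in an open set $U\subset\mathbb C$ containing the real point $s_r$, are real on $U\cap\mathbb R$, and $\rho^2:=X^2+Z^2\ge c>0$ on $U\cap\mathbb R$. The critical points of $\rho^2$ are its zeros and the poles of $X$ and $Z$ (even where the singularity of $\rho^2$ is removable); they have no accumulation point in $U$, and near each critical point $s_0$ $$X(s)=(s-s_0)^mf(s-s_0)\,[1+(s-s_0)^ng_X(s-s_0)],\qquad Z(s)=\pm i\,(s-s_0)^mf(s-s_0)\,[1+(s-s_0)^ng_Z(s-s_0)],$$ where $n\in\mathbb N$, $n>0$, $m\in\mathbb Z$, $\frac{2m+n}2>-1$, the functions $f,g_X,g_Z$ are analytic near $0$, and $f(0)^2(g_X(0)-g_Z(0))\neq0$ ($m,n,f,g_X,g_Z$ and the sign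 may depend on $s_0$). Let $\tilde\theta$ be a continuous real function on $U\cap\mathbb R$ with $Z=\rho\cos\tilde\theta$, $X=\rho\sin\tilde\theta$, $\rho=\sqrt{\rho^2}>0$. Let the natural time be $\tau(s)=2\int_{s_r}^s\sqrt{\rho^2(u)}\,du$; put $t_r=\tau(s_r)=0$ and $\theta=\tilde\theta\circ\tau^{-1}$. Choose branch cuts attached to the critical points, closed in $U$, not containing $s_r$, and such that every critical point $s_0$ has arbitrarily small neighbourhoods that remain connected when the critical points and the cuts are removed (as is the case for a cut along a simple arc starting at $s_0$). Let $U_0$ be the connected component containing $s_r$ of $U$ without the critical points and the cuts; the cuts are such that $U_0$ is open and $\tau$ continues to a single-valued analytic function on $U_0$. Let $C_{r,0}$ be the connected component containing $s_r$ of $\{s\in U_0:|\tau(s)-\tau(s_r)|<r\}$, and let $R=\sup\{r>0:\overline{C_{r,0}}\subset U_0\}$, assumed finite. *Assumption R2.* $C_{R,0}$ is bounded and $\partial C_{R,0}\cap\partial U_0$ is a finite set of critical points. *Assumption R1* (at a critical point $s_0$). A level line of $\operatorname{Re}\tau$ in $U_0$ emanating from $s_0$ reaches the real axis at $s_r$,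 $C_{R,0}$ is bounded, and $\partial C_{R,0}\cap\partial U_0=\{s_0,\overline{s_0}\}$. **Theorem.** Let $X,Z$ satisfy Assumption XZ. (i) If Assumption R2 holds, then $\theta$ is smooth near $t_r$ and $\theta'\in F_{1,R}(\{t_r\})$. (Thus, at $t_r$, the condition "$\theta'\in F_{1,\tau_*}(J)$ for some $\tau_*\ge t_c$" holds with $J=\{t_r\}$ and $\tau_*=t_c=R$: Assumption 2.) (ii) If Assumption R1 holds at $s_0$, and $X,Z$ have the form above at $s_0$ with $m,n$ and the sign $\pm$, then $t_0=\tau(s_0):=\lim_{U_0\ni s\to s_0}\tau(s)$ exists and, with $\gamma=\frac{\pm n}{2m+n+2}$, there is a compact interval $I$ containing $t_r$ in its interior on which $\theta$ is smooth and $$\theta'(t)=i\gamma\Big(\frac1{t-t_0}-\frac1{t-\overline{t_0}}\Big)+\Delta\theta'(t),$$ where $\Delta\theta'\in F_{\alpha,R}(I)$ for every $\alpha\in(0,1)$ with $\alpha\ge\frac{2m+n}{2m+n+2}$. Moreover, in that case, $I\subset[t_r-R,t_r+R]$ and, for some $\gamma_*\in\mathbb R$ and $\alpha\in(0,1)$,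 $$\theta'(t)-i\gamma_*\Big(\frac1{t-t_r+iR}-\frac1{t-t_r-iR}\Big)\in F_{\alpha,R}(I)$$ (Assumption 1 on $I$ with $t_c=R$). -/

import Mathlib

open Set Filter Topology MeasureTheory
open scoped ENNReal ContDiff

noncomputable section

namespace SuperAdiabatic

/-- The norm `sup_{t ∈ I} sup_{k ≥ 0} |f^{(k)}(t)| tc^{α+k} / Γ(α+k)`, with values in `[0, ∞]`. -/
def facNorm (α tc : ℝ) (I : Set ℝ) (f : ℝ → ℂ) : ℝ≥0∞ :=
  ⨆ t ∈ I, ⨆ k : ℕ,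
    ENNReal.ofReal (‖iteratedDeriv k f t‖ * (tc ^ (α + k) / Real.Gamma (α + k)))

/-- The space `F_{α,tc}(I)`. Degenerate intervals `I = {t}` are allowed, so smoothness on `I` is
smoothness (in the two-sided sense) at each point of `I`. -/
def FSpace (α tc : ℝ) (I : Set ℝ) : Set (ℝ → ℂ) :=
  {f | (∀ t ∈ I, ContDiffAt ℝ ∞ f t) ∧ facNorm α tc I f < ⊤}

/-- The pair of conjugate poles `iγ (1/(t - t₀) - 1/(t - conj t₀))`. -/
def polePair (γ : ℝ) (t₀ : ℂ) (t : ℝ) : ℂ :=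
  Complex.I * γ * (1 / ((t : ℂ) - t₀) - 1 / ((t : ℂ) - (starRingEnd ℂ) t₀))

/-- Assumption 1 for the adiabatic coupling `f = θ'` on `I`, with parameters `tr`, `tc`:
on the compact interval `I ⊆ [tr - tc, tr + tc]` containing `tr`, `f` is
`iγ (1/(t - tr + i tc) - 1/(t - tr - i tc))` plus an element of `F_{α,tc}(I)`. -/
def Assumption1 (f : ℝ → ℂ) (tr tc : ℝ) (I : Set ℝ) : Prop :=
  0 < tc ∧ (∃ a b : ℝ, I = Icc a b) ∧ I ⊆ Icc (tr - tc) (tr + tc) ∧ tr ∈ I ∧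
    ∃ γ α : ℝ, 0 < α ∧ α < 1 ∧
      (fun t : ℝ => f t - polePair γ ((tr : ℂ) - Complex.I * tc) t) ∈ FSpace α tc I

/-- Assumption 2 for the adiabatic coupling `f = θ'` on the compact interval `I` (which may be a
single point): `f ∈ F_{1,τ}(I)` for some `τ ≥ tc`. -/
def Assumption2 (f : ℝ → ℂ) (tc : ℝ) (I : Set ℝ) : Prop :=
  0 < tc ∧ (∃ a b : ℝ, a ≤ b ∧ I = Icc a b) ∧ ∃ τ : ℝ, tc ≤ τ ∧ f ∈ FSpace 1 τ I

/-- `ρ² = X² + Z²`. -/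
def rhoSq (X Z : ℂ → ℂ) (s : ℂ) : ℂ := X s ^ 2 + Z s ^ 2

/-- The critical points of `ρ²` in `U`: the zeros of `ρ²` and the poles of `X` and `Z`
(also when the singularity of `ρ²` there is removable). -/
def criticalPoints (U : Set ℂ) (X Z : ℂ → ℂ) : Set ℂ :=
  {s ∈ U | rhoSq X Z s = 0 ∨ meromorphicOrderAt X s < 0 ∨ meromorphicOrderAt Z s < 0}

/-- The form of `X` and `Z` near the critical point `s₀`, with parameters `m`, `n` and the sign
`ε = ±1`. -/
def HasCriticalForm (X Z : ℂ → ℂ) (s₀ : ℂ) (m : ℤ) (n : ℕ) (ε : ℤ) : Prop :=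
  0 < n ∧ (2 * (m : ℝ) + n) / 2 > -1 ∧ (ε = 1 ∨ ε = -1) ∧
    ∃ f gX gZ : ℂ → ℂ, AnalyticAt ℂ f 0 ∧ AnalyticAt ℂ gX 0 ∧ AnalyticAt ℂ gZ 0 ∧
      0 < ‖f 0 ^ 2 * (gX 0 - gZ 0)‖ ∧
      ∀ᶠ s in 𝓝[≠] s₀,
        X s = (s - s₀) ^ m * f (s - s₀) * (1 + (s - s₀) ^ n * gX (s - s₀)) ∧
        Z s = ε * Complex.I * (s - s₀) ^ m * f (s - s₀) * (1 + (s - s₀) ^ n * gZ (s - s₀))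

/-- Assumption XZ. `MeromorphicNFOn` says that the function is meromorphic, and analytic away from
its poles. The fields `realX`, `realZ` say that the Hamiltonian is real on the real axis. -/
structure AssumptionXZ (U : Set ℂ) (X Z : ℂ → ℂ) (sr : ℝ) : Prop where
  isOpen : IsOpen U
  mem : (sr : ℂ) ∈ U
  meroX : MeromorphicNFOn X U
  meroZ : MeromorphicNFOn Z U
  realX : ∀ x : ℝ, (x : ℂ) ∈ U → (X x).im = 0
  realZ : ∀ x : ℝ, (x : ℂ) ∈ U → (Z x).im = 0
  pos : ∃ c : ℝ, 0 < c ∧ ∀ x : ℝ, (x : ℂ) ∈ U → c ≤ (rhoSq X Z x).re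
  form : ∀ s₀ ∈ criticalPoints U X Z, ∃ (m : ℤ) (n : ℕ) (ε : ℤ), HasCriticalForm X Z s₀ m n ε
  discrete : ∀ s ∈ U, ¬ AccPt s (𝓟 (criticalPoints U X Z))

/-- `θt` is the angle of the Hamiltonian: `Z = ρ cos θt`, `X = ρ sin θt` on `U ∩ ℝ`, and `θt` is
continuous there. -/
def IsAngle (U : Set ℂ) (X Z : ℂ → ℂ) (θt : ℝ → ℝ) : Prop :=
  ContinuousOn θt {x : ℝ | (x : ℂ) ∈ U} ∧
    ∀ x : ℝ, (x : ℂ) ∈ U →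
      Z x = ((√(rhoSq X Z x).re * Real.cos (θt x) : ℝ) : ℂ) ∧
      X x = ((√(rhoSq X Z x).re * Real.sin (θt x) : ℝ) : ℂ)

/-- The natural time on the real axis, `τ(s) = 2 ∫_{sr}^s √(ρ²(u)) du`. -/
def realTime (X Z : ℂ → ℂ) (sr s : ℝ) : ℝ :=
  2 * ∫ u in sr..s, √(rhoSq X Z u).re

/-- `θ = θt ∘ τ⁻¹`, where `τ⁻¹` is the inverse of the natural time on the interval of `U ∩ ℝ`
around `sr`. -/
def thetaOf (U : Set ℂ) (X Z : ℂ → ℂ) (sr : ℝ) (θt : ℝ → ℝ) : ℝ → ℝ :=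
  θt ∘ Function.invFunOn (realTime X Z sr) (connectedComponentIn {x : ℝ | (x : ℂ) ∈ U} sr)

/-- The adiabatic coupling `θ'`, as a complex-valued function of the real time `t`. -/
def couplingOf (U : Set ℂ) (X Z : ℂ → ℂ) (sr : ℝ) (θt : ℝ → ℝ) (t : ℝ) : ℂ :=
  ((deriv (thetaOf U X Z sr θt) t : ℝ) : ℂ)

/-- `U` without the critical points and the branch cuts; `B s₀` is the branch cut attached to the
critical point `s₀` (empty if none is needed there). -/
def slitSet (U : Set ℂ) (X Z : ℂ → ℂ) (B : ℂ → Set ℂ) : Set ℂ :=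
  U \ ⋃ s₀ ∈ criticalPoints U X Z, insert s₀ (B s₀)

/-- `U₀`: the connected component of the slit set that contains `sr`. -/
def slitDomain (U : Set ℂ) (X Z : ℂ → ℂ) (sr : ℝ) (B : ℂ → Set ℂ) : Set ℂ :=
  connectedComponentIn (slitSet U X Z B) sr

/-- The requirements on the branch cuts. They are closed in `U`, avoid `sr`, and near its tip `s₀`
the cut does not disconnect the plane, which is the case for every cut along a simple arc that
starts at `s₀`. (That the cuts make `τ` single valued is part of `IsNaturalTime`.) -/
structure IsBranchCutSystem (U : Set ℂ) (X Z : ℂ → ℂ) (sr : ℝ) (B : ℂ → Set ℂ) : Prop where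
  isOpen_slit : IsOpen (slitSet U X Z B)
  not_mem : ∀ s₀ ∈ criticalPoints U X Z, (sr : ℂ) ∉ B s₀
  tip : ∀ s₀ ∈ criticalPoints U X Z, ∀ N ∈ 𝓝 s₀, ∃ M ∈ 𝓝 s₀, M ⊆ N ∧
    IsPreconnected (M ∩ slitSet U X Z B)

/-- `τ` is the natural time on `U₀`: the (single-valued) analytic function on `U₀` that is given by
`2 ∫_{sr}^s √(ρ²(u)) du` for real `s` near `sr`. Since `U₀` is connected, this determines `τ` on
`U₀`. -/
def IsNaturalTime (U : Set ℂ) (X Z : ℂ → ℂ) (sr : ℝ) (B : ℂ → Set ℂ) (τ : ℂ → ℂ) : Prop :=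
  AnalyticOnNhd ℂ τ (slitDomain U X Z sr B) ∧
    ∀ᶠ s : ℝ in 𝓝 sr, τ s = (realTime X Z sr s : ℂ)

/-- `C_{r,0}`: the connected component containing `sr` of `C_r = {s ∈ U₀ | |τ(s) - τ(sr)| < r}`. -/
def sublevel (U₀ : Set ℂ) (τ : ℂ → ℂ) (sr r : ℝ) : Set ℂ :=
  connectedComponentIn {s ∈ U₀ | ‖τ s - τ sr‖ < r} sr

/-- `R = sup {r > 0 | closure C_{r,0} ⊆ U₀}`, the supremum being finite. -/
def IsRadius (U₀ : Set ℂ) (τ : ℂ → ℂ) (sr R : ℝ) : Prop :=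
  IsLUB {r : ℝ | 0 < r ∧ closure (sublevel U₀ τ sr r) ⊆ U₀} R

/-- Assumption R2: as `r` grows to `R`, the bounded region `C_{r,0}` hits the boundary of `U₀` in
critical points only. -/
def AssumptionR2 (U₀ crit : Set ℂ) (τ : ℂ → ℂ) (sr R : ℝ) : Prop :=
  Bornology.IsBounded (sublevel U₀ τ sr R) ∧
    (frontier (sublevel U₀ τ sr R) ∩ frontier U₀).Finite ∧
    frontier (sublevel U₀ τ sr R) ∩ frontier U₀ ⊆ crit

/-- A level line of `Re τ` in `U₀` that emanates from `s₀` and reaches the real axis at `sr`. -/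
def HasStokesLine (U₀ : Set ℂ) (τ : ℂ → ℂ) (s₀ : ℂ) (sr : ℝ) : Prop :=
  ∃ σ : ℝ → ℂ, ContinuousOn σ (Icc 0 1) ∧ σ 0 = s₀ ∧ σ 1 = sr ∧
    ∀ u ∈ Ioc (0 : ℝ) 1, σ u ∈ U₀ ∧ (τ (σ u)).re = (τ sr).re

/-- Assumption R1 for the critical point `s₀`. -/
def AssumptionR1 (U₀ crit : Set ℂ) (τ : ℂ → ℂ) (sr R : ℝ) (s₀ : ℂ) : Prop :=
  s₀ ∈ crit ∧ HasStokesLine U₀ τ s₀ sr ∧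
    Bornology.IsBounded (sublevel U₀ τ sr R) ∧
    frontier (sublevel U₀ τ sr R) ∩ frontier U₀ = {s₀, (starRingEnd ℂ) s₀}

end SuperAdiabatic

end

/-!
The inverse `φ` of the natural time is analytic on the disc of radius `R`, and on the real axis the
coupling `θ'` is the restriction of the analytic function `h = G ∘ φ / τ' ∘ φ`, where
`G = (X' Z - X Z') / ρ²`. At each point `p` of the boundary circle `φ` has a limit. If the limit is
a point of `U₀`, then `h` extends analytically across `p`. If it is a critical point with parameters
`m`, `n`, then `ρ²` vanishes there to the order `2m + n`, so `τ - p` is a power of a local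
coordinate with exponent `(2m + n + 2) / 2`, and `h(t) = L((1 - t/p)^β) / (1 - t/p)` with `L`
analytic and `β = 2 / (2m + n + 2)`. Hence `h` minus the polar part `∑ c_p / (t - p)` has a
derivative of the order `∑ |1 - t/p|^(β - 2)`, and Cauchy's estimate on circles of radius
`R (1 - 1 / (2 (k + 1)))` turns this into the growth `Γ(α + k) / R ^ (α + k)` of the derivatives at
real points, for `α ≥ 1 - β`; the poles themselves have the growth with `α = 1`. If the boundary
singularity is the conjugate pair of a Stokes line, then it lies on the imaginary axis, and the
residues `± iγ` of its polar part are conjugate because `h` is real on the real axis.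
-/

namespace SuperAdiabatic

open Metric Complex
open scoped Real ComplexConjugate

/-! ### Analytic functions of one complex variable -/

theorem exists_analyticAt_pow_eq {q : ℂ → ℂ} {z₀ : ℂ} (hq : AnalyticAt ℂ q z₀) (h₀ : q z₀ ≠ 0)
    {M : ℕ} (hM : M ≠ 0) : ∃ p : ℂ → ℂ, AnalyticAt ℂ p z₀ ∧ p z₀ ≠ 0 ∧ ∀ z, p z ^ M = q z := by
  refine ⟨fun z => q z₀ ^ (M : ℂ)⁻¹ * (q z / q z₀) ^ (M : ℂ)⁻¹, ?_, by simp [h₀], fun z => ?_⟩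
  · exact analyticAt_const.mul
      ((hq.div analyticAt_const h₀).cpow analyticAt_const (by simp [h₀]))
  · simp only [mul_pow, cpow_nat_inv_pow _ hM]
    field_simp

theorem ofReal_mul_mem_ball_zero {u : ℂ} {r : ℝ} (hu : u ∈ ball 0 r) {y : ℝ}
    (hy : y ∈ Icc (0 : ℝ) 1) : (y : ℂ) * u ∈ ball 0 r := by
  rw [mem_ball_zero_iff] at hu ⊢
  rw [norm_mul, norm_real, Real.norm_of_nonneg hy.1]
  exact (mul_le_of_le_one_left (norm_nonneg u) hy.2).trans_lt hu

theorem intervalIntegrable_mul_comp_ofReal_mul {P : ℂ → ℂ} {r : ℝ} (hP : ContinuousOn P (ball 0 r))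
    {w : ℝ → ℂ} (hw : IntervalIntegrable w volume 0 1) {u : ℂ} (hu : u ∈ ball 0 r) :
    IntervalIntegrable (fun y : ℝ => w y * P (y * u)) volume 0 1 := by
  refine hw.mul_continuousOn ?_
  rw [uIcc_of_le zero_le_one]
  exact hP.comp (f := fun y : ℝ => (y : ℂ) * u) (by fun_prop)
    fun y hy => ofReal_mul_mem_ball_zero hu hy

theorem hasDerivAt_integral_mul_comp_ofReal_mul {P : ℂ → ℂ} {r : ℝ}
    (hP : AnalyticOnNhd ℂ P (ball 0 r)) {w : ℝ → ℂ} (hw : IntervalIntegrable w volume 0 1) {u : ℂ}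
    (hu : u ∈ ball 0 r) :
    HasDerivAt (fun v => ∫ y in (0 : ℝ)..1, w y * P (y * v))
      (∫ y in (0 : ℝ)..1, w y * (y * deriv P (y * u))) u := by
  obtain ⟨r', hur', hr'⟩ := exists_between (mem_ball_zero_iff.1 hu)
  have hur' : u ∈ ball 0 r' := mem_ball_zero_iff.2 hur'
  have hr'r : closedBall (0 : ℂ) r' ⊆ ball 0 r := closedBall_subset_ball hr'
  have hball : ball (0 : ℂ) r' ⊆ ball 0 r := ball_subset_closedBall.trans hr'r
  obtain ⟨C, hC⟩ := (isCompact_closedBall (0 : ℂ) r').exists_bound_of_continuousOn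
    (hP.deriv.continuousOn.mono hr'r)
  have hint : ∀ v ∈ ball (0 : ℂ) r',
      IntervalIntegrable (fun y : ℝ => w y * P (y * v)) volume 0 1 := fun v hv =>
    intervalIntegrable_mul_comp_ofReal_mul hP.continuousOn hw (hball hv)
  have hint' : IntervalIntegrable (fun y : ℝ => w y * (y * deriv P (y * u))) volume 0 1 := by
    simpa only [mul_assoc] using intervalIntegrable_mul_comp_ofReal_mul hP.deriv.continuousOn
      (hw.mul_continuousOn continuous_ofReal.continuousOn) hu
  refine (intervalIntegral.hasDerivAt_integral_of_dominated_loc_of_deriv_le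
    (F' := fun v (y : ℝ) => w y * (y * deriv P (y * v))) (bound := fun y => ‖w y‖ * C)
    (isOpen_ball.mem_nhds hur') ?_ (hint u hur') ?_ ?_ (hw.norm.mul_const C) ?_).2
  · filter_upwards [isOpen_ball.mem_nhds hur'] with v hv
    exact (hint v hv).aestronglyMeasurable_restrict_uIoc
  · exact hint'.aestronglyMeasurable_restrict_uIoc
  · refine Eventually.of_forall fun y hy v hv => ?_
    rw [uIoc_of_le zero_le_one] at hy
    have hy' : y ∈ Icc (0 : ℝ) 1 := ⟨hy.1.le, hy.2⟩
    rw [norm_mul, norm_mul, norm_real, Real.norm_of_nonneg hy'.1]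
    gcongr
    exact (mul_le_of_le_one_left (norm_nonneg _) hy'.2).trans
      (hC _ (ball_subset_closedBall (ofReal_mul_mem_ball_zero hv hy')))
  · refine Eventually.of_forall fun y hy v hv => ?_
    rw [uIoc_of_le zero_le_one] at hy
    have hy' : y ∈ Icc (0 : ℝ) 1 := ⟨hy.1.le, hy.2⟩
    have hPd := (hP _ (hball (ofReal_mul_mem_ball_zero hv hy'))).differentiableAt.hasDerivAt
    exact ((hPd.comp v ((hasDerivAt_id v).const_mul (y : ℂ))).const_mul (w y)).congr_deriv
      (by ring)

-- The solution is `k u = ∫₀¹ y ^ (a - 1) P (y u) dy`: integrating `d/dy (y ^ a P (y u))` over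
-- `[0, 1]` gives the equation.
theorem exists_analyticAt_mul_add_mul_deriv_eq {P : ℂ → ℂ} (hP : AnalyticAt ℂ P 0) {a : ℝ}
    (ha : 0 < a) :
    ∃ k : ℂ → ℂ, AnalyticAt ℂ k 0 ∧ ∀ᶠ u in 𝓝 (0 : ℂ), a * k u + u * deriv k u = P u := by
  obtain ⟨r, hr, hPr⟩ := eventually_nhds_iff_ball.1 hP.eventually_analyticAt
  replace hPr : AnalyticOnNhd ℂ P (ball 0 r) := hPr
  set w : ℝ → ℂ := fun y => ((y ^ (a - 1) : ℝ) : ℂ)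
  have hw : IntervalIntegrable w volume 0 1 := by
    have := intervalIntegral.intervalIntegrable_rpow' (a := 0) (b := 1) (r := a - 1) (by linarith)
    exact ⟨this.1.ofReal, this.2.ofReal⟩
  have hk := fun u (hu : u ∈ ball (0 : ℂ) r) => hasDerivAt_integral_mul_comp_ofReal_mul hPr hw hu
  refine ⟨fun u => ∫ y in (0 : ℝ)..1, w y * P (y * u), ?_, ?_⟩
  · exact DifferentiableOn.analyticAt
      (fun u hu => (hk u hu).differentiableAt.differentiableWithinAt) (ball_mem_nhds _ hr)
  filter_upwards [ball_mem_nhds (0 : ℂ) hr] with u hu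
  have hint := (intervalIntegrable_mul_comp_ofReal_mul hPr.continuousOn hw hu).const_mul (a : ℂ)
  have hint' : IntervalIntegrable (fun y : ℝ => u * (w y * (y * deriv P (y * u)))) volume 0 1 := by
    simpa only [mul_assoc] using (intervalIntegrable_mul_comp_ofReal_mul hPr.deriv.continuousOn
      (hw.mul_continuousOn continuous_ofReal.continuousOn) hu).const_mul u
  have hder : ∀ y ∈ Ioo (0 : ℝ) 1, HasDerivAt (fun y : ℝ => ((y ^ a : ℝ) : ℂ) * P (y * u))
      (a * (w y * P (y * u)) + u * (w y * (y * deriv P (y * u)))) y := by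
    intro y hy
    have hPy := (hPr _ (ofReal_mul_mem_ball_zero hu
      (Ioo_subset_Icc_self hy))).differentiableAt.hasDerivAt
    have hcomp := (hPy.comp (y : ℂ) ((hasDerivAt_id (y : ℂ)).mul_const u)).comp_ofReal
    refine ((Real.hasDerivAt_rpow_const (Or.inl hy.1.ne')).ofReal_comp.mul hcomp).congr_deriv ?_
    have hya : y ^ a = y ^ (a - 1) * y := by rw [← Real.rpow_add_one hy.1.ne', sub_add_cancel]
    simp only [w, Function.comp_apply, id, hya]
    push_cast
    ring
  have hcont : ContinuousOn (fun y : ℝ => ((y ^ a : ℝ) : ℂ) * P (y * u)) (Icc 0 1) :=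
    (continuous_ofReal.comp (Real.continuous_rpow_const ha.le)).continuousOn.mul
      (hPr.continuousOn.comp (f := fun y : ℝ => (y : ℂ) * u) (by fun_prop)
        fun y hy => ofReal_mul_mem_ball_zero hu hy)
  rw [(hk u hu).deriv, ← intervalIntegral.integral_const_mul,
    ← intervalIntegral.integral_const_mul, ← intervalIntegral.integral_add hint hint',
    intervalIntegral.integral_eq_sub_of_hasDerivAt_of_le zero_le_one hcont hder (hint.add hint')]
  simp [Real.zero_rpow ha.ne']

/-! ### Gluing and reflecting analytic functions -/

theorem nonempty_ball_inter_ball_inter {E : Type*} [NormedAddCommGroup E] [NormedSpace ℝ E]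
    {D : Set E} (hD : Convex ℝ D) {p q : E} (hp : p ∈ closure D) (hq : q ∈ closure D) {r s : ℝ}
    (hr : 0 < r) (hs : 0 < s) (hpq : dist p q < r + s) : (ball p r ∩ ball q s ∩ D).Nonempty := by
  have hrs : 0 < r + s := add_pos hr hs
  have hw : AffineMap.lineMap p q (r / (r + s)) ∈ closure D :=
    hD.closure.lineMap_mem hp hq ⟨by positivity, (div_le_one hrs).2 (by linarith)⟩
  have hwp : AffineMap.lineMap p q (r / (r + s)) ∈ ball p r := by
    rw [mem_ball, dist_lineMap_left, Real.norm_of_nonneg (by positivity), div_mul_eq_mul_div,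
      div_lt_iff₀ hrs]
    gcongr
  have hwq : AffineMap.lineMap p q (r / (r + s)) ∈ ball q s := by
    have hsub : 1 - r / (r + s) = s / (r + s) := by
      field_simp
      ring
    rw [mem_ball, dist_lineMap_right, hsub, Real.norm_of_nonneg (by positivity),
      div_mul_eq_mul_div, div_lt_iff₀ hrs]
    gcongr
  exact mem_closure_iff.1 hw _ (isOpen_ball.inter isOpen_ball) ⟨hwp, hwq⟩

theorem eqOn_ball_inter_ball_of_eqOn {D E : Set ℂ} (hD : IsOpen D) (hDc : Convex ℝ D)
    (hDE : D ⊆ E) (hE : Convex ℝ E) {f g : ℂ → ℂ} {p q : ℂ} {r s : ℝ} (hp : p ∈ closure D)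
    (hq : q ∈ closure D) (hr : 0 < r) (hs : 0 < s) (hf : AnalyticOnNhd ℂ f (ball p r ∩ E))
    (hg : AnalyticOnNhd ℂ g (ball q s ∩ E)) (hfg : EqOn f g (ball p r ∩ ball q s ∩ D)) :
    EqOn f g (ball p r ∩ ball q s ∩ E) := by
  intro z hz
  have hpq : dist p q < r + s := (dist_triangle_left p q z).trans_lt (add_lt_add hz.1.1 hz.1.2)
  obtain ⟨v, hv, hvD⟩ := nonempty_ball_inter_ball_inter hDc hp hq hr hs hpq
  have hopen : IsOpen (ball p r ∩ ball q s ∩ D) := (isOpen_ball.inter isOpen_ball).inter hD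
  exact AnalyticOnNhd.eqOn_of_preconnected_of_eventuallyEq (hf.mono fun x hx => ⟨hx.1.1, hx.2⟩)
    (hg.mono fun x hx => ⟨hx.1.2, hx.2⟩)
    (((convex_ball p r).inter (convex_ball q s)).inter hE).isPreconnected ⟨hv, hDE hvD⟩
    (eventually_of_mem (hopen.mem_nhds ⟨hv, hvD⟩) hfg) hz

theorem exists_analyticOnNhd_glue {D E : Set ℂ} (hD : IsOpen D) (hDc : Convex ℝ D) (hDE : D ⊆ E)
    (hE : IsOpen E) (hEc : Convex ℝ E) {f : ℂ → ℂ} {δ : ℂ → ℝ} {g : ℂ → ℂ → ℂ}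
    (hδ : ∀ p ∈ closure D, 0 < δ p)
    (hg : ∀ p ∈ closure D, AnalyticOnNhd ℂ (g p) (ball p (δ p) ∩ E))
    (hgf : ∀ p ∈ closure D, EqOn (g p) f (ball p (δ p) ∩ D)) :
    ∃ F : ℂ → ℂ, (∀ p ∈ closure D, EqOn F (g p) (ball p (δ p) ∩ E)) ∧ EqOn F f D ∧
      AnalyticOnNhd ℂ F (E ∩ ⋃ p ∈ closure D, ball p (δ p)) := by
  classical
  let F : ℂ → ℂ := fun z => if h : ∃ p ∈ closure D, z ∈ ball p (δ p) then g h.choose z else 0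
  have hF : ∀ p ∈ closure D, EqOn F (g p) (ball p (δ p) ∩ E) := by
    intro p hp z hz
    have h : ∃ q ∈ closure D, z ∈ ball q (δ q) := ⟨p, hp, hz.1⟩
    obtain ⟨hq, hzq⟩ := h.choose_spec
    refine (dif_pos h).trans (eqOn_ball_inter_ball_of_eqOn hD hDc hDE hEc hq hp (hδ _ hq) (hδ p hp)
      (hg _ hq) (hg p hp) (fun x hx => ?_) ⟨⟨hzq, hz.1⟩, hz.2⟩)
    rw [hgf _ hq ⟨hx.1.1, hx.2⟩, hgf p hp ⟨hx.1.2, hx.2⟩]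
  refine ⟨F, hF, fun z hz => ?_, ?_⟩
  · have hzc := subset_closure hz
    have hzb := mem_ball_self (x := z) (hδ z hzc)
    rw [hF z hzc ⟨hzb, hDE hz⟩, hgf z hzc ⟨hzb, hz⟩]
  · rintro z ⟨hzE, hz⟩
    obtain ⟨p, hp, hzp⟩ := mem_iUnion₂.1 hz
    exact (hg p hp z ⟨hzp, hzE⟩).congr
      (eventually_of_mem ((isOpen_ball.inter hE).mem_nhds ⟨hzp, hzE⟩) fun x hx => (hF p hp hx).symm)

theorem analyticAt_conj_conj {f : ℂ → ℂ} {z : ℂ} (hf : AnalyticAt ℂ f z) :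
    AnalyticAt ℂ (fun w => conj (f (conj w))) (conj z) := by
  rw [analyticAt_iff_eventually_differentiableAt] at hf ⊢
  have htendsto : Tendsto conj (𝓝 (conj z)) (𝓝 z) := by
    simpa only [conj_conj] using continuous_conj.tendsto (conj z)
  filter_upwards [htendsto.eventually hf] with w hw
  simpa only [Function.comp_def, conj_conj] using hw.conj_conj

/-! ### Derivatives along the real axis -/

theorem iteratedDeriv_comp_ofReal {F : ℂ → ℂ} (k : ℕ) {t : ℝ} (ht : AnalyticAt ℂ F t) :
    iteratedDeriv k (fun x : ℝ => F x) t = iteratedDeriv k F t := by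
  induction k generalizing t with
  | zero => simp only [iteratedDeriv_zero]
  | succ k ih =>
    have hev : (iteratedDeriv k fun x : ℝ => F x) =ᶠ[𝓝 t] fun x : ℝ => iteratedDeriv k F x := by
      filter_upwards [continuous_ofReal.continuousAt.eventually ht.eventually_analyticAt] with x hx
      exact ih hx
    have hk : AnalyticAt ℂ (iteratedDeriv k F) t := by
      rw [iteratedDeriv_eq_iterate]
      exact ht.iterated_deriv k
    rw [iteratedDeriv_succ, iteratedDeriv_succ, hev.deriv_eq]
    exact hk.differentiableAt.hasDerivAt.comp_ofReal.deriv

theorem contDiffAt_comp_ofReal {F : ℂ → ℂ} {t : ℝ} (ht : AnalyticAt ℂ F t) :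
    ContDiffAt ℝ ∞ (fun x : ℝ => F x) t :=
  ((ht.contDiffAt (n := ∞)).restrict_scalars ℝ).comp t ofRealCLM.contDiff.contDiffAt

theorem tendsto_ofReal_nhdsNE (x : ℝ) : Tendsto (fun y : ℝ => (y : ℂ)) (𝓝[≠] x) (𝓝[≠] (x : ℂ)) :=
  continuous_ofReal.continuousAt.continuousWithinAt.tendsto_nhdsWithin
    fun _ hy => ofReal_injective.ne hy

theorem eqOn_of_eventually_eq_ofReal {f g : ℂ → ℂ} {V : Set ℂ} (hf : AnalyticOnNhd ℂ f V)
    (hg : AnalyticOnNhd ℂ g V) (hV : IsPreconnected V) {x : ℝ} (hx : (x : ℂ) ∈ V)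
    (h : ∀ᶠ y : ℝ in 𝓝 x, f y = g y) : EqOn f g V :=
  hf.eqOn_of_preconnected_of_frequently_eq hg hV hx
    ((tendsto_ofReal_nhdsNE x).frequently (h.filter_mono nhdsWithin_le_nhds).frequently)

theorem norm_iteratedDeriv_pole (c p z : ℂ) (k : ℕ) :
    ‖iteratedDeriv k (fun z => c / (z - p)) z‖ = ‖c‖ * k.factorial * ‖z - p‖⁻¹ ^ (k + 1) := by
  have hfun : (fun z => c / (z - p)) = fun z => c * (1 * z + -p)⁻¹ := by
    funext z
    rw [div_eq_mul_inv, one_mul, sub_eq_add_neg]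
  rw [hfun, iteratedDeriv_const_mul_field, iteratedDeriv_eq_iterate, iter_deriv_inv_linear]
  simp only [norm_mul, norm_pow, norm_neg, norm_one, one_pow, one_mul, mul_one, norm_zpow,
    norm_natCast]
  rw [show (-1 - k : ℤ) = -((k + 1 : ℕ) : ℤ) by push_cast; ring, zpow_neg, zpow_natCast, inv_pow,
    mul_assoc, ← sub_eq_add_neg]

/-! ### Averages over circles approaching a singularity, and Cauchy estimates -/

theorem circleAverage_eq_integral_neg_pi_pi {E : Type*} [NormedAddCommGroup E] [NormedSpace ℝ E]
    (f : ℂ → E) (c : ℂ) (r η : ℝ) :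
    Real.circleAverage f c r = (2 * π)⁻¹ • ∫ θ in -π..π, f (circleMap c r (θ + η)) := by
  rw [Real.circleAverage_eq_integral_add (η - π)]
  congr 1
  have hshift := intervalIntegral.integral_comp_add_right (a := 0) (b := 2 * π)
    (fun θ => f (circleMap c r (θ + η))) (-π)
  rw [zero_add, show 2 * π + -π = π by ring] at hshift
  rw [← hshift]
  congr 1 with θ
  congr 2
  ring

theorem norm_circleMap_add_arg_sub (t p : ℂ) (r θ : ℝ) :
    ‖circleMap t r (θ + (p - t).arg) - p‖ = ‖circleMap 0 r θ - ‖p - t‖‖ := by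
  have hp : p = t + ‖p - t‖ * exp ((p - t).arg * I) := by
    rw [norm_mul_exp_arg_mul_I]
    ring
  have hrot : circleMap t r (θ + (p - t).arg) - p =
      exp ((p - t).arg * I) * (circleMap 0 r θ - ‖p - t‖) := by
    nth_rewrite 2 [hp]
    simp only [circleMap, ofReal_add, add_mul, exp_add, zero_add]
    ring
  rw [hrot, norm_mul, norm_exp_ofReal_mul_I, one_mul]

theorem norm_circleMap_zero_sub_ofReal_sq (r D θ : ℝ) :
    ‖circleMap 0 r θ - D‖ ^ 2 = (D - r) ^ 2 + 2 * (r * D) * (1 - Real.cos θ) := by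
  rw [← normSq_eq_norm_sq, normSq_apply]
  simp only [circleMap, zero_add, sub_re, sub_im, mul_re, mul_im, ofReal_re, ofReal_im,
    exp_ofReal_mul_I_re, exp_ofReal_mul_I_im]
  linear_combination r ^ 2 * Real.sin_sq_add_cos_sq θ

theorem le_norm_circleMap_zero_sub_ofReal {R r D θ : ℝ} (hR : 0 < R) (hr : R / 2 ≤ r) (hrR : r < R)
    (hD : R ≤ D) (hθ : |θ| ≤ π) :
    (R - r + R / π * |θ|) / 2 ≤ ‖circleMap 0 r θ - D‖ := by
  have hsq := norm_circleMap_zero_sub_ofReal_sq r D θ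
  have hrD : R ^ 2 / 2 ≤ r * D := by nlinarith
  have hrD₀ : 0 ≤ r * D := (by positivity : (0 : ℝ) ≤ R ^ 2 / 2).trans hrD
  have hcos : 2 / π ^ 2 * θ ^ 2 ≤ 1 - Real.cos θ := by
    linarith [Real.cos_le_one_sub_mul_cos_sq hθ]
  have hcos₀ : 0 ≤ 2 * (r * D) * (1 - Real.cos θ) :=
    mul_nonneg (by nlinarith) (by linarith [Real.cos_le_one θ])
  have hradial : R - r ≤ ‖circleMap 0 r θ - D‖ := by
    refine le_of_sq_le_sq ?_ (norm_nonneg _)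
    nlinarith
  have hangular : R / π * |θ| ≤ ‖circleMap 0 r θ - D‖ := by
    refine le_of_sq_le_sq ?_ (norm_nonneg _)
    calc (R / π * |θ|) ^ 2 = 2 * (R ^ 2 / 2) * (2 / π ^ 2 * θ ^ 2) / 2 := by
          rw [mul_pow, sq_abs]
          ring
      _ ≤ 2 * (R ^ 2 / 2) * (2 / π ^ 2 * θ ^ 2) := half_le_self (by positivity)
      _ ≤ 2 * (r * D) * (1 - Real.cos θ) := by gcongr
      _ ≤ ‖circleMap 0 r θ - D‖ ^ 2 := by
          rw [hsq]
          exact le_add_of_nonneg_left (sq_nonneg _)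
  linarith

theorem integral_rpow_neg_one_sub_le {α c d b : ℝ} (hα : 0 < α) (hc : 0 < c) (hd : 0 < d)
    (hb : 0 ≤ b) :
    ∫ x in (0 : ℝ)..b, ((d + c * x) / 2) ^ (-1 - α) ≤ 2 / (c * α) * (d / 2) ^ (-α) := by
  have hpos : ∀ x ∈ uIcc 0 b, 0 < (d + c * x) / 2 := by
    intro x hx
    rw [uIcc_of_le hb] at hx
    have := mul_nonneg hc.le hx.1
    positivity
  have hder : ∀ x ∈ uIcc 0 b, HasDerivAt (fun x : ℝ => -(2 / (c * α)) * ((d + c * x) / 2) ^ (-α))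
      (((d + c * x) / 2) ^ (-1 - α)) x := by
    intro x hx
    have haff : HasDerivAt (fun x : ℝ => (d + c * x) / 2) (c / 2) x := by
      simpa only [mul_one, id] using (((hasDerivAt_id x).const_mul c).const_add d).div_const 2
    refine ((haff.rpow_const (p := -α) (Or.inl (hpos x hx).ne')).const_mul _).congr_deriv ?_
    rw [show -α - 1 = -1 - α by ring]
    field_simp
  have hcont : ContinuousOn (fun x : ℝ => ((d + c * x) / 2) ^ (-1 - α)) (uIcc 0 b) :=
    ContinuousOn.rpow_const (by fun_prop) fun x hx => Or.inl (hpos x hx).ne'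
  have hend : 0 ≤ 2 / (c * α) * ((d + c * b) / 2) ^ (-α) :=
    mul_nonneg (by positivity) (Real.rpow_nonneg (hpos b right_mem_uIcc).le _)
  rw [intervalIntegral.integral_eq_sub_of_hasDerivAt hder hcont.intervalIntegrable]
  simp only [mul_zero, add_zero]
  linarith

theorem norm_circleMap_sub_pos {t p : ℂ} {r : ℝ} (hr : 0 ≤ r) (hp : r < ‖p - t‖) (θ : ℝ) :
    0 < ‖circleMap t r θ - p‖ := by
  rw [norm_pos_iff, sub_ne_zero]
  rintro rfl
  rw [circleMap_sub_center, norm_circleMap_zero, abs_of_nonneg hr] at hp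
  exact hp.false

theorem integral_comp_abs_neg_self {E : Type*} [NormedAddCommGroup E] [NormedSpace ℝ E]
    {f : ℝ → E} {b : ℝ} (hb : 0 ≤ b) (hf : IntervalIntegrable (fun x => f |x|) volume (-b) b) :
    ∫ x in -b..b, f |x| = (2 : ℝ) • ∫ x in (0 : ℝ)..b, f x := by
  have hsub : uIcc (-b) 0 ⊆ uIcc (-b) b ∧ uIcc 0 b ⊆ uIcc (-b) b := by
    rw [uIcc_of_le hb, uIcc_of_le (neg_nonpos.2 hb), uIcc_of_le (neg_le_self hb)]
    exact ⟨Icc_subset_Icc_right hb, Icc_subset_Icc_left (neg_nonpos.2 hb)⟩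
  have hright : ∫ x in (0 : ℝ)..b, f |x| = ∫ x in (0 : ℝ)..b, f x := by
    refine intervalIntegral.integral_congr fun x hx => ?_
    rw [uIcc_of_le hb] at hx
    simp only [abs_of_nonneg hx.1]
  have hleft : ∫ x in -b..0, f |x| = ∫ x in (0 : ℝ)..b, f |x| := by
    simpa only [abs_neg, neg_zero] using
      (intervalIntegral.integral_comp_neg (a := 0) (b := b) fun x => f |x|).symm
  rw [← intervalIntegral.integral_add_adjacent_intervals (hf.mono_set hsub.1)
    (hf.mono_set hsub.2), hleft, hright, two_smul]

theorem circleAverage_norm_sub_rpow_le {R r α : ℝ} (hR : 0 < R) (hα : 0 < α) (hr : R / 2 ≤ r)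
    (hrR : r < R) {t p : ℂ} (hp : R ≤ ‖p - t‖) :
    Real.circleAverage (fun z => ‖z - p‖ ^ (-1 - α)) t r ≤ 2 / (R * α) * ((R - r) / 2) ^ (-α) := by
  have hπ := Real.pi_pos
  have hr₀ : 0 < r := (half_pos hR).trans_le hr
  have hd : 0 < R - r := sub_pos.2 hrR
  set g : ℝ → ℝ := fun θ => ((R - r + R / π * θ) / 2) ^ (-1 - α)
  have hgpos : ∀ θ : ℝ, 0 < (R - r + R / π * |θ|) / 2 := fun θ => by positivity
  have hg : Continuous fun θ => g |θ| :=
    Continuous.rpow_const (by fun_prop) fun θ => Or.inl (hgpos θ).ne'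
  have hf : Continuous fun θ => ‖circleMap t r (θ + (p - t).arg) - p‖ ^ (-1 - α) :=
    Continuous.rpow_const (by fun_prop) fun θ =>
      Or.inl (norm_circleMap_sub_pos hr₀.le (hrR.trans_le hp) _).ne'
  have hle : ∀ θ ∈ Icc (-π) π, ‖circleMap t r (θ + (p - t).arg) - p‖ ^ (-1 - α) ≤ g |θ| := by
    intro θ hθ
    rw [norm_circleMap_add_arg_sub]
    exact Real.rpow_le_rpow_of_nonpos (hgpos θ)
      (le_norm_circleMap_zero_sub_ofReal hR hr hrR hp (abs_le.2 hθ)) (by linarith)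
  rw [circleAverage_eq_integral_neg_pi_pi _ _ _ (p - t).arg, smul_eq_mul]
  calc (2 * π)⁻¹ * ∫ θ in -π..π, ‖circleMap t r (θ + (p - t).arg) - p‖ ^ (-1 - α)
      ≤ (2 * π)⁻¹ * ∫ θ in -π..π, g |θ| := by
        gcongr
        exact intervalIntegral.integral_mono_on (by linarith) (hf.intervalIntegrable _ _)
          (hg.intervalIntegrable _ _) hle
    _ = (2 * π)⁻¹ * (2 * ∫ θ in (0 : ℝ)..π, g θ) := by
        rw [integral_comp_abs_neg_self hπ.le (hg.intervalIntegrable _ _), smul_eq_mul]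
    _ ≤ (2 * π)⁻¹ * (2 * (2 / (R / π * α) * ((R - r) / 2) ^ (-α))) := by
        gcongr
        exact integral_rpow_neg_one_sub_le hα (by positivity) hd hπ.le
    _ = 2 / (R * α) * ((R - r) / 2) ^ (-α) := by field_simp

theorem norm_iteratedDeriv_le_circleAverage {F : ℂ → ℂ} {t : ℂ} {r : ℝ} (hr : 0 < r)
    (hF : DiffContOnCl ℂ F (ball t r)) (k : ℕ) :
    ‖iteratedDeriv k F t‖ ≤ k.factorial * Real.circleAverage (fun z => ‖F z‖) t r * r⁻¹ ^ k := by
  have hcauchy := hF.circleIntegral_one_div_sub_center_pow_smul hr k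
  have hle : ‖∮ z in C(t, r), (1 / (z - t) ^ (k + 1)) • F z‖ ≤
      ∫ θ : ℝ in 0..2 * π, r⁻¹ ^ k * ‖F (circleMap t r θ)‖ := by
    refine (intervalIntegral.norm_integral_le_integral_norm (by positivity)).trans_eq ?_
    congr 1 with θ
    simp only [deriv_circleMap, norm_smul, norm_mul, norm_div, norm_pow, norm_one, norm_I,
      circleMap_sub_center, norm_circleMap_zero, abs_of_pos hr, inv_pow, pow_succ]
    field_simp
  have hnorm : ‖(2 * π * I / k.factorial : ℂ)‖ = 2 * π / k.factorial := by
    simp [abs_of_pos Real.pi_pos]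
  rw [hcauchy, intervalIntegral.integral_const_mul, norm_smul, hnorm, div_mul_eq_mul_div,
    div_le_iff₀ (by positivity), ← le_div_iff₀' (by positivity)] at hle
  rw [Real.circleAverage_def, smul_eq_mul]
  refine hle.trans_eq ?_
  field_simp

theorem half_le_one_sub_one_div_pow (k : ℕ) : (1 : ℝ) / 2 ≤ (1 - 1 / (2 * (k + 1))) ^ k := by
  have hk : 1 / (2 * (k + 1) : ℝ) ≤ 1 := by
    rw [div_le_one (by positivity)]
    linarith [(Nat.cast_nonneg k : (0 : ℝ) ≤ k)]
  have hkk : (k : ℝ) * (1 / (2 * (k + 1))) ≤ 1 / 2 := by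
    rw [mul_one_div, div_le_div_iff₀ (by positivity) two_pos]
    linarith
  calc (1 : ℝ) / 2 ≤ 1 + k * -(1 / (2 * (k + 1))) := by linarith
    _ ≤ (1 + -(1 / (2 * (k + 1)))) ^ k := one_add_mul_le_pow (by linarith) k
    _ = (1 - 1 / (2 * (k + 1))) ^ k := by rw [← sub_eq_add_neg]

/-- The weight `1 + ∑ p ∈ P, ‖z - p‖ ^ (-1 - α)`, which controls the derivative of a function with
singularities like `(z - p) ^ (-α)` at the points `p` of `P`. -/
noncomputable def singularWeight (P : Finset ℂ) (α : ℝ) (z : ℂ) : ℝ :=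
  1 + ∑ p ∈ P, ‖z - p‖ ^ (-1 - α)

theorem one_le_singularWeight (P : Finset ℂ) (α : ℝ) (z : ℂ) : 1 ≤ singularWeight P α z :=
  le_add_of_nonneg_right (Finset.sum_nonneg fun _ _ => Real.rpow_nonneg (norm_nonneg _) _)

theorem singularWeight_nonneg (P : Finset ℂ) (α : ℝ) (z : ℂ) : 0 ≤ singularWeight P α z :=
  zero_le_one.trans (one_le_singularWeight P α z)

theorem norm_sub_rpow_le_singularWeight {P : Finset ℂ} {p : ℂ} (hp : p ∈ P) (α : ℝ) (z : ℂ) :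
    ‖z - p‖ ^ (-1 - α) ≤ singularWeight P α z :=
  (Finset.single_le_sum (f := fun p => ‖z - p‖ ^ (-1 - α))
    (fun _ _ => Real.rpow_nonneg (norm_nonneg _) _) hp).trans (le_add_of_nonneg_left zero_le_one)

theorem continuousOn_singularWeight {P : Finset ℂ} {α : ℝ} {S : Set ℂ} (h : ∀ p ∈ P, p ∉ S) :
    ContinuousOn (singularWeight P α) S :=
  continuousOn_const.add <| continuousOn_finsetSum _ fun p hp =>
    ContinuousOn.rpow_const (by fun_prop) fun z hz =>
      Or.inl (norm_ne_zero_iff.2 (sub_ne_zero.2 fun hzp => h p hp (hzp ▸ hz)))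

theorem circleAverage_singularWeight_le {R r α : ℝ} (hR : 0 < R) (hα : 0 < α) (hr : R / 2 ≤ r)
    (hrR : r < R) {P : Finset ℂ} {t : ℂ} (hP : ∀ p ∈ P, R ≤ ‖p - t‖) :
    Real.circleAverage (singularWeight P α) t r ≤
      1 + P.card * (2 / (R * α) * ((R - r) / 2) ^ (-α)) := by
  have hr₀ : 0 ≤ r := (half_pos hR).le.trans hr
  have hint : ∀ p ∈ P, CircleIntegrable (fun z => ‖z - p‖ ^ (-1 - α)) t r := fun p hp => by
    refine Continuous.intervalIntegrable (Continuous.rpow_const (by fun_prop) fun θ => ?_) _ _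
    exact Or.inl (norm_circleMap_sub_pos hr₀ (hrR.trans_le (hP p hp)) θ).ne'
  have hsum : CircleIntegrable (fun z => ∑ p ∈ P, ‖z - p‖ ^ (-1 - α)) t r := by
    simpa only [Finset.sum_fn] using CircleIntegrable.sum P hint
  unfold singularWeight
  rw [Real.circleAverage_fun_add (circleIntegrable_const _ _ _) hsum, Real.circleAverage_const,
    Real.circleAverage_fun_sum hint, ← nsmul_eq_mul]
  gcongr
  exact Finset.sum_le_card_nsmul _ _ _ fun p hp =>
    circleAverage_norm_sub_rpow_le hR hα hr hrR (hP p hp)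

theorem circleAverage_norm_le_of_le_singularWeight {R r α C₀ : ℝ} (hR : 0 < R) (hα : 0 < α)
    (hr : R / 2 ≤ r) (hrR : r < R) (hC₀ : 0 ≤ C₀) {P : Finset ℂ} {t : ℂ}
    (hP : ∀ p ∈ P, R ≤ ‖p - t‖) {f : ℂ → ℂ} (hf : ContinuousOn f (ball t R))
    (hle : ∀ z ∈ ball t R, ‖f z‖ ≤ C₀ * singularWeight P α z) :
    Real.circleAverage (fun z => ‖f z‖) t r ≤
      C₀ * (1 + P.card * (2 / (R * α) * ((R - r) / 2) ^ (-α))) := by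
  have hr₀ : 0 ≤ r := (half_pos hR).le.trans hr
  have hsphere : sphere t r ⊆ ball t R :=
    sphere_subset_closedBall.trans (closedBall_subset_ball hrR)
  have hweight : ContinuousOn (singularWeight P α) (sphere t r) :=
    continuousOn_singularWeight fun p hp hpr => by
      rw [mem_sphere_iff_norm] at hpr
      linarith [hP p hp]
  calc Real.circleAverage (fun z => ‖f z‖) t r
      ≤ Real.circleAverage (fun z => C₀ • singularWeight P α z) t r := by
        refine Real.circleAverage_mono ?_ ?_ fun z hz => hle z (hsphere (abs_of_nonneg hr₀ ▸ hz))
        · exact (hf.mono hsphere).norm.circleIntegrable hr₀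
        · exact (hweight.const_smul C₀).circleIntegrable hr₀
    _ ≤ C₀ * (1 + P.card * (2 / (R * α) * ((R - r) / 2) ^ (-α))) := by
        rw [Real.circleAverage_fun_smul, smul_eq_mul]
        gcongr
        exact circleAverage_singularWeight_le hR hα hr hrR hP

-- Cauchy's estimate for `deriv F` on the circle of radius `R (1 - 1 / (2 (k + 1)))`: the power
-- of the radius costs only a factor `2`, and the average of the weight is of order `(k + 1) ^ α`.
theorem exists_norm_iteratedDeriv_succ_le {R α C₀ : ℝ} (hR : 0 < R) (hα : 0 < α) (hC₀ : 0 ≤ C₀)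
    (P : Finset ℂ) :
    ∃ C, ∀ (F : ℂ → ℂ) (t : ℂ), (∀ p ∈ P, R ≤ ‖p - t‖) → AnalyticOnNhd ℂ F (ball t R) →
      (∀ z ∈ ball t R, ‖deriv F z‖ ≤ C₀ * singularWeight P α z) →
      ∀ k : ℕ, ‖iteratedDeriv (k + 1) F t‖ ≤ C * (k.factorial * (k + 1 : ℝ) ^ α * R⁻¹ ^ k) := by
  refine ⟨C₀ * (1 + P.card * (2 / (R * α) * (4 / R) ^ α)) * 2, fun F t hP hF hbound k => ?_⟩
  have hk : (0 : ℝ) ≤ k := k.cast_nonneg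
  have hhalf := half_le_one_sub_one_div_pow k
  set r := R * (1 - 1 / (2 * (k + 1))) with hr
  have hRr : R - r = R / (2 * (k + 1)) := by
    rw [hr]
    field_simp
    ring
  have hrR : r < R := sub_pos.1 (hRr ▸ by positivity)
  have hr₂ : R / 2 ≤ r := by
    have : R / (2 * (k + 1)) ≤ R / 2 := by
      gcongr
      linarith
    linarith
  have hr₀ : 0 < r := (half_pos hR).trans_le hr₂
  have hk₁ : 1 ≤ (k + 1 : ℝ) ^ α := Real.one_le_rpow (le_add_of_nonneg_left hk) hα.le
  have hpow : ((R - r) / 2) ^ (-α) = (4 / R) ^ α * (k + 1 : ℝ) ^ α := by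
    rw [← Real.mul_rpow (by positivity) (by positivity), hRr, Real.rpow_neg (by positivity),
      ← Real.inv_rpow (by positivity)]
    congr 1
    field_simp
    norm_num
  have hrk : r⁻¹ ^ k ≤ 2 * R⁻¹ ^ k := by
    rw [hr, mul_inv, mul_pow, mul_comm]
    gcongr
    rw [inv_pow]
    exact inv_le_of_inv_le₀ two_pos (by rwa [← one_div])
  have hdiff : DiffContOnCl ℂ (deriv F) (ball t r) :=
    (hF.deriv.differentiableOn.mono (closedBall_subset_ball hrR)).diffContOnCl_ball subset_rfl
  rw [iteratedDeriv_succ']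
  calc ‖iteratedDeriv k (deriv F) t‖
      ≤ k.factorial * Real.circleAverage (fun z => ‖deriv F z‖) t r * r⁻¹ ^ k :=
        norm_iteratedDeriv_le_circleAverage hr₀ hdiff k
    _ ≤ k.factorial * (C₀ * (1 + P.card * (2 / (R * α) * ((R - r) / 2) ^ (-α)))) * r⁻¹ ^ k := by
        gcongr
        exact circleAverage_norm_le_of_le_singularWeight hR hα hr₂ hrR hC₀ hP
          hF.deriv.continuousOn hbound
    _ ≤ k.factorial * (C₀ * ((k + 1 : ℝ) ^ α + P.card * (2 / (R * α) *
          ((4 / R) ^ α * (k + 1 : ℝ) ^ α)))) * (2 * R⁻¹ ^ k) := by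
        rw [hpow]
        gcongr
    _ = _ := by ring

/-! ### Functions with branched poles on the boundary of a disc -/

-- If `1 - z / p = -x` with `x ≥ 0`, then `z - t = (p - t) + x p`, which is at least as long as
-- `p - t` because `⟪p - t, p⟫ ≥ 0` for `t` in the closed disc that has `p` on its boundary.
theorem one_sub_div_mem_slitPlane {p t z : ℂ} (hp : p ≠ 0) (ht : ‖t‖ ≤ ‖p‖)
    (hz : ‖z - t‖ < ‖p - t‖) : 1 - z / p ∈ slitPlane := by
  by_contra hcon
  rw [mem_slitPlane_iff_not_le_zero, not_not, Complex.le_def] at hcon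
  obtain ⟨hre, him⟩ := hcon
  set x := -(1 - z / p).re
  have hx : 0 ≤ x := neg_nonneg.2 hre
  have hxp : z - t = (p - t) + x * p := by
    have : 1 - z / p = -(x : ℂ) := Complex.ext (by simp [x]) (by simpa using him)
    have : z / p = 1 + x := by linear_combination -this
    rw [(div_eq_iff hp).1 this]
    ring
  have hinner : (t * conj p).re ≤ ‖p‖ ^ 2 := by
    calc (t * conj p).re ≤ ‖t * conj p‖ := re_le_norm _
      _ = ‖t‖ * ‖p‖ := by rw [norm_mul, norm_conj]
      _ ≤ ‖p‖ ^ 2 := by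
        rw [sq]
        gcongr
  have hnorm : ‖z - t‖ ^ 2 =
      ‖p - t‖ ^ 2 + 2 * x * (‖p‖ ^ 2 - (t * conj p).re) + (x * ‖p‖) ^ 2 := by
    rw [hxp, mul_pow]
    simp only [← normSq_eq_norm_sq, normSq_apply, sub_re, sub_im, add_re, add_im, mul_re, mul_im,
      ofReal_re, ofReal_im, conj_re, conj_im]
    ring
  have hlt : ‖z - t‖ ^ 2 < ‖p - t‖ ^ 2 := by gcongr
  nlinarith [mul_nonneg hx (sub_nonneg.2 hinner), sq_nonneg (x * ‖p‖)]

theorem exists_ball_norm_deriv_le {g : ℂ → ℂ} {y : ℂ} (hg : AnalyticAt ℂ g y) :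
    ∃ δ > 0, ∃ C ≥ 0, ∀ z ∈ ball y δ, AnalyticAt ℂ g z ∧ ‖deriv g z‖ ≤ C := by
  have hlt : ∀ᶠ z in 𝓝 y, ‖deriv g z‖ < ‖deriv g y‖ + 1 :=
    hg.deriv.continuousAt.norm.eventually (gt_mem_nhds (lt_add_one _))
  obtain ⟨δ, hδ, hball⟩ := eventually_nhds_iff_ball.1 (hg.eventually_analyticAt.and hlt)
  exact ⟨δ, hδ, ‖deriv g y‖ + 1, by positivity, fun z hz => ⟨(hball z hz).1, (hball z hz).2.le⟩⟩

theorem norm_deriv_comp_cpow_sub_div_le {L : ℂ → ℂ} {β C : ℝ} (hβ : 0 ≤ β) {y : ℂ}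
    (hy : y ∈ slitPlane) (hL : DifferentiableAt ℂ L (y ^ (β : ℂ)))
    (hderiv : ‖deriv L (y ^ (β : ℂ))‖ ≤ C) (hlip : ‖L (y ^ (β : ℂ)) - L 0‖ ≤ C * ‖y ^ (β : ℂ)‖) :
    ‖deriv (fun w => (L (w ^ (β : ℂ)) - L 0) / w) y‖ ≤ C * (β + 1) * ‖y‖ ^ (β - 2) := by
  have hy₀ : y ≠ 0 := slitPlane_ne_zero hy
  have hpos : 0 < ‖y‖ := norm_pos_iff.2 hy₀
  have hpow : HasDerivAt (fun w : ℂ => w ^ (β : ℂ)) (β * y ^ ((β - 1 : ℝ) : ℂ)) y := by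
    simpa using (hasDerivAt_id y).cpow_const (c := β) hy
  have hquot := ((hL.hasDerivAt.comp y hpow).sub_const (L 0)).div (hasDerivAt_id y) hy₀
  have hrpow : ‖y‖ ^ (β - 1) * ‖y‖ = ‖y‖ ^ β := by
    rw [← Real.rpow_add_one hpos.ne', sub_add_cancel]
  have hdiv : ‖y‖ ^ β / ‖y‖ ^ 2 = ‖y‖ ^ (β - 2) := by
    rw [Real.rpow_sub hpos, Real.rpow_two]
  calc ‖deriv (fun w => (L (w ^ (β : ℂ)) - L 0) / w) y‖
      = ‖deriv L (y ^ (β : ℂ)) * (β * y ^ ((β - 1 : ℝ) : ℂ)) * y -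
          (L (y ^ (β : ℂ)) - L 0)‖ / ‖y‖ ^ 2 := by
        rw [show (fun w => (L (w ^ (β : ℂ)) - L 0) / w) =
          (fun w => (L ∘ fun w : ℂ => w ^ (β : ℂ)) w - L 0) / id from rfl, hquot.deriv, norm_div,
          norm_pow]
        simp only [id_eq, mul_one, Function.comp_apply]
    _ ≤ (‖deriv L (y ^ (β : ℂ))‖ * (β * (‖y‖ ^ (β - 1) * ‖y‖)) +
          ‖L (y ^ (β : ℂ)) - L 0‖) / ‖y‖ ^ 2 := by
        gcongr
        refine (norm_sub_le _ _).trans_eq ?_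
        simp only [norm_mul, norm_real, Real.norm_of_nonneg hβ, norm_cpow_real, mul_assoc]
    _ ≤ (C * (β * ‖y‖ ^ β) + C * ‖y‖ ^ β) / ‖y‖ ^ 2 := by
        rw [norm_cpow_real] at hlip
        rw [hrpow]
        gcongr
    _ = C * (β + 1) * ‖y‖ ^ (β - 2) := by
        rw [← hdiv]
        ring

theorem exists_ball_norm_deriv_comp_cpow_sub_div_le {L : ℂ → ℂ} (hL : AnalyticAt ℂ L 0) {β : ℝ}
    (hβ : 0 < β) :
    ∃ δ > 0, ∃ C ≥ 0, ∀ y ∈ ball 0 δ ∩ slitPlane,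
      AnalyticAt ℂ (fun w => (L (w ^ (β : ℂ)) - L 0) / w) y ∧
      ‖deriv (fun w => (L (w ^ (β : ℂ)) - L 0) / w) y‖ ≤ C * ‖y‖ ^ (β - 2) := by
  obtain ⟨η, hη, C, hC, hball⟩ := exists_ball_norm_deriv_le hL
  have hlim : Tendsto (fun y : ℂ => ‖y‖ ^ β) (𝓝 0) (𝓝 0) := by
    have : ContinuousAt (fun y : ℂ => ‖y‖ ^ β) 0 :=
      continuousAt_id.norm.rpow_const (Or.inr hβ.le)
    simpa only [ContinuousAt, norm_zero, Real.zero_rpow hβ.ne'] using this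
  obtain ⟨δ, hδ, hsmall⟩ := eventually_nhds_iff_ball.1 (hlim.eventually (gt_mem_nhds hη))
  refine ⟨δ, hδ, C * (β + 1), by positivity, fun y hy => ?_⟩
  have hmem : y ^ (β : ℂ) ∈ ball (0 : ℂ) η := by
    rw [mem_ball_zero_iff, norm_cpow_real]
    exact hsmall y hy.1
  obtain ⟨hLy, hderiv⟩ := hball _ hmem
  have hlip : ‖L (y ^ (β : ℂ)) - L 0‖ ≤ C * ‖y ^ (β : ℂ)‖ := by
    simpa only [sub_zero] using (convex_ball (0 : ℂ) η).norm_image_sub_le_of_norm_deriv_le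
      (fun z hz => (hball z hz).1.differentiableAt) (fun z hz => (hball z hz).2)
      (mem_ball_self hη) hmem
  have hpow : AnalyticAt ℂ (fun w : ℂ => w ^ (β : ℂ)) y :=
    analyticAt_id.cpow analyticAt_const hy.2
  have hcomp : AnalyticAt ℂ (fun w => L (w ^ (β : ℂ))) y :=
    hLy.comp (f := fun w => w ^ (β : ℂ)) hpow
  exact ⟨(hcomp.sub analyticAt_const).div analyticAt_id (id_eq y ▸ slitPlane_ne_zero hy.2),
    norm_deriv_comp_cpow_sub_div_le hβ.le hy.2 hLy.differentiableAt hderiv hlip⟩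

theorem exists_ball_norm_deriv_comp_one_sub_div_le {L : ℂ → ℂ} (hL : AnalyticAt ℂ L 0) {β : ℝ}
    (hβ : 0 < β) {p : ℂ} (hp : p ≠ 0) :
    ∃ δ > 0, ∃ C ≥ 0, ∀ t ∈ ball p δ, 1 - t / p ∈ slitPlane →
      AnalyticAt ℂ (fun t => (L ((1 - t / p) ^ (β : ℂ)) - L 0) / (1 - t / p)) t ∧
      ‖deriv (fun t => (L ((1 - t / p) ^ (β : ℂ)) - L 0) / (1 - t / p)) t‖ ≤
        C * ‖t - p‖ ^ (β - 2) := by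
  obtain ⟨δ, hδ, C, hC, hball⟩ := exists_ball_norm_deriv_comp_cpow_sub_div_le hL hβ
  have hp₀ : 0 < ‖p‖ := norm_pos_iff.2 hp
  have hnorm : ∀ t, ‖1 - t / p‖ = ‖t - p‖ / ‖p‖ := fun t => by
    rw [← norm_div, sub_div, div_self hp, norm_sub_rev]
  refine ⟨δ * ‖p‖, by positivity, C / ‖p‖ ^ (β - 2) / ‖p‖, by positivity, fun t ht hslit => ?_⟩
  have hmem : 1 - t / p ∈ ball (0 : ℂ) δ := by
    rw [mem_ball_zero_iff, hnorm, div_lt_iff₀ hp₀]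
    exact mem_ball_iff_norm.1 ht
  obtain ⟨hH, hle⟩ := hball _ ⟨hmem, hslit⟩
  have haff : AnalyticAt ℂ (fun t => 1 - t / p) t :=
    analyticAt_const.sub (analyticAt_id.div analyticAt_const hp)
  have hderiv : HasDerivAt (fun t => 1 - t / p) (-(1 / p)) t :=
    ((hasDerivAt_id t).div_const p).const_sub 1
  refine ⟨hH.comp (f := fun t => 1 - t / p) haff, ?_⟩
  calc _ = ‖deriv (fun w => (L (w ^ (β : ℂ)) - L 0) / w) (1 - t / p) * -(1 / p)‖ :=
        congrArg _ (HasDerivAt.comp t hH.differentiableAt.hasDerivAt hderiv).deriv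
    _ ≤ C * ‖1 - t / p‖ ^ (β - 2) * (1 / ‖p‖) := by
        rw [norm_mul, norm_neg, norm_div, norm_one]
        gcongr
    _ = _ := by
        rw [hnorm, Real.div_rpow (norm_nonneg _) hp₀.le]
        ring

/-- `h` continues analytically from `D` to a neighbourhood of the point `p`. -/
def ExtendsAnalyticallyAt (h : ℂ → ℂ) (D : Set ℂ) (p : ℂ) : Prop :=
  ∃ f : ℂ → ℂ, AnalyticAt ℂ f p ∧ ∀ᶠ t in 𝓝[D] p, h t = f t

/-- Near `p`, the function `h` on `D` has a simple pole with residue `c`, up to an analytic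
function of the branched variable `(1 - t / p) ^ β` that takes the place of the constant `c`. -/
def HasBranchedPole (h : ℂ → ℂ) (D : Set ℂ) (p : ℂ) (β : ℝ) (c : ℂ) : Prop :=
  ∃ L : ℂ → ℂ, AnalyticAt ℂ L 0 ∧ c = -p * L 0 ∧
    ∀ᶠ t in 𝓝[D] p, h t = L ((1 - t / p) ^ (β : ℂ)) / (1 - t / p)

/-- `h` is analytic in the disc of radius `R` about `0`, and its singularities on the boundary are
branched poles at the points `p` of the finite set `P`, with exponents `β p` and residues `c p`. -/
structure HasBranchedPoles (h : ℂ → ℂ) (R : ℝ) (P : Finset ℂ) (β : ℂ → ℝ) (c : ℂ → ℂ) : Prop where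
  radius_pos : 0 < R
  norm_eq : ∀ p ∈ P, ‖p‖ = R
  exponent_pos : ∀ p ∈ P, 0 < β p
  analyticOnNhd : AnalyticOnNhd ℂ h (ball 0 R)
  extendsAnalyticallyAt : ∀ p, ‖p‖ = R → p ∉ P → ExtendsAnalyticallyAt h (ball 0 R) p
  hasBranchedPole : ∀ p ∈ P, HasBranchedPole h (ball 0 R) p (β p) (c p)

/-- The sum of simple poles at the points `p` of `P` with residues `c p`. -/
noncomputable def polarPart (P : Finset ℂ) (c : ℂ → ℂ) (z : ℂ) : ℂ :=
  ∑ p ∈ P, c p / (z - p)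

theorem analyticAt_polarPart {P : Finset ℂ} (c : ℂ → ℂ) {y : ℂ} (hy : y ∉ P) :
    AnalyticAt ℂ (polarPart P c) y :=
  Finset.analyticAt_fun_sum _ fun _ hp =>
    analyticAt_const.div (analyticAt_id.sub analyticAt_const)
      (sub_ne_zero.2 fun hyp => hy (hyp ▸ hp))

/-- The plane without the radial rays that go outwards from the points of `P`. -/
def raySlit (P : Finset ℂ) : Set ℂ := {z | ∀ p ∈ P, 1 - z / p ∈ slitPlane}

section HasBranchedPoles

variable {h : ℂ → ℂ} {R : ℝ} {P : Finset ℂ} {β : ℂ → ℝ} {c : ℂ → ℂ}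

theorem HasBranchedPoles.ne_zero (hh : HasBranchedPoles h R P β c) {p : ℂ} (hp : p ∈ P) : p ≠ 0 :=
  norm_pos_iff.1 (hh.norm_eq p hp ▸ hh.radius_pos)

/-- `g` continues `h - polarPart P c` to the part of `ball x δ` in the slit plane, with the
derivative bounded by `C` times the weight of the singularities. -/
structure IsWeightedExtension (h : ℂ → ℂ) (R : ℝ) (P : Finset ℂ) (β : ℂ → ℝ) (c : ℂ → ℂ) (x : ℂ)
    (δ : ℝ) (g : ℂ → ℂ) (C : ℝ) : Prop where
  radius_pos : 0 < δ
  eqOn : EqOn g (h - polarPart P c) (ball x δ ∩ ball 0 R)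
  analyticAt : ∀ z ∈ ball x δ ∩ raySlit P, AnalyticAt ℂ g z
  norm_deriv_le : ∀ z ∈ ball x δ ∩ raySlit P, ∀ α, (∀ p ∈ P, 1 - β p ≤ α) →
    ‖deriv g z‖ ≤ C * singularWeight P α z

theorem div_one_sub_div_sub_pole {p z : ℂ} (hp : p ≠ 0) (hz : z ≠ p) (w l : ℂ) :
    w / (1 - z / p) - -p * l / (z - p) = (w - l) / (1 - z / p) := by
  have hpz : p - z ≠ 0 := sub_ne_zero.2 hz.symm
  rw [← neg_sub p z, show 1 - z / p = (p - z) / p by rw [sub_div, div_self hp]]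
  field_simp

theorem HasBranchedPoles.exists_isWeightedExtension_of_mem (hh : HasBranchedPoles h R P β c)
    {x : ℂ} (hx : x ∈ P) : ∃ δ g, ∃ C ≥ 0, IsWeightedExtension h R P β c x δ g C := by
  obtain ⟨L, hL, hc, hev⟩ := hh.hasBranchedPole x hx
  have hx₀ := hh.ne_zero hx
  obtain ⟨δ₁, hδ₁, C₁, hC₁, hsing⟩ :=
    exists_ball_norm_deriv_comp_one_sub_div_le hL (hh.exponent_pos x hx) hx₀
  obtain ⟨δ₂, hδ₂, C₂, hC₂, hrest⟩ :=
    exists_ball_norm_deriv_le (analyticAt_polarPart c (P.notMem_erase x))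
  obtain ⟨δ₃, hδ₃, hev⟩ := mem_nhdsWithin_iff.1 hev
  set H : ℂ → ℂ := fun t => (L ((1 - t / x) ^ (β x : ℂ)) - L 0) / (1 - t / x) with hH
  set δ := min (min δ₁ δ₂) (min δ₃ 1)
  have hδle : ball x δ ⊆ (ball x δ₁ ∩ ball x δ₂) ∩ (ball x δ₃ ∩ ball x 1) := fun z hz => by
    simpa only [mem_inter_iff, mem_ball, lt_min_iff, δ] using hz
  refine ⟨δ, H - polarPart (P.erase x) c, C₁ + C₂, by positivity, by positivity, ?_,
    fun z hz => ?_, fun z hz α hα => ?_⟩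
  · rintro z ⟨hz, hzR⟩
    have hhz : h z = _ := hev ⟨(hδle hz).2.1, hzR⟩
    have hzx : z ≠ x := by
      rintro rfl
      exact absurd (mem_ball_zero_iff.1 hzR) (hh.norm_eq z hx).not_lt
    simp only [Pi.sub_apply, polarPart, hH, hhz]
    rw [← Finset.add_sum_erase P _ hx, hc, ← sub_sub, div_one_sub_div_sub_pole hx₀ hzx]
  · exact (hsing z (hδle hz.1).1.1 (hz.2 x hx)).1.sub (hrest z (hδle hz.1).1.2).1
  · obtain ⟨hHz, hHle⟩ := hsing z (hδle hz.1).1.1 (hz.2 x hx)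
    obtain ⟨hPz, hPle⟩ := hrest z (hδle hz.1).1.2
    have hzx : 0 < ‖z - x‖ := norm_pos_iff.2 <| sub_ne_zero.2 <| by
      rintro rfl
      simpa [div_self hx₀] using hz.2 z hx
    have hpow : ‖z - x‖ ^ (β x - 2) ≤ singularWeight P α z :=
      (Real.rpow_le_rpow_of_exponent_ge hzx (mem_ball_iff_norm.1 (hδle hz.1).2.2).le
        (by linarith [hα x hx])).trans (norm_sub_rpow_le_singularWeight hx α z)
    rw [deriv_sub hHz.differentiableAt hPz.differentiableAt, add_mul]
    refine (norm_sub_le _ _).trans (add_le_add (hHle.trans (by gcongr)) (hPle.trans ?_))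
    exact le_mul_of_one_le_right hC₂ (one_le_singularWeight P α z)

theorem HasBranchedPoles.exists_isWeightedExtension_of_notMem (hh : HasBranchedPoles h R P β c)
    {x : ℂ} (hxR : x ∈ closedBall 0 R) (hx : x ∉ P) :
    ∃ δ g, ∃ C ≥ 0, IsWeightedExtension h R P β c x δ g C := by
  obtain ⟨f, hf, hfh⟩ : ExtendsAnalyticallyAt h (ball 0 R) x := by
    rcases (mem_closedBall_zero_iff.1 hxR).lt_or_eq with hlt | heq
    · exact ⟨h, hh.analyticOnNhd x (mem_ball_zero_iff.2 hlt), Eventually.of_forall fun _ => rfl⟩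
    · exact hh.extendsAnalyticallyAt x heq hx
  obtain ⟨δ₁, hδ₁, C, hC, hball⟩ := exists_ball_norm_deriv_le (hf.sub (analyticAt_polarPart c hx))
  obtain ⟨δ₂, hδ₂, hev⟩ := mem_nhdsWithin_iff.1 hfh
  refine ⟨min δ₁ δ₂, f - polarPart P c, C, hC, by positivity, ?_, fun z hz => ?_,
    fun z hz α _ => ?_⟩
  · rintro z ⟨hz, hzR⟩
    have hhz : h z = f z := hev ⟨ball_subset_ball (min_le_right _ _) hz, hzR⟩
    simp only [Pi.sub_apply, hhz]
  · exact (hball z (ball_subset_ball (min_le_left _ _) hz.1)).1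
  · exact (hball z (ball_subset_ball (min_le_left _ _) hz.1)).2.trans
      (le_mul_of_one_le_right hC (one_le_singularWeight P α z))

theorem HasBranchedPoles.exists_isWeightedExtension (hh : HasBranchedPoles h R P β c) {x : ℂ}
    (hx : x ∈ closedBall 0 R) : ∃ δ g, ∃ C ≥ 0, IsWeightedExtension h R P β c x δ g C := by
  by_cases hxP : x ∈ P
  · exact hh.exists_isWeightedExtension_of_mem hxP
  · exact hh.exists_isWeightedExtension_of_notMem hx hxP

-- The radius `ε` is a Lebesgue number of the covering of the closed disc by the discs on which
-- the local extensions are defined.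
theorem HasBranchedPoles.exists_uniform_isWeightedExtension (hh : HasBranchedPoles h R P β c) :
    ∃ ε > 0, ∃ C ≥ 0, ∃ g : ℂ → ℂ → ℂ, ∀ x ∈ closedBall 0 R,
      IsWeightedExtension h R P β c x ε (g x) C := by
  choose! δ g C hC hext using fun x hx => hh.exists_isWeightedExtension (x := x) hx
  have hK : IsCompact (closedBall (0 : ℂ) R) := isCompact_closedBall _ _
  obtain ⟨T, hT, hcover⟩ := hK.elim_nhds_subcover (fun x => ball x (δ x))
    fun x hx => ball_mem_nhds x (hext x hx).radius_pos
  obtain ⟨ε, hε, hleb⟩ := lebesgue_number_lemma_of_metric hK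
    (c := fun x : T => ball (x : ℂ) (δ x)) (fun _ => isOpen_ball) (by
      simpa only [iUnion_subtype] using hcover)
  have : Nonempty T := ⟨(hleb 0 (mem_closedBall_self hh.radius_pos.le)).choose⟩
  choose! i hi using hleb
  refine ⟨ε, hε, ∑ x ∈ T, C x, Finset.sum_nonneg fun y hy => hC y (hT y hy), fun x => g (i x),
    fun x hx => ?_⟩
  have hix := hext _ (hT _ (i x).2)
  refine ⟨hε, hix.eqOn.mono (inter_subset_inter_left _ (hi x hx)),
    fun z hz => hix.analyticAt z ⟨hi x hx hz.1, hz.2⟩,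
    fun z hz α hα => (hix.norm_deriv_le z ⟨hi x hx hz.1, hz.2⟩ α hα).trans ?_⟩
  gcongr
  · exact singularWeight_nonneg P α z
  · exact Finset.single_le_sum (fun y hy => hC y (hT y hy)) (i x).2

theorem exists_mem_ball_inter_ball_dist_lt {t z : ℂ} (htR : ‖t‖ < R) (hz : z ∈ ball t R) {ε : ℝ}
    (htε : ‖t‖ < ε) : ∃ x ∈ ball 0 R ∩ ball t R, z ∈ ball x ε := by
  have ht₂ : ‖t / 2‖ = ‖t‖ / 2 := by rw [norm_div, norm_ofNat]
  have hpos : 0 < R + ‖t‖ / 2 := by linarith [norm_nonneg t]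
  -- the radial contraction towards `t / 2` that maps the disc of radius `R + ‖t‖ / 2`, which
  -- contains `ball t R`, onto the disc of radius `R - ‖t‖ / 2`
  set l := (R - ‖t‖ / 2) / (R + ‖t‖ / 2)
  have hl₀ : 0 < l := div_pos (by linarith [norm_nonneg t]) hpos
  have hl₁ : l ≤ 1 := by
    rw [div_le_one hpos]
    linarith [norm_nonneg t]
  have hl : l * (R + ‖t‖ / 2) = R - ‖t‖ / 2 := div_mul_cancel₀ _ hpos.ne'
  have hzt : ‖z - t / 2‖ < R + ‖t‖ / 2 := by
    rw [← ht₂, show z - t / 2 = (z - t) + t / 2 by ring]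
    exact (norm_add_le _ _).trans_lt (by gcongr; exact mem_ball_iff_norm.1 hz)
  have hlz : ‖(l : ℂ) * (z - t / 2)‖ < R - ‖t‖ / 2 := by
    rw [norm_mul, norm_real, Real.norm_of_nonneg hl₀.le, ← hl]
    gcongr
  refine ⟨t / 2 + l * (z - t / 2), ⟨?_, ?_⟩, ?_⟩
  · rw [mem_ball_zero_iff]
    linarith [norm_add_le (t / 2) (l * (z - t / 2))]
  · rw [mem_ball_iff_norm, show t / 2 + l * (z - t / 2) - t = l * (z - t / 2) - t / 2 by ring]
    linarith [norm_sub_le (l * (z - t / 2)) (t / 2)]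
  · rw [mem_ball_iff_norm,
      show z - (t / 2 + l * (z - t / 2)) = ((1 - l : ℝ) : ℂ) * (z - t / 2) by push_cast; ring,
      norm_mul, norm_real, Real.norm_of_nonneg (by linarith)]
    nlinarith [mul_le_mul_of_nonneg_left hzt.le (sub_nonneg.2 hl₁)]

theorem HasBranchedPoles.exists_extension_ball (hh : HasBranchedPoles h R P β c) :
    ∃ ε > 0, ∃ C ≥ 0, ∀ t : ℂ, ‖t‖ < ε → (∀ p ∈ P, R ≤ ‖p - t‖) →
      ∃ F : ℂ → ℂ, h - polarPart P c =ᶠ[𝓝 t] F ∧ AnalyticOnNhd ℂ F (ball t R) ∧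
        ∀ z ∈ ball t R, ∀ α, (∀ p ∈ P, 1 - β p ≤ α) → ‖deriv F z‖ ≤ C * singularWeight P α z := by
  obtain ⟨ε, hε, C, hC, g, hg⟩ := hh.exists_uniform_isWeightedExtension
  refine ⟨min ε R, lt_min hε hh.radius_pos, C, hC, fun t ht hP => ?_⟩
  obtain ⟨htε, htR⟩ := lt_min_iff.1 ht
  set E := ball t R
  set D := ball (0 : ℂ) R ∩ E
  have hD : IsOpen D := isOpen_ball.inter isOpen_ball
  have hE : E ⊆ raySlit P := fun z hz p hp =>
    one_sub_div_mem_slitPlane (hh.ne_zero hp) (htR.le.trans_eq (hh.norm_eq p hp).symm)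
      ((mem_ball_iff_norm.1 hz).trans_le (hP p hp))
  have hcl : ∀ x ∈ closure D, x ∈ closedBall 0 R := fun x hx =>
    closure_ball_subset_closedBall (closure_mono inter_subset_left hx)
  obtain ⟨F, hFg, hFD, hFan⟩ := exists_analyticOnNhd_glue (D := D) (E := E) hD
    ((convex_ball _ _).inter (convex_ball _ _)) inter_subset_right isOpen_ball
    (convex_ball _ _) (f := h - polarPart P c) (δ := fun _ => ε) (g := g) (fun _ _ => hε)
    (fun x hx z hz => (hg x (hcl x hx)).analyticAt z ⟨hz.1, hE hz.2⟩)
    (fun x hx z hz => (hg x (hcl x hx)).eqOn ⟨hz.1, hz.2.1⟩)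
  have hcov : ∀ z ∈ E, ∃ x ∈ closure D, z ∈ ball x ε := fun z hz =>
    let ⟨x, hx, hzx⟩ := exists_mem_ball_inter_ball_dist_lt htR hz htε
    ⟨x, subset_closure hx, hzx⟩
  refine ⟨F, ?_, fun z hz => ?_, fun z hz α hα => ?_⟩
  · have htD : t ∈ D := ⟨mem_ball_zero_iff.2 htR, mem_ball_self hh.radius_pos⟩
    filter_upwards [hD.mem_nhds htD] with z hz using (hFD hz).symm
  · obtain ⟨x, hx, hzx⟩ := hcov z hz
    exact hFan z ⟨hz, mem_iUnion₂.2 ⟨x, hx, hzx⟩⟩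
  · obtain ⟨x, hx, hzx⟩ := hcov z hz
    have hFx : F =ᶠ[𝓝 z] g x := by
      filter_upwards [(isOpen_ball.inter isOpen_ball).mem_nhds ⟨hzx, hz⟩] with y hy
        using hFg x hx hy
    rw [hFx.deriv_eq]
    exact (hg x (hcl x hx)).norm_deriv_le z ⟨hzx, hE hz⟩ α hα

theorem HasBranchedPoles.exists_norm_iteratedDeriv_sub_polarPart_le
    (hh : HasBranchedPoles h R P β c) :
    ∃ ε > 0, ∀ α > 0, (∀ p ∈ P, 1 - β p ≤ α) → ∃ C, ∀ t : ℂ, ‖t‖ < ε →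
      (∀ p ∈ P, R ≤ ‖p - t‖) → ∀ k : ℕ, ‖iteratedDeriv (k + 1) (h - polarPart P c) t‖ ≤
        C * (k.factorial * (k + 1 : ℝ) ^ α * R⁻¹ ^ k) := by
  obtain ⟨ε, hε, C₀, hC₀, hext⟩ := hh.exists_extension_ball
  refine ⟨ε, hε, fun α hα hβ => ?_⟩
  obtain ⟨C, hC⟩ := exists_norm_iteratedDeriv_succ_le hh.radius_pos hα hC₀ P
  refine ⟨C, fun t ht hP k => ?_⟩
  obtain ⟨F, hF, hFan, hFle⟩ := hext t ht hP
  rw [hF.iteratedDeriv_eq]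
  exact hC F t hP hFan (fun z hz => hFle z hz α hβ) k

end HasBranchedPoles

/-! ### Membership in `FSpace` -/

theorem factorial_mul_rpow_le_Gamma {α : ℝ} (hα : 0 < α) (k : ℕ) :
    (k.factorial : ℝ) * (k + 1) ^ α ≤ (1 + α) * Real.Gamma (α + (k + 1 : ℕ)) := by
  have hk : (0 : ℝ) < k + 1 := by positivity
  have hΓ : 0 < Real.Gamma (α + (k + 1 : ℕ)) := Real.Gamma_pos_of_pos (by positivity)
  have hΓsucc : Real.Gamma (α + (k + 2 : ℕ)) = (α + (k + 1)) * Real.Gamma (α + (k + 1 : ℕ)) := by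
    rw [← Nat.cast_succ, ← Real.Gamma_add_one (by positivity)]
    push_cast
    ring_nf
  have hΓnat : Real.Gamma ((k + 2 : ℕ) : ℝ) = (k + 1) * k.factorial := by
    rw [← Nat.cast_succ, ← Nat.cast_mul, ← Nat.factorial_succ, ← Real.Gamma_nat_eq_factorial]
    push_cast
    ring_nf
  have hsub : ((k + 2 : ℕ) : ℝ) - 1 = k + 1 := by
    push_cast
    ring
  -- `log ∘ Γ` is convex, so its slope on `[k + 2, k + 2 + α]` is at least that on `[k + 1, k + 2]`.
  have hlog := Real.BohrMollerup.f_add_nat_ge (f := Real.log ∘ Real.Gamma) (x := α) (n := k + 2)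
    Real.convexOn_log_Gamma (fun {y} hy => by
      simp only [Function.comp_apply]
      rw [Real.Gamma_add_one hy.ne', Real.log_mul hy.ne' (Real.Gamma_pos_of_pos hy).ne', add_comm])
    (by omega) hα
  rw [Function.comp_apply, Function.comp_apply, add_comm _ α, hsub] at hlog
  have hmul : (k + 1) * k.factorial * (k + 1 : ℝ) ^ α ≤
      (α + (k + 1)) * Real.Gamma (α + (k + 1 : ℕ)) := by
    rw [← Real.log_le_log_iff (by positivity) (by positivity),
      Real.log_mul (by positivity) (by positivity), Real.log_rpow hk, ← hΓsucc, ← hΓnat]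
    exact hlog
  have hα' : α + (k + 1) ≤ (k + 1) * (1 + α) := by nlinarith [k.cast_nonneg (α := ℝ)]
  refine le_of_mul_le_mul_left ?_ hk
  calc (k + 1 : ℝ) * (k.factorial * (k + 1) ^ α)
      ≤ (α + (k + 1)) * Real.Gamma (α + (k + 1 : ℕ)) := by rwa [← mul_assoc]
    _ ≤ (k + 1) * (1 + α) * Real.Gamma (α + (k + 1 : ℕ)) :=
      mul_le_mul_of_nonneg_right hα' hΓ.le
    _ = _ := by ring

theorem factorial_mul_rpow_mul_div_Gamma_le {α R : ℝ} (hα : 0 < α) (hR : 0 < R) (k : ℕ) :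
    (k.factorial * (k + 1 : ℝ) ^ α * R⁻¹ ^ k) *
      (R ^ (α + (k + 1 : ℕ)) / Real.Gamma (α + (k + 1 : ℕ))) ≤ (1 + α) * R ^ (α + 1) := by
  have hΓ : 0 < Real.Gamma (α + (k + 1 : ℕ)) := Real.Gamma_pos_of_pos (by positivity)
  have hpow : R ^ (α + (k + 1 : ℕ)) = R ^ (α + 1) * R ^ k := by
    rw [← Real.rpow_natCast R k, ← Real.rpow_add hR]
    push_cast
    ring_nf
  rw [← mul_div_assoc, div_le_iff₀ hΓ, hpow, inv_pow]
  calc k.factorial * (k + 1 : ℝ) ^ α * (R ^ k)⁻¹ * (R ^ (α + 1) * R ^ k)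
      = k.factorial * (k + 1 : ℝ) ^ α * R ^ (α + 1) := by field_simp
    _ ≤ (1 + α) * Real.Gamma (α + (k + 1 : ℕ)) * R ^ (α + 1) :=
      mul_le_mul_of_nonneg_right (factorial_mul_rpow_le_Gamma hα k) (by positivity)
    _ = _ := by ring

theorem mem_FSpace_of_norm_iteratedDeriv_le {α R C : ℝ} (hα : 0 < α) (hR : 0 < R) {I : Set ℝ}
    (hI : IsCompact I) {f : ℝ → ℂ} (hf : ∀ t ∈ I, ContDiffAt ℝ ∞ f t)
    (h : ∀ t ∈ I, ∀ k : ℕ,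
      ‖iteratedDeriv (k + 1) f t‖ ≤ C * (k.factorial * (k + 1 : ℝ) ^ α * R⁻¹ ^ k)) :
    f ∈ FSpace α R I := by
  obtain ⟨C₀, hC₀⟩ :=
    hI.exists_bound_of_continuousOn fun t ht => (hf t ht).continuousAt.continuousWithinAt
  have hweight (k : ℕ) : 0 ≤ R ^ (α + k) / Real.Gamma (α + k) :=
    div_nonneg (Real.rpow_nonneg hR.le _) (Real.Gamma_pos_of_pos (by positivity)).le
  refine ⟨hf, (iSup₂_le fun t ht => iSup_le fun k => ENNReal.ofReal_le_ofReal
    (q := max (C₀ * (R ^ (α + (0 : ℕ)) / Real.Gamma (α + (0 : ℕ))))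
      (|C| * ((1 + α) * R ^ (α + 1)))) ?_).trans_lt ENNReal.ofReal_lt_top⟩
  rcases k with _ | k
  · refine le_max_of_le_left (mul_le_mul_of_nonneg_right ?_ (hweight 0))
    simpa only [iteratedDeriv_zero] using hC₀ t ht
  · refine le_max_of_le_right ((mul_le_mul_of_nonneg_right (h t ht k) (hweight _)).trans ?_)
    rw [mul_assoc]
    exact mul_le_mul (le_abs_self C) (factorial_mul_rpow_mul_div_Gamma_le hα hR k)
      (mul_nonneg (by positivity) (hweight _)) (abs_nonneg C)

theorem exists_pos_lt_one_le {ι : Type*} (P : Finset ι) {β : ι → ℝ} (h : ∀ p ∈ P, 0 < β p) :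
    ∃ b, 0 < b ∧ b < 1 ∧ ∀ p ∈ P, b ≤ β p := by
  obtain ⟨b, hb, hbβ⟩ := (Filter.Eventually.and (Ioo_mem_nhdsGT one_pos)
    (P.eventually_all.2 fun p hp => eventually_nhdsWithin_of_eventually_nhds
      (eventually_le_nhds (h p hp)))).exists
  exact ⟨b, hb.1, hb.2, hbβ⟩

theorem norm_iteratedDeriv_polarPart_zero_le {P : Finset ℂ} {R : ℝ} (hR : 0 < R)
    (hP : ∀ p ∈ P, ‖p‖ = R) (c : ℂ → ℂ) (k : ℕ) :
    ‖iteratedDeriv k (polarPart P c) 0‖ ≤ (∑ p ∈ P, ‖c p‖) * (k.factorial * R⁻¹ ^ (k + 1)) := by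
  have hpole : ∀ p ∈ P, ContDiffAt ℂ k (fun z => c p / (z - p)) 0 := fun p hp =>
    contDiffAt_const.div (contDiffAt_id.sub contDiffAt_const)
      (by simpa only [id, zero_sub, ← norm_pos_iff, norm_neg, hP p hp] using hR)
  have hsum : iteratedDeriv k (polarPart P c) 0 =
      ∑ p ∈ P, iteratedDeriv k (fun z => c p / (z - p)) 0 := iteratedDeriv_fun_sum hpole
  rw [hsum, Finset.sum_mul]
  refine (norm_sum_le _ _).trans_eq (Finset.sum_congr rfl fun p hp => ?_)
  rw [norm_iteratedDeriv_pole, zero_sub, norm_neg, hP p hp, mul_assoc]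

theorem HasBranchedPoles.exists_norm_iteratedDeriv_zero_le {h : ℂ → ℂ} {R : ℝ} {P : Finset ℂ}
    {β : ℂ → ℝ} {c : ℂ → ℂ} (hh : HasBranchedPoles h R P β c) :
    ∃ C, ∀ k : ℕ, ‖iteratedDeriv (k + 1) h 0‖ ≤
      C * (k.factorial * (k + 1 : ℝ) ^ (1 : ℝ) * R⁻¹ ^ k) := by
  have hR := hh.radius_pos
  obtain ⟨b, hb0, hb1, hbβ⟩ := exists_pos_lt_one_le P hh.exponent_pos
  obtain ⟨ε, hε, hC⟩ := hh.exists_norm_iteratedDeriv_sub_polarPart_le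
  obtain ⟨C, hC⟩ := hC (1 - b) (by linarith) fun p hp => by linarith [hbβ p hp]
  have hrem := hC 0 (by rwa [norm_zero]) fun p hp => by rw [sub_zero, hh.norm_eq p hp]
  have hP : AnalyticAt ℂ (polarPart P c) 0 :=
    analyticAt_polarPart c fun h0 => hh.ne_zero h0 rfl
  have hh0 : AnalyticAt ℂ h 0 := hh.analyticOnNhd 0 (mem_ball_self hR)
  refine ⟨|C| + (∑ p ∈ P, ‖c p‖) * R⁻¹ ^ 2, fun k => ?_⟩
  have hsplit : iteratedDeriv (k + 1) h 0 = iteratedDeriv (k + 1) (h - polarPart P c) 0 +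
      iteratedDeriv (k + 1) (polarPart P c) 0 := by
    rw [← iteratedDeriv_add (hh0.sub hP).contDiffAt hP.contDiffAt, sub_add_cancel]
  have hexp : (k + 1 : ℝ) ^ (1 - b) ≤ (k + 1) ^ (1 : ℝ) :=
    Real.rpow_le_rpow_of_exponent_le (by linarith [k.cast_nonneg (α := ℝ)]) (by linarith)
  rw [hsplit, add_mul]
  refine (norm_add_le _ _).trans (add_le_add ((hrem k).trans ?_)
    ((norm_iteratedDeriv_polarPart_zero_le hR hh.norm_eq c (k + 1)).trans_eq ?_))
  · gcongr
    exact le_abs_self C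
  · rw [Real.rpow_one, Nat.factorial_succ]
    push_cast
    ring

theorem mem_FSpace_of_eventuallyEq {α R : ℝ} {I : Set ℝ} {f g : ℝ → ℂ} (hg : g ∈ FSpace α R I)
    (hfg : ∀ t ∈ I, f =ᶠ[𝓝 t] g) : f ∈ FSpace α R I := by
  have hnorm : facNorm α R I f = facNorm α R I g :=
    biSup_congr fun t ht => by simp only [(hfg t ht).iteratedDeriv_eq]
  exact ⟨fun t ht => (hg.1 t ht).congr_of_eventuallyEq (hfg t ht), hnorm.trans_lt hg.2⟩

theorem norm_ofReal_le_norm_sub {p : ℂ} (hp : p.re = 0) (t : ℝ) : ‖p‖ ≤ ‖p - t‖ := by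
  refine (sq_le_sq₀ (norm_nonneg _) (norm_nonneg _)).1 ?_
  simp only [← normSq_eq_norm_sq, normSq_apply, sub_re, sub_im, ofReal_re, ofReal_im, hp]
  nlinarith [mul_self_nonneg t]

namespace HasBranchedPoles

variable {h : ℂ → ℂ} {R : ℝ} {P : Finset ℂ} {β : ℂ → ℝ} {c : ℂ → ℂ}

theorem mem_FSpace_one (hh : HasBranchedPoles h R P β c) :
    (fun t : ℝ => h t) ∈ FSpace 1 R {0} := by
  have h0 : AnalyticAt ℂ h ((0 : ℝ) : ℂ) :=
    hh.analyticOnNhd _ (by simpa only [ofReal_zero] using mem_ball_self hh.radius_pos)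
  obtain ⟨C, hC⟩ := hh.exists_norm_iteratedDeriv_zero_le
  refine mem_FSpace_of_norm_iteratedDeriv_le one_pos hh.radius_pos isCompact_singleton (C := C)
    (fun t ht => ?_) fun t ht k => ?_ <;> obtain rfl := mem_singleton_iff.1 ht
  · exact contDiffAt_comp_ofReal h0
  · rw [iteratedDeriv_comp_ofReal _ h0, ofReal_zero]
    exact hC k

theorem exists_sub_polarPart_mem_FSpace (hh : HasBranchedPoles h R P β c)
    (hP : ∀ p ∈ P, p.re = 0) :
    ∃ δ > 0, ∀ I : Set ℝ, IsCompact I → (∀ t ∈ I, |t| < δ) → ∀ α > 0,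
      (∀ p ∈ P, 1 - β p ≤ α) → (fun t : ℝ => h t - polarPart P c t) ∈ FSpace α R I := by
  obtain ⟨ε, hε, hbound⟩ := hh.exists_norm_iteratedDeriv_sub_polarPart_le
  refine ⟨min ε R, lt_min hε hh.radius_pos, fun I hI hIδ α hα hβ => ?_⟩
  obtain ⟨C, hC⟩ := hbound α hα hβ
  have hnorm (t) (ht : t ∈ I) : ‖(t : ℂ)‖ < ε ∧ ‖(t : ℂ)‖ < R := by
    simpa only [norm_real, Real.norm_eq_abs, lt_min_iff] using hIδ t ht
  have han (t) (ht : t ∈ I) : AnalyticAt ℂ (h - polarPart P c) (t : ℂ) :=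
    (hh.analyticOnNhd t (mem_ball_zero_iff.2 (hnorm t ht).2)).sub
      (analyticAt_polarPart c fun htP => (hnorm t ht).2.ne (hh.norm_eq _ htP))
  refine mem_FSpace_of_norm_iteratedDeriv_le hα hh.radius_pos hI (C := C)
    (fun t ht => contDiffAt_comp_ofReal (han t ht)) fun t ht k => ?_
  refine (congrArg norm (iteratedDeriv_comp_ofReal (k + 1) (han t ht))).trans_le
    (hC t (hnorm t ht).1 (fun p hp => ?_) k)
  exact (hh.norm_eq p hp).symm.trans_le (norm_ofReal_le_norm_sub (hP p hp) t)

end HasBranchedPoles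

/-! ### Sections of a locally biholomorphic function over discs -/

theorem exists_analyticAt_eventually_inverse {τ : ℂ → ℂ} {s : ℂ} (h : AnalyticAt ℂ τ s)
    (h' : deriv τ s ≠ 0) :
    ∃ ψ : ℂ → ℂ, AnalyticAt ℂ ψ (τ s) ∧ ψ (τ s) = s ∧ (∀ᶠ t in 𝓝 (τ s), τ (ψ t) = t) ∧
      ∀ᶠ x in 𝓝 s, ψ (τ x) = x :=
  ⟨_, h.analyticAt_localInverse h',
    (h.hasStrictDerivAt.eventually_left_inverse (hf' := h')).self_of_nhds,
    h.hasStrictDerivAt.eventually_right_inverse (hf' := h'),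
    h.hasStrictDerivAt.eventually_left_inverse (hf' := h')⟩

/-- A holomorphic function on an open set whose derivative has no zeros; away from the critical
points and the cuts, the natural time is of this kind. -/
structure IsLocallyBiholomorphic (τ : ℂ → ℂ) (U₀ : Set ℂ) : Prop where
  isOpen : IsOpen U₀
  analyticOnNhd : AnalyticOnNhd ℂ τ U₀
  deriv_ne_zero : ∀ s ∈ U₀, deriv τ s ≠ 0

/-- `φ` is a holomorphic section of `τ : U₀ → ℂ` over `D`. The inverse of the natural time is
constructed as such a section over a disc. -/
structure IsLift (U₀ : Set ℂ) (τ φ : ℂ → ℂ) (D : Set ℂ) : Prop where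
  analyticOnNhd : AnalyticOnNhd ℂ φ D
  mem : ∀ t ∈ D, φ t ∈ U₀
  right_inv : ∀ t ∈ D, τ (φ t) = t

section Lift

variable {U₀ D : Set ℂ} {τ φ : ℂ → ℂ}

theorem IsLift.mono {D' : Set ℂ} (h : IsLift U₀ τ φ D) (hD : D' ⊆ D) : IsLift U₀ τ φ D' :=
  ⟨h.analyticOnNhd.mono hD, fun t ht => h.mem t (hD ht), fun t ht => h.right_inv t (hD ht)⟩

theorem IsLift.deriv_eq (hτ : AnalyticOnNhd ℂ τ U₀) (h : IsLift U₀ τ φ D) (hD : IsOpen D) {t : ℂ}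
    (ht : t ∈ D) : deriv φ t = (deriv τ (φ t))⁻¹ := by
  have hcomp := (hτ _ (h.mem t ht)).differentiableAt.hasDerivAt.comp t
    (h.analyticOnNhd t ht).differentiableAt.hasDerivAt
  have hid : τ ∘ φ =ᶠ[𝓝 t] id := by
    filter_upwards [hD.mem_nhds ht] with x hx using h.right_inv x hx
  exact eq_inv_of_mul_eq_one_right (hcomp.unique ((hasDerivAt_id t).congr_of_eventuallyEq hid))

theorem IsLift.congr_of_forall_exists_mem_nhds {ψ : ℂ → ℂ}
    (h : ∀ t ∈ D, ∃ φ, ∃ V ∈ 𝓝 t, IsLift U₀ τ φ V ∧ EqOn ψ φ V) : IsLift U₀ τ ψ D where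
  analyticOnNhd t ht := by
    obtain ⟨φ, V, hV, hφ, hψφ⟩ := h t ht
    exact (hφ.analyticOnNhd t (mem_of_mem_nhds hV)).congr (hψφ.eventuallyEq_of_mem hV).symm
  mem t ht := by
    obtain ⟨φ, V, hV, hφ, hψφ⟩ := h t ht
    exact hψφ (mem_of_mem_nhds hV) ▸ hφ.mem t (mem_of_mem_nhds hV)
  right_inv t ht := by
    obtain ⟨φ, V, hV, hφ, hψφ⟩ := h t ht
    exact hψφ (mem_of_mem_nhds hV) ▸ hφ.right_inv t (mem_of_mem_nhds hV)

namespace IsLocallyBiholomorphic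

theorem exists_isLift_ball (hτ : IsLocallyBiholomorphic τ U₀) {s : ℂ} (hs : s ∈ U₀) :
    ∃ (ψ : ℂ → ℂ) (δ : ℝ), 0 < δ ∧ IsLift U₀ τ ψ (ball (τ s) δ) ∧ ψ (τ s) = s ∧
      ∀ᶠ x in 𝓝 s, ψ (τ x) = x := by
  obtain ⟨ψ, hψ, hψs, hright, hleft⟩ :=
    exists_analyticAt_eventually_inverse (hτ.analyticOnNhd s hs) (hτ.deriv_ne_zero s hs)
  have hmem : ∀ᶠ t in 𝓝 (τ s), ψ t ∈ U₀ :=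
    hψ.continuousAt.eventually (by rw [hψs]; exact hτ.isOpen.mem_nhds hs)
  obtain ⟨δ, hδ, hball⟩ := Metric.eventually_nhds_iff_ball.1
    (hψ.eventually_analyticAt.and (hright.and hmem))
  exact ⟨ψ, δ, hδ, ⟨fun t ht => (hball t ht).1, fun t ht => (hball t ht).2.2,
    fun t ht => (hball t ht).2.1⟩, hψs, hleft⟩

theorem eqOn_of_isLift (hτ : IsLocallyBiholomorphic τ U₀) (h : IsLift U₀ τ φ D) {φ' : ℂ → ℂ}
    (h' : IsLift U₀ τ φ' D) (hD : IsOpen D) (hDc : IsPreconnected D) {t : ℂ} (ht : t ∈ D)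
    (heq : φ t = φ' t) : EqOn φ φ' D := by
  obtain ⟨ψ, -, -, -, -, hleft⟩ := hτ.exists_isLift_ball (h.mem t ht)
  refine h.analyticOnNhd.eqOn_of_preconnected_of_eventuallyEq h'.analyticOnNhd hDc ht ?_
  filter_upwards [(h.analyticOnNhd t ht).continuousAt.eventually hleft,
    (h'.analyticOnNhd t ht).continuousAt.eventually (heq ▸ hleft), hD.mem_nhds ht] with x hx hx' hxD
  rw [h.right_inv x hxD] at hx
  rw [h'.right_inv x hxD] at hx'
  rw [← hx, hx']

theorem isOpen_image_of_isLift (hτ : IsLocallyBiholomorphic τ U₀) (h : IsLift U₀ τ φ D)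
    (hD : IsOpen D) : IsOpen (φ '' D) := by
  rw [isOpen_iff_mem_nhds]
  rintro _ ⟨t, ht, rfl⟩
  obtain ⟨ψ, -, -, -, -, hleft⟩ := hτ.exists_isLift_ball (h.mem t ht)
  have hφψ : ∀ᶠ x in 𝓝 t, φ x = ψ x := by
    filter_upwards [(h.analyticOnNhd t ht).continuousAt.eventually hleft, hD.mem_nhds ht]
      with x hx hxD
    rw [h.right_inv x hxD] at hx
    exact hx.symm
  have hlim : Tendsto τ (𝓝 (φ t)) (𝓝 t) := by
    simpa only [h.right_inv t ht] using
      (hτ.analyticOnNhd _ (h.mem t ht)).continuousAt.tendsto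
  filter_upwards [hleft, hlim.eventually hφψ, hlim.eventually (hD.mem_nhds ht)] with x hx hx' hxD
  exact ⟨τ x, hxD, hx'.trans hx⟩

theorem exists_extension_of_mapClusterPt (hτ : IsLocallyBiholomorphic τ U₀)
    (h : IsLift U₀ τ φ D) (hD : IsOpen D) (hDc : Convex ℝ D) {p s : ℂ} (hs : s ∈ U₀)
    (hps : MapClusterPt s (𝓝[D] p) φ) :
    ∃ (ψ : ℂ → ℂ) (δ : ℝ), 0 < δ ∧ IsLift U₀ τ ψ (ball p δ) ∧ ψ p = s ∧
      EqOn ψ φ (ball p δ ∩ D) := by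
  have hτs : τ s = p := by
    have hcl : MapClusterPt (τ s) (𝓝[D] p) (τ ∘ φ) :=
      hps.continuousAt_comp (hτ.analyticOnNhd s hs).continuousAt
    have hlim : Tendsto (τ ∘ φ) (𝓝[D] p) (𝓝 p) := by
      refine Tendsto.congr' (f₁ := id) ?_ (tendsto_id.mono_left nhdsWithin_le_nhds)
      filter_upwards [self_mem_nhdsWithin] with t ht using (h.right_inv t ht).symm
    exact eq_of_nhds_neBot (ClusterPt.mono hcl hlim)
  obtain ⟨ψ, δ, hδ, hψ, hψs, hleft⟩ := hτ.exists_isLift_ball hs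
  rw [hτs] at hψ hψs
  refine ⟨ψ, δ, hδ, hψ, hψs, ?_⟩
  obtain ⟨t, ht, htb, htD⟩ := ((hps.frequently hleft).and_eventually
    (inter_mem (mem_nhdsWithin_of_mem_nhds (ball_mem_nhds p hδ)) self_mem_nhdsWithin)).exists
  rw [h.right_inv t htD] at ht
  exact hτ.eqOn_of_isLift (hψ.mono inter_subset_left) (h.mono inter_subset_right)
    (isOpen_ball.inter hD) ((convex_ball p δ).inter hDc).isPreconnected ⟨htb, htD⟩ ht

theorem exists_isLift_ball_of_forall_lt (hτ : IsLocallyBiholomorphic τ U₀) {a : ℂ} {r : ℝ}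
    (hr : 0 < r) (h : ∀ x < r, ∃ φ, IsLift U₀ τ φ (ball 0 x) ∧ φ 0 = a) :
    ∃ φ, IsLift U₀ τ φ (ball 0 r) ∧ φ 0 = a := by
  choose! f hf hf0 using h
  have hcompat : ∀ x < r, ∀ y < r, ∀ t ∈ ball (0 : ℂ) x ∩ ball 0 y, f x t = f y t := by
    intro x hx y hy t ht
    have hmin : 0 < min x y := (norm_nonneg t).trans_lt
      (lt_min (mem_ball_zero_iff.1 ht.1) (mem_ball_zero_iff.1 ht.2))
    refine hτ.eqOn_of_isLift ((hf x hx).mono (ball_subset_ball (min_le_left x y)))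
      ((hf y hy).mono (ball_subset_ball (min_le_right x y))) isOpen_ball
      (convex_ball _ _).isPreconnected (mem_ball_self hmin) ((hf0 x hx).trans (hf0 y hy).symm) ?_
    exact mem_ball_zero_iff.2 (lt_min (mem_ball_zero_iff.1 ht.1) (mem_ball_zero_iff.1 ht.2))
  let Φ : ℂ → ℂ := fun t => f ((‖t‖ + r) / 2) t
  have hΦ : ∀ x < r, EqOn Φ (f x) (ball 0 x) := fun x hx t ht => by
    have htx := mem_ball_zero_iff.1 ht
    exact hcompat _ (by linarith) x hx t ⟨mem_ball_zero_iff.2 (by linarith), ht⟩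
  refine ⟨Φ, IsLift.congr_of_forall_exists_mem_nhds fun t ht => ?_, hf0 _ ?_⟩
  · obtain ⟨x, htx, hxr⟩ := exists_between (mem_ball_zero_iff.1 ht)
    exact ⟨f x, ball 0 x, isOpen_ball.mem_nhds (mem_ball_zero_iff.2 htx), hf x hxr, hΦ x hxr⟩
  · rw [norm_zero, zero_add]
    exact half_lt_self hr

theorem exists_isLift_ball_add_of_isCompact (hτ : IsLocallyBiholomorphic τ U₀) {r : ℝ}
    (hr : 0 < r) (h : IsLift U₀ τ φ (ball 0 r)) {K : Set ℂ} (hK : IsCompact K) (hKU : K ⊆ U₀)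
    (hφK : MapsTo φ (ball 0 r) K) :
    ∃ η > 0, ∃ ψ, IsLift U₀ τ ψ (ball 0 (η + r)) ∧ ψ 0 = φ 0 := by
  have hext : ∀ p ∈ closure (ball (0 : ℂ) r), ∃ (ψ : ℂ → ℂ) (δ : ℝ), 0 < δ ∧
      IsLift U₀ τ ψ (ball p δ) ∧ EqOn ψ φ (ball p δ ∩ ball 0 r) := by
    intro p hp
    have : (𝓝[ball (0 : ℂ) r] p).NeBot := mem_closure_iff_nhdsWithin_neBot.1 hp
    obtain ⟨s, hs, hcl⟩ := hK.exists_mapClusterPt (f := 𝓝[ball (0 : ℂ) r] p) (u := φ)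
      (le_principal_iff.2 (mem_map.2 (mem_of_superset self_mem_nhdsWithin hφK)))
    obtain ⟨ψ, δ, hδ, hψ, -, hψφ⟩ :=
      hτ.exists_extension_of_mapClusterPt h isOpen_ball (convex_ball _ _) (hKU hs) hcl
    exact ⟨ψ, δ, hδ, hψ, hψφ⟩
  choose! g δ hδ hg hgφ using hext
  obtain ⟨F, hFg, hFφ, -⟩ := exists_analyticOnNhd_glue (E := univ) isOpen_ball
    (convex_ball (0 : ℂ) r) (subset_univ _) isOpen_univ convex_univ hδ
    (fun p hp => (hg p hp).analyticOnNhd.mono inter_subset_left) hgφ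
  have hopen : IsOpen (⋃ p ∈ closure (ball (0 : ℂ) r), ball p (δ p)) :=
    isOpen_biUnion fun _ _ => isOpen_ball
  obtain ⟨η, hη, hsub⟩ := (isCompact_closedBall (0 : ℂ) r).exists_thickening_subset_open hopen
    (fun p hp => by
      rw [← closure_ball (0 : ℂ) hr.ne'] at hp
      exact mem_iUnion₂.2 ⟨p, hp, mem_ball_self (hδ p hp)⟩)
  rw [thickening_closedBall hη hr.le] at hsub
  refine ⟨η, hη, F, IsLift.congr_of_forall_exists_mem_nhds fun t ht => ?_,
    hFφ (mem_ball_self hr)⟩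
  obtain ⟨p, hp, hpt⟩ := mem_iUnion₂.1 (hsub ht)
  exact ⟨g p, ball p (δ p), isOpen_ball.mem_nhds hpt, hg p hp,
    (hFg p hp).mono (subset_inter Subset.rfl (subset_univ _))⟩

end IsLocallyBiholomorphic

/-! ### Sublevel components -/

variable {a r R : ℝ}

theorem sublevel_subset (r : ℝ) : sublevel U₀ τ a r ⊆ {s ∈ U₀ | ‖τ s - τ a‖ < r} :=
  connectedComponentIn_subset _ _

theorem sublevel_mono (h : r ≤ R) : sublevel U₀ τ a r ⊆ sublevel U₀ τ a R :=
  connectedComponentIn_mono _ fun _ hs => ⟨hs.1, hs.2.trans_le h⟩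

theorem IsLocallyBiholomorphic.isOpen_sublevel (hτ : IsLocallyBiholomorphic τ U₀) (r : ℝ) :
    IsOpen (sublevel U₀ τ a r) :=
  ((hτ.analyticOnNhd.continuousOn.sub continuousOn_const).norm.isOpen_inter_preimage hτ.isOpen
    isOpen_Iio).connectedComponentIn

theorem IsLocallyBiholomorphic.mem_frontier_inter_frontier (hτ : IsLocallyBiholomorphic τ U₀)
    {s : ℂ} (hs : s ∈ closure (sublevel U₀ τ a R)) (hsU : s ∉ U₀) :
    s ∈ frontier (sublevel U₀ τ a R) ∩ frontier U₀ := by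
  have hsub : sublevel U₀ τ a R ⊆ U₀ := fun x hx => (sublevel_subset R hx).1
  rw [(hτ.isOpen_sublevel R).frontier_eq, hτ.isOpen.frontier_eq]
  exact ⟨⟨hs, fun h => hsU (hsub h)⟩, closure_mono hsub hs, hsU⟩

/-- `φ` is the inverse of the natural time `τ` over the disc of radius `R`, taking values in `U₀`
and mapping the centre to `a`. -/
structure IsTimeInverse (U₀ : Set ℂ) (τ : ℂ → ℂ) (a R : ℝ) (φ : ℂ → ℂ) : Prop where
  radius_pos : 0 < R
  isLift : IsLift U₀ τ φ (ball 0 R)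
  map_zero : φ 0 = a

theorem IsTimeInverse.apply_self (h : IsTimeInverse U₀ τ a R φ) : τ a = 0 := by
  rw [← h.map_zero, h.isLift.right_inv 0 (mem_ball_self h.radius_pos)]

theorem IsTimeInverse.mapsTo_sublevel (h : IsTimeInverse U₀ τ a R φ) :
    MapsTo φ (ball 0 R) (sublevel U₀ τ a R) := by
  have hpc : IsPreconnected (φ '' ball 0 R) :=
    (convex_ball (0 : ℂ) R).isPreconnected.image _ h.isLift.analyticOnNhd.continuousOn
  refine mapsTo_iff_image_subset.2
    (hpc.subset_connectedComponentIn ⟨0, mem_ball_self h.radius_pos, h.map_zero⟩ ?_)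
  rintro _ ⟨x, hx, rfl⟩
  refine ⟨h.isLift.mem x hx, ?_⟩
  rw [h.isLift.right_inv x hx, h.apply_self, sub_zero]
  exact mem_ball_zero_iff.1 hx

theorem IsLocallyBiholomorphic.exists_isTimeInverse
    (hτ : IsLocallyBiholomorphic τ U₀) (haU : (a : ℂ) ∈ U₀) (ha : τ a = 0) (hR : 0 < R)
    (hK : ∀ r < R, IsCompact (closure (sublevel U₀ τ a r)) ∧ closure (sublevel U₀ τ a r) ⊆ U₀) :
    ∃ φ, IsTimeInverse U₀ τ a R φ := by
  let A : Set ℝ := {r | r ≤ R ∧ ∃ φ, IsTimeInverse U₀ τ a r φ}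
  have hA : BddAbove A := ⟨R, fun r hr => hr.1⟩
  obtain ⟨r₀, hr₀⟩ : A.Nonempty := by
    obtain ⟨ψ, δ, hδ, hψ, hψa, -⟩ := hτ.exists_isLift_ball haU
    rw [ha] at hψ hψa
    exact ⟨min δ R, min_le_right _ _, ψ, lt_min hδ hR,
      hψ.mono (ball_subset_ball (min_le_left _ _)), hψa⟩
  have hr : 0 < sSup A := by
    have ⟨_, _, hφ⟩ := hr₀
    exact hφ.radius_pos.trans_le (le_csSup hA hr₀)
  obtain ⟨φ, hφ, hφ0⟩ := hτ.exists_isLift_ball_of_forall_lt (a := a) hr fun x hx => by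
    obtain ⟨y, ⟨-, φ, hφ⟩, hxy⟩ := exists_lt_of_lt_csSup ⟨r₀, hr₀⟩ hx
    exact ⟨φ, hφ.isLift.mono (ball_subset_ball hxy.le), hφ.map_zero⟩
  rcases (csSup_le ⟨r₀, hr₀⟩ fun x hx => hx.1 : sSup A ≤ R).eq_or_lt with heq | hlt
  · exact ⟨φ, hR, heq ▸ hφ, hφ0⟩
  obtain ⟨hcpt, hsub⟩ := hK _ hlt
  obtain ⟨η, hη, ψ, hψ, hψφ⟩ := hτ.exists_isLift_ball_add_of_isCompact hr hφ hcpt hsub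
    fun t ht => subset_closure (IsTimeInverse.mapsTo_sublevel ⟨hr, hφ, hφ0⟩ ht)
  have hmem : min (η + sSup A) R ∈ A := ⟨min_le_right _ _, ψ, lt_min (by linarith) hR,
    hψ.mono (ball_subset_ball (min_le_left _ _)), hψφ.trans hφ0⟩
  exact absurd (le_csSup hA hmem) (not_le.2 (lt_min (by linarith) hlt))

theorem IsTimeInverse.mapsTo_ball (h : IsTimeInverse U₀ τ a R φ) :
    MapsTo τ (sublevel U₀ τ a R) (ball 0 R) := fun x hx =>
  mem_ball_zero_iff.2 (by simpa only [h.apply_self, sub_zero] using (sublevel_subset R hx).2)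

theorem IsTimeInverse.leftInvOn (h : IsTimeInverse U₀ τ a R φ) (hτ : IsLocallyBiholomorphic τ U₀) :
    LeftInvOn φ τ (sublevel U₀ τ a R) := by
  suffices hsub : sublevel U₀ τ a R ⊆ φ '' ball 0 R by
    intro x hx
    obtain ⟨t, ht, rfl⟩ := hsub hx
    rw [h.isLift.right_inv t ht]
  refine IsPreconnected.subset_of_closure_inter_subset isPreconnected_connectedComponentIn
    (hτ.isOpen_image_of_isLift h.isLift isOpen_ball)
    ⟨φ 0, h.mapsTo_sublevel (mem_ball_self h.radius_pos), 0, mem_ball_self h.radius_pos, rfl⟩ ?_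
  rintro x ⟨hxc, hx⟩
  refine ⟨τ x, h.mapsTo_ball hx, ?_⟩
  have : (𝓝[φ '' ball 0 R] x).NeBot := mem_closure_iff_nhdsWithin_neBot.1 hxc
  have hcont : ContinuousAt (φ ∘ τ) x :=
    (h.isLift.analyticOnNhd _ (h.mapsTo_ball hx)).continuousAt.comp
      (hτ.analyticOnNhd x (sublevel_subset R hx).1).continuousAt
  have hid : Tendsto (φ ∘ τ) (𝓝[φ '' ball 0 R] x) (𝓝 x) := by
    refine Tendsto.congr' (f₁ := id) ?_ (tendsto_id.mono_left nhdsWithin_le_nhds)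
    filter_upwards [self_mem_nhdsWithin]
    rintro _ ⟨t, ht, rfl⟩
    rw [Function.comp_apply, h.isLift.right_inv t ht, id]
  exact tendsto_nhds_unique (hcont.tendsto.mono_left nhdsWithin_le_nhds) hid

/-! ### Boundary values of the inverse natural time -/

-- Otherwise `f` crosses a small sphere around a cluster point arbitrarily close to `p`, and `K`
-- meets that sphere in a further cluster point; finitely many cluster points leave a sphere free.
theorem exists_tendsto_of_finite_mapClusterPt {E Y : Type*} [NormedAddCommGroup E]
    [NormedSpace ℝ E] [MetricSpace Y] {D : Set E} (hD : Convex ℝ D) {p : E} (hp : p ∈ closure D)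
    {f : E → Y} (hf : ContinuousOn f D) {K F : Set Y} (hK : IsCompact K) (hfK : MapsTo f D K)
    (hF : F.Finite) (hKF : ∀ s ∈ K, MapClusterPt s (𝓝[D] p) f → s ∈ F) :
    ∃ s ∈ K, Tendsto f (𝓝[D] p) (𝓝 s) := by
  have : (𝓝[D] p).NeBot := mem_closure_iff_nhdsWithin_neBot.1 hp
  have hDmem : ∀ᶠ t in 𝓝[D] p, f t ∈ K := mem_of_superset self_mem_nhdsWithin hfK
  obtain ⟨s, hs, hcl⟩ := hK.exists_mapClusterPt (le_principal_iff.2 (mem_map.2 hDmem))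
  refine ⟨s, hs, Metric.tendsto_nhds.2 fun ε hε => ?_⟩
  obtain ⟨η, ⟨hη, hηε⟩, hηF⟩ : (Ioo 0 ε \ (dist · s) '' F).Nonempty :=
    ((Ioo_infinite hε).sdiff (hF.image _)).nonempty
  have hsphere : ∀ᶠ t in 𝓝[D] p, dist (f t) s ≠ η := by
    by_contra hcon
    have hfreq := (not_eventually.1 hcon).and_eventually hDmem
    obtain ⟨x, ⟨hxK, hxs⟩, hx⟩ :=
      (hK.inter_right (isClosed_sphere (x := s) (ε := η))).exists_mapClusterPt_of_frequently
        (hfreq.mono fun t ht => ⟨ht.2, not_not.1 ht.1⟩)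
    exact hηF ⟨x, hKF x hxK hx, hxs⟩
  obtain ⟨δ, hδ, hball⟩ := Metric.mem_nhdsWithin_iff.1 hsphere
  have hV : ball p δ ∩ D ∈ 𝓝[D] p :=
    inter_mem (mem_nhdsWithin_of_mem_nhds (ball_mem_nhds p hδ)) self_mem_nhdsWithin
  obtain ⟨t₀, hnear, ht₀⟩ := ((hcl.frequently (ball_mem_nhds s hη)).and_eventually hV).exists
  filter_upwards [hV] with t ht
  by_contra! hfar
  obtain ⟨x, hx, hxη⟩ := ((convex_ball p δ).inter hD).isPreconnected.intermediate_value ht₀ ht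
    ((continuous_id.dist continuous_const).comp_continuousOn (hf.mono inter_subset_right))
    ⟨(mem_ball.1 hnear).le, hηε.le.trans hfar⟩
  exact hball hx hxη

theorem nhdsWithin_ball_neBot {p : ℂ} (hR : 0 < R) (hp : ‖p‖ = R) :
    (𝓝[ball (0 : ℂ) R] p).NeBot := by
  rw [← mem_closure_iff_nhdsWithin_neBot, closure_ball _ hR.ne']
  exact mem_closedBall_zero_iff.2 hp.le

namespace IsTimeInverse

theorem exists_tendsto (h : IsTimeInverse U₀ τ a R φ) (hτ : IsLocallyBiholomorphic τ U₀)
    (hb : Bornology.IsBounded (sublevel U₀ τ a R))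
    (hfin : (frontier (sublevel U₀ τ a R) ∩ frontier U₀).Finite) {p : ℂ} (hp : ‖p‖ = R) :
    ∃ s ∈ closure (sublevel U₀ τ a R), Tendsto φ (𝓝[ball 0 R] p) (𝓝 s) := by
  have hmaps : MapsTo φ (ball 0 R) (closure (sublevel U₀ τ a R)) :=
    h.mapsTo_sublevel.mono_right subset_closure
  by_cases hreg : ∃ s ∈ closure (sublevel U₀ τ a R), s ∈ U₀ ∧ MapClusterPt s (𝓝[ball 0 R] p) φ
  · obtain ⟨s, hs, hsU, hcl⟩ := hreg
    obtain ⟨ψ, δ, hδ, hψ, hψs, hψφ⟩ :=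
      hτ.exists_extension_of_mapClusterPt h.isLift isOpen_ball (convex_ball _ _) hsU hcl
    refine ⟨s, hs, hψs ▸ ((hψ.analyticOnNhd p (mem_ball_self hδ)).continuousAt.tendsto.mono_left
      nhdsWithin_le_nhds).congr' ?_⟩
    exact mem_of_superset (inter_mem (mem_nhdsWithin_of_mem_nhds (ball_mem_nhds p hδ))
      self_mem_nhdsWithin) hψφ
  · push Not at hreg
    exact exists_tendsto_of_finite_mapClusterPt (convex_ball _ _)
      (mem_closure_iff_nhdsWithin_neBot.2 (nhdsWithin_ball_neBot h.radius_pos hp))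
      h.isLift.analyticOnNhd.continuousOn hb.isCompact_closure hmaps hfin fun s hs hcl =>
      hτ.mem_frontier_inter_frontier hs fun hsU => hreg s hs hsU hcl

theorem eq_of_tendsto (h : IsTimeInverse U₀ τ a R φ) {p s t₀ : ℂ} (hp : ‖p‖ = R)
    (hlim : Tendsto φ (𝓝[ball 0 R] p) (𝓝 s)) (ht₀ : Tendsto τ (𝓝[U₀] s) (𝓝 t₀)) : p = t₀ := by
  have := nhdsWithin_ball_neBot h.radius_pos hp
  have hlimU : Tendsto φ (𝓝[ball 0 R] p) (𝓝[U₀] s) :=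
    tendsto_nhdsWithin_iff.2 ⟨hlim, eventually_mem_nhdsWithin.mono h.isLift.mem⟩
  have hid : Tendsto id (𝓝[ball 0 R] p) (𝓝 t₀) :=
    (ht₀.comp hlimU).congr' (eventually_mem_nhdsWithin.mono h.isLift.right_inv)
  exact tendsto_nhds_unique (tendsto_id.mono_left nhdsWithin_le_nhds) hid

variable {s₀ t₀ : ℂ}

theorem tendsto_comp (h : IsTimeInverse U₀ τ a R φ) (hτ : IsLocallyBiholomorphic τ U₀) :
    Tendsto (φ ∘ τ) (𝓝[sublevel U₀ τ a R] s₀) (𝓝 s₀) :=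
  (tendsto_id.mono_left nhdsWithin_le_nhds).congr'
    (eventually_mem_nhdsWithin.mono fun _ hs => (h.leftInvOn hτ hs).symm)

theorem tendsto_nhdsWithin_ball (h : IsTimeInverse U₀ τ a R φ)
    (ht₀ : Tendsto τ (𝓝[U₀] s₀) (𝓝 t₀)) :
    Tendsto τ (𝓝[sublevel U₀ τ a R] s₀) (𝓝[ball 0 R] t₀) :=
  tendsto_nhdsWithin_iff.2
    ⟨ht₀.mono_left (nhdsWithin_mono _ fun _ hs => (sublevel_subset R hs).1),
      eventually_mem_nhdsWithin.mono h.mapsTo_ball⟩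

theorem norm_eq_of_tendsto (h : IsTimeInverse U₀ τ a R φ) (hτ : IsLocallyBiholomorphic τ U₀)
    (hs₀ : s₀ ∈ closure (sublevel U₀ τ a R)) (hs₀U : s₀ ∉ U₀)
    (ht₀ : Tendsto τ (𝓝[U₀] s₀) (𝓝 t₀)) : ‖t₀‖ = R := by
  have := mem_closure_iff_nhdsWithin_neBot.1 hs₀
  have hτC := h.tendsto_nhdsWithin_ball ht₀
  have hle : ‖t₀‖ ≤ R := le_of_tendsto (tendsto_nhdsWithin_iff.1 hτC).1.norm
    (eventually_mem_nhdsWithin.mono fun s hs => (mem_ball_zero_iff.1 (h.mapsTo_ball hs)).le)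
  refine hle.eq_of_not_lt fun hlt => hs₀U ?_
  have hmem : t₀ ∈ ball 0 R := mem_ball_zero_iff.2 hlt
  have hlim := ((h.isLift.analyticOnNhd t₀ hmem).continuousAt.tendsto.mono_left
    nhdsWithin_le_nhds).comp hτC
  exact tendsto_nhds_unique (h.tendsto_comp hτ) hlim ▸ h.isLift.mem t₀ hmem

theorem tendsto_of_tendsto (h : IsTimeInverse U₀ τ a R φ) (hτ : IsLocallyBiholomorphic τ U₀)
    (hb : Bornology.IsBounded (sublevel U₀ τ a R))
    (hfin : (frontier (sublevel U₀ τ a R) ∩ frontier U₀).Finite)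
    (hs₀ : s₀ ∈ closure (sublevel U₀ τ a R)) (hs₀U : s₀ ∉ U₀)
    (ht₀ : Tendsto τ (𝓝[U₀] s₀) (𝓝 t₀)) : Tendsto φ (𝓝[ball 0 R] t₀) (𝓝 s₀) := by
  have := mem_closure_iff_nhdsWithin_neBot.1 hs₀
  obtain ⟨s, -, hs⟩ := h.exists_tendsto hτ hb hfin (h.norm_eq_of_tendsto hτ hs₀ hs₀U ht₀)
  rwa [tendsto_nhds_unique (h.tendsto_comp hτ) (hs.comp (h.tendsto_nhdsWithin_ball ht₀))]

end IsTimeInverse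

end Lift

/-! ### The critical points -/

/-- The derivative `θ̃'` of the angle of the Hamiltonian along the real axis, continued to complex
`s`: differentiating `tan θ̃ = X / Z` gives this formula. -/
noncomputable def angleDeriv (X Z : ℂ → ℂ) (s : ℂ) : ℂ :=
  (deriv X s * Z s - X s * deriv Z s) / rhoSq X Z s

section CriticalForm

variable {X Z : ℂ → ℂ} {s₀ : ℂ} {m : ℤ} {n : ℕ} {ε : ℤ}

theorem rhoSq_eq_of_eq_mul {A a b c s : ℂ} (hc : c ^ 2 = -1) (hX : X s = A * a)
    (hZ : Z s = c * A * b) : rhoSq X Z s = A ^ 2 * (a ^ 2 - b ^ 2) := by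
  rw [rhoSq, hX, hZ]
  linear_combination (A * b) ^ 2 * hc

-- The common factor `A` drops out of the Wronskian of `X` and `Z` divided by `X² + Z²`.
theorem angleDeriv_eq_of_eventually_eq_mul {A a b : ℂ → ℂ} {a' b' c s : ℂ} (hc : c ^ 2 = -1)
    (hA : DifferentiableAt ℂ A s) (hA₀ : A s ≠ 0) (ha : HasDerivAt a a' s)
    (hb : HasDerivAt b b' s) (hX : ∀ᶠ x in 𝓝 s, X x = A x * a x)
    (hZ : ∀ᶠ x in 𝓝 s, Z x = c * A x * b x) :
    angleDeriv X Z s = c * (a' * b s - a s * b') / (a s ^ 2 - b s ^ 2) := by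
  have hX' := ((hA.hasDerivAt.mul ha).congr_of_eventuallyEq hX).deriv
  have hZ' := (((hA.hasDerivAt.const_mul c).mul hb).congr_of_eventuallyEq hZ).deriv
  rw [angleDeriv, rhoSq_eq_of_eq_mul hc hX.self_of_nhds hZ.self_of_nhds, hX', hZ',
    hX.self_of_nhds, hZ.self_of_nhds,
    ← mul_div_mul_left (c * _) _ (pow_ne_zero 2 hA₀)]
  congr 1
  ring

theorem one_add_pow_mul_sq_sub_sq (u x z : ℂ) (n : ℕ) :
    (1 + u ^ n * x) ^ 2 - (1 + u ^ n * z) ^ 2 = u ^ n * ((x - z) * (2 + u ^ n * (x + z))) := by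
  ring

theorem hasDerivAt_one_add_pow_mul {g : ℂ → ℂ} {s : ℂ} (hg : DifferentiableAt ℂ g (s - s₀)) :
    HasDerivAt (fun x => 1 + (x - s₀) ^ n * g (x - s₀))
      (n * (s - s₀) ^ (n - 1) * g (s - s₀) + (s - s₀) ^ n * deriv g (s - s₀)) s := by
  simpa using ((((hasDerivAt_id s).sub_const s₀).pow n).mul
    (hg.hasDerivAt.comp_sub_const s s₀)).const_add 1

theorem tendsto_sub_nhdsNE (s₀ : ℂ) : Tendsto (fun s => s - s₀) (𝓝[≠] s₀) (𝓝 0) :=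
  tendsto_sub_nhds_zero_iff.2 (tendsto_id.mono_left nhdsWithin_le_nhds)

theorem HasCriticalForm.order_pos (h : HasCriticalForm X Z s₀ m n ε) : 0 < 2 * m + n + 2 := by
  have h' : (-2 : ℝ) < 2 * m + n := by linarith [h.2.1]
  have : (-2 : ℤ) < 2 * m + n := by exact_mod_cast h'
  linarith

theorem HasCriticalForm.sign_mul_I_sq (h : HasCriticalForm X Z s₀ m n ε) :
    ((ε : ℂ) * I) ^ 2 = -1 := by
  rcases h.2.2.1 with rfl | rfl <;> norm_num [mul_pow]

theorem HasCriticalForm.exists_rhoSq_eq (h : HasCriticalForm X Z s₀ m n ε) :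
    ∃ q : ℂ → ℂ, AnalyticAt ℂ q 0 ∧ q 0 ≠ 0 ∧
      ∀ᶠ s in 𝓝[≠] s₀, rhoSq X Z s = (s - s₀) ^ (2 * m + n) * q (s - s₀) := by
  have hc := h.sign_mul_I_sq
  obtain ⟨hn, -, -, f, gX, gZ, hf, hgX, hgZ, hne, hform⟩ := h
  obtain ⟨hf₀, hd₀⟩ := mul_ne_zero_iff.1 (norm_pos_iff.1 hne)
  refine ⟨fun u => f u ^ 2 * ((gX u - gZ u) * (2 + u ^ n * (gX u + gZ u))), by fun_prop,
    mul_ne_zero hf₀ (mul_ne_zero hd₀ (by simp [hn.ne'])), ?_⟩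
  filter_upwards [hform, self_mem_nhdsWithin] with s ⟨hX, hZ⟩ hs
  rw [rhoSq_eq_of_eq_mul (b := 1 + (s - s₀) ^ n * gZ (s - s₀)) hc hX (hZ.trans (by ring)),
    one_add_pow_mul_sq_sub_sq, zpow_add₀ (sub_ne_zero.2 hs), zpow_mul', zpow_natCast]
  norm_cast
  ring

theorem HasCriticalForm.exists_angleDeriv_eq (h : HasCriticalForm X Z s₀ m n ε) :
    ∃ g : ℂ → ℂ, AnalyticAt ℂ g 0 ∧ g 0 = ε * I * n / 2 ∧
      ∀ᶠ s in 𝓝[≠] s₀, (s - s₀) * angleDeriv X Z s = g (s - s₀) := by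
  have hc := h.sign_mul_I_sq
  obtain ⟨hn, -, -, f, gX, gZ, hf, hgX, hgZ, hne, hform⟩ := h
  obtain ⟨hf₀, hd₀⟩ := mul_ne_zero_iff.1 (norm_pos_iff.1 hne)
  replace hf₀ := ne_zero_pow two_ne_zero hf₀
  set d := fun u => (gX u - gZ u) * (2 + u ^ n * (gX u + gZ u)) with hd
  have hda : AnalyticAt ℂ d 0 := by fun_prop
  have hd0 : d 0 ≠ 0 := mul_ne_zero hd₀ (by simp [hn.ne'])
  refine ⟨fun u => ε * I * (n * (gX u - gZ u) + u * (deriv gX u - deriv gZ u) +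
    u ^ (n + 1) * (deriv gX u * gZ u - gX u * deriv gZ u)) / d u, ?_, ?_, ?_⟩
  · have := hgX.deriv
    have := hgZ.deriv
    exact AnalyticAt.div (by fun_prop) hda hd0
  · simp only [hd, hn.ne', zero_mul, add_zero, ne_eq, not_false_eq_true, zero_pow,
      Nat.succ_ne_zero]
    field_simp
  have hsub := tendsto_sub_nhdsNE s₀
  filter_upwards [eventually_eventually_nhdsWithin.2 hform, self_mem_nhdsWithin,
    hsub.eventually hf.eventually_analyticAt, hsub.eventually hgX.eventually_analyticAt,
    hsub.eventually hgZ.eventually_analyticAt, hsub.eventually (hf.continuousAt.eventually_ne hf₀),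
    hsub.eventually (hda.continuousAt.eventually_ne hd0)] with s hs hs₀ hfs hXs hZs hfs₀ hds₀
  rw [isOpen_compl_singleton.nhdsWithin_eq hs₀] at hs
  have hu : s - s₀ ≠ 0 := sub_ne_zero.2 hs₀
  have hA : DifferentiableAt ℂ (fun x => (x - s₀) ^ m * f (x - s₀)) s :=
    ((differentiableAt_id.sub_const s₀).zpow (.inl hu)).mul
      (hfs.differentiableAt.hasDerivAt.comp_sub_const s s₀).differentiableAt
  rw [angleDeriv_eq_of_eventually_eq_mul hc hA (mul_ne_zero (zpow_ne_zero m hu) hfs₀)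
      (hasDerivAt_one_add_pow_mul hXs.differentiableAt)
      (hasDerivAt_one_add_pow_mul hZs.differentiableAt) (hs.mono fun x hx => hx.1)
      (hs.mono fun x hx => hx.2.trans (by ring)), one_add_pow_mul_sq_sub_sq]
  obtain ⟨j, rfl⟩ := Nat.exists_eq_succ_of_ne_zero hn.ne'
  rw [Nat.succ_sub_one]
  simp only [Nat.succ_eq_add_one, hd] at hds₀ ⊢
  field_simp
  push_cast
  ring

end CriticalForm

/-- Near `s₀`, which is typically a boundary point of `U₀`, the function `τ - t₀` on `U₀` is a
constant times `(s - s₀) ^ (M / 2)` to leading order. The two relations, with `κ 0 = 2 / M`, say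
this without naming a branch of the power: they describe the logarithmic derivative and the square
of `τ - t₀`. -/
def HasBranchPoint (τ : ℂ → ℂ) (U₀ : Set ℂ) (s₀ t₀ : ℂ) (M : ℕ) : Prop :=
  ∃ κ l : ℂ → ℂ, AnalyticAt ℂ κ 0 ∧ κ 0 = 2 / M ∧ AnalyticAt ℂ l 0 ∧ l 0 ≠ 0 ∧
    ∀ᶠ s in 𝓝[U₀] s₀, τ s - t₀ = (s - s₀) * κ (s - s₀) * deriv τ s ∧
      (τ s - t₀) ^ 2 = (s - s₀) ^ M * l (s - s₀)

section BranchPoint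

variable {τ : ℂ → ℂ} {U₀ : Set ℂ} {s₀ t₀ : ℂ} {M : ℕ}

theorem HasBranchPoint.tendsto (h : HasBranchPoint τ U₀ s₀ t₀ M) (hM : M ≠ 0) :
    Tendsto τ (𝓝[U₀] s₀) (𝓝 t₀) := by
  obtain ⟨κ, l, -, -, hl, -, hev⟩ := h
  have hsub : Tendsto (fun s => s - s₀) (𝓝[U₀] s₀) (𝓝 0) :=
    tendsto_sub_nhds_zero_iff.2 (tendsto_id.mono_left nhdsWithin_le_nhds)
  have hsq : Tendsto (fun s => (τ s - t₀) ^ 2) (𝓝[U₀] s₀) (𝓝 0) := by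
    have := (hsub.pow M).mul (hl.continuousAt.tendsto.comp hsub)
    rw [zero_pow hM, zero_mul] at this
    exact this.congr' (hev.mono fun s hs => hs.2.symm)
  have hsqrt : Tendsto (fun s => √‖(τ s - t₀) ^ 2‖) (𝓝[U₀] s₀) (𝓝 0) := by
    simpa only [Function.comp_def, norm_zero, Real.sqrt_zero] using
      (Real.continuous_sqrt.tendsto _).comp hsq.norm
  rw [tendsto_iff_norm_sub_tendsto_zero]
  simpa only [norm_pow, Real.sqrt_sq (norm_nonneg _)] using hsqrt

theorem hasDerivAt_of_sq_eq_zpow {w : ℂ → ℂ} {s : ℂ} {N : ℤ} (hw : DifferentiableAt ℂ w s)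
    (hs : s ≠ s₀) (h : ∀ᶠ x in 𝓝 s, w x ^ 2 = (x - s₀) ^ N) :
    HasDerivAt w (N * w s / (2 * (s - s₀))) s := by
  have hu : s - s₀ ≠ 0 := sub_ne_zero.2 hs
  have hsq : 2 * w s * deriv w s = N * (s - s₀) ^ (N - 1) := by
    have hpow := (hasDerivAt_zpow N _ (.inl hu)).comp_sub_const s s₀
    simpa using (hw.hasDerivAt.pow 2).unique (hpow.congr_of_eventuallyEq h)
  have hs₂ := h.self_of_nhds
  have hw₀ : w s ≠ 0 := ne_zero_pow two_ne_zero (hs₂ ▸ zpow_ne_zero N hu)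
  refine hw.hasDerivAt.congr_deriv ?_
  rw [zpow_sub_one₀ hu, ← hs₂] at hsq
  field_simp at hsq ⊢
  linear_combination hsq

-- `k w` is the derivative of `(s - s₀) ^ (N / 2 + 1) k`, where `w = (s - s₀) ^ (N / 2)`.
theorem hasDerivAt_sub_mul_mul {w k : ℂ → ℂ} {P s : ℂ} {N : ℤ} (hw : DifferentiableAt ℂ w s)
    (hs : s ≠ s₀) (h : ∀ᶠ x in 𝓝 s, w x ^ 2 = (x - s₀) ^ N)
    (hk : DifferentiableAt ℂ k (s - s₀))
    (hP : (N / 2 + 1) * k (s - s₀) + (s - s₀) * deriv k (s - s₀) = P) :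
    HasDerivAt (fun x => (x - s₀) * k (x - s₀) * w x) (P * w s) s := by
  have hu : s - s₀ ≠ 0 := sub_ne_zero.2 hs
  refine ((((hasDerivAt_id s).sub_const s₀).mul (hk.hasDerivAt.comp_sub_const s s₀)).mul
    (hasDerivAt_of_sq_eq_zpow hw hs h)).congr_deriv ?_
  rw [← hP]
  simp only [id_eq, Pi.mul_apply]
  field_simp
  ring

theorem exists_eventually_eq_add_of_hasDerivAt {E : ℂ → ℂ} (hU₀ : IsOpen U₀)
    (hτ : AnalyticOnNhd ℂ τ U₀) (hs₀ : s₀ ∈ closure U₀)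
    (htip : ∀ W ∈ 𝓝 s₀, ∃ V ∈ 𝓝 s₀, V ⊆ W ∧ IsPreconnected (V ∩ U₀))
    (hE : ∀ᶠ s in 𝓝[U₀] s₀, HasDerivAt E (deriv τ s) s) :
    ∃ t₀, ∀ᶠ s in 𝓝[U₀] s₀, τ s = t₀ + E s := by
  obtain ⟨W, hW, hsW, hWE⟩ := mem_nhdsWithin.1 hE
  obtain ⟨V, hV, hVW, hVc⟩ := htip W (hW.mem_nhds hsW)
  obtain ⟨x₀, hx₀⟩ := mem_closure_iff_nhds.1 hs₀ V hV
  set O := connectedComponentIn (W ∩ U₀) x₀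
  have hO : O ⊆ W ∩ U₀ := connectedComponentIn_subset _ _
  have hder : ∀ s ∈ O, HasDerivAt (fun s => τ s - E s) 0 s := fun s hs => by
    simpa only [sub_self] using
      (hτ s (hO hs).2).differentiableAt.hasDerivAt.fun_sub (hWE (hO hs))
  obtain ⟨t₀, ht₀⟩ := (hW.inter hU₀).connectedComponentIn.exists_is_const_of_deriv_eq_zero
    isPreconnected_connectedComponentIn
    (fun s hs => (hder s hs).differentiableAt.differentiableWithinAt)
    (fun s hs => (hder s hs).deriv)
  have hVO : V ∩ U₀ ⊆ O :=
    hVc.subset_connectedComponentIn hx₀ (inter_subset_inter_left _ hVW)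
  refine ⟨t₀, ?_⟩
  filter_upwards [self_mem_nhdsWithin, mem_nhdsWithin_of_mem_nhds hV] with s hsU hsV
  exact sub_eq_iff_eq_add.1 (ht₀ s (hVO ⟨hsV, hsU⟩))

-- The function `k` solves `(M / 2) k + u k' = 2 p`.
theorem exists_eventually_hasDerivAt_of_sq_eq_zpow {v p : ℂ → ℂ} {N : ℤ} (hU₀ : IsOpen U₀)
    (hv : AnalyticOnNhd ℂ v U₀) (hM : M ≠ 0) (hMN : (M : ℤ) = N + 2) (hp : AnalyticAt ℂ p 0)
    (hp₀ : p 0 ≠ 0) (hs₀ : s₀ ∉ U₀)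
    (hw : ∀ᶠ s in 𝓝[U₀] s₀, (v s / (2 * p (s - s₀))) ^ 2 = (s - s₀) ^ N) :
    ∃ k : ℂ → ℂ, AnalyticAt ℂ k 0 ∧ k 0 = 4 * p 0 / M ∧ ∀ᶠ s in 𝓝[U₀] s₀,
      HasDerivAt (fun x => (x - s₀) * k (x - s₀) * (v x / (2 * p (x - s₀)))) (v s) s := by
  obtain ⟨k, hk, hode⟩ := exists_analyticAt_mul_add_mul_deriv_eq
    (analyticAt_const (v := (2 : ℂ)).mul hp) (a := M / 2) (by positivity)
  simp only [ofReal_div, ofReal_natCast, ofReal_ofNat, Pi.mul_apply] at hode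
  have hMc : (M : ℂ) ≠ 0 := Nat.cast_ne_zero.2 hM
  have hMN' : (M : ℂ) / 2 = N / 2 + 1 := by
    rw [show (M : ℂ) = N + 2 by exact_mod_cast hMN]; ring
  refine ⟨k, hk, ?_, ?_⟩
  · have := hode.self_of_nhds
    simp only [zero_mul, add_zero] at this
    field_simp
    linear_combination 2 * this
  have hsub : Tendsto (fun s => s - s₀) (𝓝[U₀] s₀) (𝓝 0) :=
    tendsto_sub_nhds_zero_iff.2 (tendsto_id.mono_left nhdsWithin_le_nhds)
  filter_upwards [self_mem_nhdsWithin, eventually_eventually_nhdsWithin.2 hw,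
    hsub.eventually (hp.continuousAt.eventually_ne hp₀),
    hsub.eventually hk.eventually_analyticAt, hsub.eventually hp.eventually_analyticAt,
    hsub.eventually hode] with s hs hws hps hka hpa hodes
  rw [hU₀.nhdsWithin_eq hs] at hws
  have hdiff : DifferentiableAt ℂ (fun x => v x / (2 * p (x - s₀))) s :=
    (hv s hs).differentiableAt.fun_div
      ((hpa.differentiableAt.hasDerivAt.comp_sub_const s s₀).differentiableAt.const_mul 2)
      (mul_ne_zero two_ne_zero hps)
  exact (hasDerivAt_sub_mul_mul hdiff (ne_of_mem_of_not_mem hs hs₀) hws hka.differentiableAt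
    (hMN' ▸ hodes)).congr_deriv (mul_div_cancel₀ _ (mul_ne_zero two_ne_zero hps))

-- With `ρ² = (s - s₀) ^ N p²`, the primitive of `τ' = ± 2 ρ` has the form `(s - s₀) k τ' / (2 p)`.
theorem exists_hasBranchPoint {rho q : ℂ → ℂ} {N : ℤ} (hU₀ : IsOpen U₀)
    (hτ : AnalyticOnNhd ℂ τ U₀) (hsq : ∀ s ∈ U₀, deriv τ s ^ 2 = 4 * rho s) (hM : M ≠ 0)
    (hMN : (M : ℤ) = N + 2) (hq : AnalyticAt ℂ q 0) (hq₀ : q 0 ≠ 0) (hs₀ : s₀ ∉ U₀)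
    (hs₀' : s₀ ∈ closure U₀) (hrho : ∀ᶠ s in 𝓝[≠] s₀, rho s = (s - s₀) ^ N * q (s - s₀))
    (htip : ∀ W ∈ 𝓝 s₀, ∃ V ∈ 𝓝 s₀, V ⊆ W ∧ IsPreconnected (V ∩ U₀)) :
    ∃ t₀, HasBranchPoint τ U₀ s₀ t₀ M := by
  obtain ⟨p, hp, hp₀, hpq⟩ := exists_analyticAt_pow_eq hq hq₀ two_ne_zero
  have hMc : (M : ℂ) ≠ 0 := Nat.cast_ne_zero.2 hM
  have hU₀s₀ : U₀ ⊆ {s₀}ᶜ := fun s hs h => hs₀ (h ▸ hs)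
  have hp₀ev := ((tendsto_sub_nhdsNE s₀).mono_left (nhdsWithin_mono _ hU₀s₀)).eventually
    (hp.continuousAt.eventually_ne hp₀)
  have hw : ∀ᶠ s in 𝓝[U₀] s₀, (deriv τ s / (2 * p (s - s₀))) ^ 2 = (s - s₀) ^ N := by
    filter_upwards [self_mem_nhdsWithin, nhdsWithin_mono _ hU₀s₀ hrho, hp₀ev] with s hs hr hps
    rw [div_pow, hsq s hs, hr, ← hpq]
    field_simp
    ring
  obtain ⟨k, hk, hk₀, hE⟩ :=
    exists_eventually_hasDerivAt_of_sq_eq_zpow hU₀ hτ.deriv hM hMN hp hp₀ hs₀ hw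
  obtain ⟨t₀, ht₀⟩ := exists_eventually_eq_add_of_hasDerivAt hU₀ hτ hs₀' htip hE
  refine ⟨t₀, fun u => k u / (2 * p u), fun u => k u ^ 2,
    hk.div (analyticAt_const.mul hp) (mul_ne_zero two_ne_zero hp₀), ?_, hk.pow 2, ?_, ?_⟩
  · simp only [hk₀]
    field_simp
    norm_num
  · simp only [hk₀]
    exact pow_ne_zero 2 (div_ne_zero (mul_ne_zero (by norm_num) hp₀) hMc)
  · filter_upwards [self_mem_nhdsWithin, ht₀, hw] with s hs ht hws
    rw [ht, add_sub_cancel_left]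
    refine ⟨by ring, ?_⟩
    rw [mul_pow, hws, ← zpow_natCast _ M, hMN, zpow_add₀ (sub_ne_zero.2 (hU₀s₀ hs))]
    norm_cast
    ring

theorem exists_eq_const_of_pow_eq {f : ℂ → ℂ} {D : Set ℂ} (hD : IsPreconnected D)
    (hf : ContinuousOn f D) (hM : M ≠ 0) {w : ℂ} (hw : ∀ t ∈ D, f t ^ M = w) :
    ∃ c, ∀ t ∈ D, f t = c := by
  rcases D.eq_empty_or_nonempty with rfl | ⟨x, hx⟩
  · exact ⟨0, fun _ => False.elim⟩
  have hfin : {z : ℂ | z ^ M = w}.Finite :=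
    (Polynomial.nthRoots M w).toFinset.finite_toSet.subset fun z hz => by
      simpa [Polynomial.mem_nthRoots hM.bot_lt] using hz
  exact ⟨f x, fun t ht => hD.constant_of_mapsTo hfin.isDiscrete hf hw ht hx⟩

theorem exists_eq_mul_of_pow_eq_mul_pow {f y : ℂ → ℂ} {D : Set ℂ} (hD : IsPreconnected D)
    (hf : ContinuousOn f D) (hy : ContinuousOn y D) (hy₀ : ∀ t ∈ D, y t ≠ 0) (hM : M ≠ 0) {w : ℂ}
    (hw : ∀ t ∈ D, f t ^ M = w * y t ^ M) : ∃ c, ∀ t ∈ D, f t = c * y t := by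
  obtain ⟨c, hc⟩ := exists_eq_const_of_pow_eq hD (hf.div hy hy₀) hM (w := w) fun t ht => by
    rw [Pi.div_apply, div_pow, div_eq_iff (pow_ne_zero M (hy₀ t ht)), hw t ht]
  exact ⟨c, fun t ht => (div_eq_iff (hy₀ t ht)).1 (hc t ht)⟩

theorem cpow_two_div_natCast_pow (hM : M ≠ 0) (z : ℂ) :
    (z ^ ((2 / M : ℝ) : ℂ)) ^ M = z ^ 2 := by
  rw [← cpow_nat_mul]
  have hMc : (M : ℂ) ≠ 0 := Nat.cast_ne_zero.2 hM
  rw [show (M : ℂ) * ((2 / M : ℝ) : ℂ) = (2 : ℕ) by push_cast; field_simp, cpow_natCast]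

theorem exists_analyticAt_comp_mul_eq {l : ℂ → ℂ} (hl : AnalyticAt ℂ l 0) (hl₀ : l 0 ≠ 0)
    (hM : M ≠ 0) :
    ∃ V ψ : ℂ → ℂ, AnalyticAt ℂ V 0 ∧ (∀ u, V u ^ M = u ^ M * l u) ∧ AnalyticAt ℂ ψ 0 ∧ ψ 0 = 0 ∧
      ∀ᶠ u in 𝓝 0, ψ (V u) = u := by
  obtain ⟨κ, hκ, hκ₀, hκM⟩ := exists_analyticAt_pow_eq hl hl₀ hM
  have hV' : deriv (fun u => u * κ u) 0 ≠ 0 := by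
    have := ((hasDerivAt_id (0 : ℂ)).mul hκ.differentiableAt.hasDerivAt).deriv
    simp only [id_eq, one_mul, zero_mul, add_zero] at this
    exact this ▸ hκ₀
  obtain ⟨ψ, hψ, hψ₀, -, hψV⟩ := exists_analyticAt_eventually_inverse (analyticAt_id.mul hκ) hV'
  simp only [Pi.mul_apply, id_eq, zero_mul] at hψ hψ₀
  exact ⟨fun u => u * κ u, ψ, analyticAt_id.mul hκ, fun u => by rw [mul_pow, hκM], hψ, hψ₀, hψV⟩

variable {φ G g : ℂ → ℂ} {R : ℝ}

-- `(φ - s₀) κ (φ - s₀)`, with `κ ^ M = l`, and `(1 - t / t₀) ^ (2 / M)` have proportional `M`-th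
-- powers, hence are proportional near `t₀`.
theorem IsLift.exists_sub_eq_cpow (h : IsLift U₀ τ φ (ball 0 R)) (hR : 0 < R) (ht₀ : ‖t₀‖ = R)
    (hM : M ≠ 0) {l : ℂ → ℂ} (hl : AnalyticAt ℂ l 0) (hl₀ : l 0 ≠ 0)
    (hlim : Tendsto φ (𝓝[ball 0 R] t₀) (𝓝 s₀))
    (hev : ∀ᶠ s in 𝓝[U₀] s₀, (τ s - t₀) ^ 2 = (s - s₀) ^ M * l (s - s₀)) :
    ∃ ψ : ℂ → ℂ, AnalyticAt ℂ ψ 0 ∧ ψ 0 = 0 ∧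
      ∀ᶠ t in 𝓝[ball 0 R] t₀, φ t - s₀ = ψ ((1 - t / t₀) ^ ((2 / M : ℝ) : ℂ)) := by
  have ht₀₀ : t₀ ≠ 0 := norm_pos_iff.1 (ht₀ ▸ hR)
  obtain ⟨V, ψ, hV, hVM, hψ, hψ₀, hψV⟩ := exists_analyticAt_comp_mul_eq hl hl₀ hM
  have hlimU : Tendsto φ (𝓝[ball 0 R] t₀) (𝓝[U₀] s₀) :=
    tendsto_nhdsWithin_iff.2 ⟨hlim, eventually_mem_nhdsWithin.mono h.mem⟩
  have hlim₀ : Tendsto (fun t => φ t - s₀) (𝓝[ball 0 R] t₀) (𝓝 0) :=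
    tendsto_sub_nhds_zero_iff.2 hlim
  have hall := (hlimU.eventually hev).and ((hlim₀.eventually hψV).and
    (hlim₀.eventually hV.eventually_analyticAt))
  obtain ⟨δ, hδ, hb⟩ := Metric.mem_nhdsWithin_iff.1 hall
  set S := ball t₀ δ ∩ ball 0 R
  have hslit : ∀ t ∈ S, 1 - t / t₀ ∈ slitPlane := fun t ht =>
    one_sub_div_mem_slitPlane (t := 0) ht₀₀ (by simp) (by simpa [ht₀] using ht.2)
  obtain ⟨c, hc⟩ := exists_eq_mul_of_pow_eq_mul_pow (D := S) (M := M) (w := t₀ ^ 2)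
    (f := fun t => V (φ t - s₀)) (y := fun t => (1 - t / t₀) ^ ((2 / M : ℝ) : ℂ))
    ((convex_ball _ _).inter (convex_ball _ _)).isPreconnected
    (fun t ht => (ContinuousAt.comp (f := fun t => φ t - s₀) (hb ht).2.2.continuousAt
      ((h.analyticOnNhd t ht.2).continuousAt.sub continuousAt_const)).continuousWithinAt)
    (fun t ht => (ContinuousAt.cpow (f := fun t => 1 - t / t₀) (by fun_prop) continuousAt_const
      (hslit t ht)).continuousWithinAt)
    (fun t ht => by simp [cpow_eq_zero_iff, slitPlane_ne_zero (hslit t ht)]) hM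
    fun t ht => by
      rw [cpow_two_div_natCast_pow hM, hVM, ← (hb ht).1, h.right_inv t ht.2]
      field_simp
      ring
  refine ⟨fun w => ψ (c * w), ?_, by simpa using hψ₀, ?_⟩
  · exact AnalyticAt.fun_comp_of_eq (f := fun w : ℂ => c * w) hψ (by fun_prop) (by simp)
  · filter_upwards [self_mem_nhdsWithin, mem_nhdsWithin_of_mem_nhds (ball_mem_nhds t₀ hδ)]
      with t htR htδ
    rw [← hc t ⟨htδ, htR⟩, (hb ⟨htδ, htR⟩).2.1]

theorem HasBranchPoint.hasBranchedPole (hτ : HasBranchPoint τ U₀ s₀ t₀ M) (hM : M ≠ 0)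
    (h : IsLift U₀ τ φ (ball 0 R)) (hR : 0 < R) (ht₀ : ‖t₀‖ = R)
    (hlim : Tendsto φ (𝓝[ball 0 R] t₀) (𝓝 s₀)) (hg : AnalyticAt ℂ g 0)
    (hG : ∀ᶠ s in 𝓝[≠] s₀, (s - s₀) * G s = g (s - s₀)) :
    HasBranchedPole (fun t => G (φ t) / deriv τ (φ t)) (ball 0 R) t₀ (2 / M) (2 * g 0 / M) := by
  obtain ⟨κ, l, hκ, hκ₀, hl, hl₀, hev⟩ := hτ
  obtain ⟨ψ, hψ, hψ₀, hφψ⟩ :=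
    h.exists_sub_eq_cpow hR ht₀ hM hl hl₀ hlim (hev.mono fun s hs => hs.2)
  have ht₀₀ : t₀ ≠ 0 := norm_pos_iff.1 (ht₀ ▸ hR)
  have hlimU : Tendsto φ (𝓝[ball 0 R] t₀) (𝓝[U₀] s₀) :=
    tendsto_nhdsWithin_iff.2 ⟨hlim, eventually_mem_nhdsWithin.mono h.mem⟩
  refine ⟨fun w => -(1 / t₀) * (g (ψ w) * κ (ψ w)), ?_, ?_, ?_⟩
  · exact analyticAt_const.mul (AnalyticAt.fun_comp_of_eq (g := fun u => g u * κ u)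
      (hg.mul hκ) hψ hψ₀)
  · simp only [hψ₀, hκ₀]
    field_simp
  · filter_upwards [self_mem_nhdsWithin, hφψ, hlimU.eventually hev,
      hlim.eventually (eventually_nhdsWithin_iff.1 hG)] with t ht hψt ⟨hτt, _⟩ hGt
    rw [h.right_inv t ht] at hτt
    have ht' : t - t₀ ≠ 0 := sub_ne_zero.2 fun h' => by simp [h', ht₀] at ht
    obtain ⟨⟨hu, hκt⟩, hd⟩ : (φ t - s₀ ≠ 0 ∧ κ (φ t - s₀) ≠ 0) ∧ deriv τ (φ t) ≠ 0 := by
      rw [← mul_ne_zero_iff, ← mul_ne_zero_iff, ← hτt]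
      exact ht'
    rw [← hψt, ← hGt (sub_ne_zero.1 hu), show 1 - t / t₀ = -(t - t₀) / t₀ by field_simp; ring, hτt]
    field_simp

end BranchPoint

/-! ### The real axis -/

section RealAxis

theorem im_deriv_eq_zero {f : ℂ → ℂ} {x : ℝ} (hf : ∀ᶠ y : ℝ in 𝓝 x, (f y).im = 0) :
    (deriv f x).im = 0 := by
  by_cases hd : DifferentiableAt ℂ f x
  · have h := imCLM.hasFDerivAt.comp_hasDerivAt x hd.hasDerivAt.comp_ofReal
    exact h.unique ((hasDerivAt_const x (0 : ℝ)).congr_of_eventuallyEq hf)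
  · rw [deriv_zero_of_not_differentiableAt hd, zero_im]

theorem eventually_eq_add_im_log {θ r : ℝ → ℝ} {W : ℝ → ℂ} {x : ℝ} (hθ : ContinuousAt θ x)
    (hW : ∀ᶠ y in 𝓝 x, 0 < r y ∧ W y = r y * exp (θ y * I)) :
    ∀ᶠ y in 𝓝 x, θ y = θ x + (log (W y / W x)).im := by
  have hnear : ∀ᶠ y in 𝓝 x, θ y ∈ Ioo (θ x - π) (θ x + π) :=
    hθ (Ioo_mem_nhds (by linarith [Real.pi_pos]) (by linarith [Real.pi_pos]))
  obtain ⟨hrx, hWx⟩ := hW.self_of_nhds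
  filter_upwards [hW, hnear] with y ⟨hry, hWy⟩ hθy
  have hquot : W y / W x = (r y / r x : ℝ) * exp ((θ y - θ x : ℝ) * I) := by
    rw [hWy, hWx, mul_div_mul_comm, ← exp_sub, ← sub_mul]
    norm_cast
  rw [hquot, exp_mul_I, log_im, arg_mul_cos_add_sin_mul_I (div_pos hry hrx)
    ⟨by linarith [hθy.1], by linarith [hθy.2]⟩, add_sub_cancel]

theorem im_div_add_mul_I (a b a' b' : ℝ) :
    (((b' : ℂ) + a' * I) / (b + a * I)).im = (a' * b - a * b') / (a ^ 2 + b ^ 2) := by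
  simp only [div_im, normSq_apply, add_re, add_im, ofReal_re, ofReal_im, mul_re, mul_im, I_re, I_im]
  ring

variable {U : Set ℂ} {X Z : ℂ → ℂ} {sr x : ℝ}

theorem rhoSq_ne_zero {s : ℂ} (hs : s ∈ U) (hc : s ∉ criticalPoints U X Z) : rhoSq X Z s ≠ 0 :=
  fun h₀ => hc ⟨hs, .inl h₀⟩

namespace AssumptionXZ

theorem isOpen_real (h : AssumptionXZ U X Z sr) : IsOpen {x : ℝ | (x : ℂ) ∈ U} :=
  h.isOpen.preimage continuous_ofReal

theorem eventually_mem (h : AssumptionXZ U X Z sr) (hx : (x : ℂ) ∈ U) :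
    ∀ᶠ y : ℝ in 𝓝 x, (y : ℂ) ∈ U :=
  h.isOpen_real.mem_nhds hx

theorem X_eq_ofReal (h : AssumptionXZ U X Z sr) (hx : (x : ℂ) ∈ U) : X x = (X x).re :=
  Complex.ext rfl (h.realX x hx)

theorem Z_eq_ofReal (h : AssumptionXZ U X Z sr) (hx : (x : ℂ) ∈ U) : Z x = (Z x).re :=
  Complex.ext rfl (h.realZ x hx)

theorem deriv_X_eq_ofReal (h : AssumptionXZ U X Z sr) (hx : (x : ℂ) ∈ U) :
    deriv X x = (deriv X x).re :=
  Complex.ext rfl (im_deriv_eq_zero ((h.eventually_mem hx).mono h.realX))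

theorem deriv_Z_eq_ofReal (h : AssumptionXZ U X Z sr) (hx : (x : ℂ) ∈ U) :
    deriv Z x = (deriv Z x).re :=
  Complex.ext rfl (im_deriv_eq_zero ((h.eventually_mem hx).mono h.realZ))

theorem rhoSq_eq_ofReal (h : AssumptionXZ U X Z sr) (hx : (x : ℂ) ∈ U) :
    rhoSq X Z x = ((X x).re ^ 2 + (Z x).re ^ 2 : ℝ) := by
  rw [rhoSq, h.X_eq_ofReal hx, h.Z_eq_ofReal hx]
  norm_cast

theorem rhoSq_re_pos (h : AssumptionXZ U X Z sr) (hx : (x : ℂ) ∈ U) : 0 < (rhoSq X Z x).re :=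
  let ⟨_, hc, hle⟩ := h.pos
  hc.trans_le (hle x hx)

theorem angleDeriv_eq_ofReal (h : AssumptionXZ U X Z sr) (hx : (x : ℂ) ∈ U) :
    angleDeriv X Z x = (((deriv X x).re * (Z x).re - (X x).re * (deriv Z x).re) /
      ((X x).re ^ 2 + (Z x).re ^ 2) : ℝ) := by
  rw [angleDeriv, h.rhoSq_eq_ofReal hx, h.X_eq_ofReal hx, h.Z_eq_ofReal hx,
    h.deriv_X_eq_ofReal hx, h.deriv_Z_eq_ofReal hx]
  norm_cast

-- At a real critical point the residue `± i n / 2` of the real function `θ̃'` would be real.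
theorem ofReal_notMem_criticalPoints (h : AssumptionXZ U X Z sr) (hx : (x : ℂ) ∈ U) :
    (x : ℂ) ∉ criticalPoints U X Z := by
  intro hc
  obtain ⟨m, n, ε, hform⟩ := h.form x hc
  obtain ⟨g, hg, hg₀, hG⟩ := hform.exists_angleDeriv_eq
  have hlim : Tendsto (fun y : ℝ => (g (y - x)).im) (𝓝[≠] x) (𝓝 (g 0).im) :=
    (continuous_im.tendsto _).comp
      (hg.continuousAt.tendsto.comp ((tendsto_sub_nhdsNE _).comp (tendsto_ofReal_nhdsNE x)))
  have hzero : ∀ᶠ y : ℝ in 𝓝[≠] x, (g (y - x)).im = 0 := by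
    filter_upwards [(tendsto_ofReal_nhdsNE x).eventually hG,
      (h.eventually_mem hx).filter_mono nhdsWithin_le_nhds] with y hy hyU
    rw [← hy, h.angleDeriv_eq_ofReal hyU]
    norm_cast
  have him : (g 0).im = 0 := tendsto_nhds_unique (hlim.congr' hzero) tendsto_const_nhds
  obtain ⟨hn, -, hε, -⟩ := hform
  rcases hε with rfl | rfl <;> simp [hg₀, hn.ne'] at him

theorem analyticAt_X {s : ℂ} (h : AssumptionXZ U X Z sr) (hs : s ∈ U)
    (hc : s ∉ criticalPoints U X Z) : AnalyticAt ℂ X s :=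
  (h.meroX hs).meromorphicOrderAt_nonneg_iff_analyticAt.1
    (not_lt.1 fun hX => hc ⟨hs, .inr (.inl hX)⟩)

theorem analyticAt_Z {s : ℂ} (h : AssumptionXZ U X Z sr) (hs : s ∈ U)
    (hc : s ∉ criticalPoints U X Z) : AnalyticAt ℂ Z s :=
  (h.meroZ hs).meromorphicOrderAt_nonneg_iff_analyticAt.1
    (not_lt.1 fun hZ => hc ⟨hs, .inr (.inr hZ)⟩)

theorem analyticAt_X_ofReal (h : AssumptionXZ U X Z sr) (hx : (x : ℂ) ∈ U) : AnalyticAt ℂ X x :=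
  h.analyticAt_X hx (h.ofReal_notMem_criticalPoints hx)

theorem analyticAt_Z_ofReal (h : AssumptionXZ U X Z sr) (hx : (x : ℂ) ∈ U) : AnalyticAt ℂ Z x :=
  h.analyticAt_Z hx (h.ofReal_notMem_criticalPoints hx)

theorem add_mul_I_ne_zero (h : AssumptionXZ U X Z sr) (hx : (x : ℂ) ∈ U) :
    Z x + X x * I ≠ 0 := by
  intro h₀
  have hmul : rhoSq X Z x = (Z x + X x * I) * (Z x - X x * I) := by
    rw [rhoSq]
    linear_combination (X x) ^ 2 * I_sq
  have := h.rhoSq_re_pos hx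
  rw [hmul, h₀, zero_mul, zero_re] at this
  exact this.false

end AssumptionXZ

namespace IsAngle

variable {θt : ℝ → ℝ}

theorem eventually_eq (hθ : IsAngle U X Z θt) (h : AssumptionXZ U X Z sr) (hx : (x : ℂ) ∈ U) :
    ∀ᶠ y : ℝ in 𝓝 x, θt y = θt x + (log ((Z y + X y * I) / (Z x + X x * I))).im := by
  refine eventually_eq_add_im_log (r := fun y => √(rhoSq X Z y).re)
    (hθ.1.continuousAt (h.eventually_mem hx)) ?_
  filter_upwards [h.eventually_mem hx] with y hy
  obtain ⟨hZ, hX⟩ := hθ.2 y hy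
  refine ⟨Real.sqrt_pos.2 (h.rhoSq_re_pos hy), ?_⟩
  rw [hZ, hX, exp_mul_I]
  push_cast
  ring

theorem hasDerivAt (hθ : IsAngle U X Z θt) (h : AssumptionXZ U X Z sr) (hx : (x : ℂ) ∈ U) :
    HasDerivAt θt (angleDeriv X Z x).re x := by
  have hW₀ := h.add_mul_I_ne_zero hx
  have hW := ((h.analyticAt_Z_ofReal hx).differentiableAt.hasDerivAt.comp_ofReal.add
    ((h.analyticAt_X_ofReal hx).differentiableAt.hasDerivAt.comp_ofReal.mul_const I)).div_const
      (Z x + X x * I)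
  have hlog := imCLM.hasFDerivAt.comp_hasDerivAt x
    (hW.clog_real (by simp only [Pi.add_apply, div_self hW₀, one_mem_slitPlane]))
  refine ((hlog.const_add (θt x)).congr_of_eventuallyEq (hθ.eventually_eq h hx)).congr_deriv ?_
  simp only [Pi.add_apply, div_self hW₀, div_one, imCLM_apply]
  rw [h.angleDeriv_eq_ofReal hx, ofReal_re, ← im_div_add_mul_I, ← h.X_eq_ofReal hx,
    ← h.Z_eq_ofReal hx, ← h.deriv_X_eq_ofReal hx, ← h.deriv_Z_eq_ofReal hx]

theorem contDiffAt (hθ : IsAngle U X Z θt) (h : AssumptionXZ U X Z sr) (hx : (x : ℂ) ∈ U) :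
    ContDiffAt ℝ ∞ θt x := by
  have hX := h.analyticAt_X_ofReal hx
  have hZ := h.analyticAt_Z_ofReal hx
  have hlog : AnalyticAt ℂ (fun s => log ((Z s + X s * I) / (Z x + X x * I))) x :=
    ((hZ.add (hX.mul analyticAt_const)).div_const).clog
      (by simp [div_self (h.add_mul_I_ne_zero hx)])
  exact (contDiffAt_const.add (imCLM.contDiff.contDiffAt.comp x
    (contDiffAt_comp_ofReal hlog))).congr_of_eventuallyEq (hθ.eventually_eq h hx)

end IsAngle

/-- The interval of the real axis around `sr` on which the natural time is inverted in
`thetaOf`. -/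
def realComponent (U : Set ℂ) (sr : ℝ) : Set ℝ :=
  connectedComponentIn {x : ℝ | (x : ℂ) ∈ U} sr

theorem ofReal_mem_of_mem_realComponent (hx : x ∈ realComponent U sr) : (x : ℂ) ∈ U :=
  connectedComponentIn_subset {x : ℝ | (x : ℂ) ∈ U} sr hx

theorem ordConnected_realComponent : (realComponent U sr).OrdConnected :=
  isPreconnected_connectedComponentIn.ordConnected

theorem realTime_self (X Z : ℂ → ℂ) (sr : ℝ) : realTime X Z sr sr = 0 := by
  rw [realTime, intervalIntegral.integral_same, mul_zero]

namespace AssumptionXZ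

theorem mem_realComponent (h : AssumptionXZ U X Z sr) : sr ∈ realComponent U sr :=
  mem_connectedComponentIn h.mem

theorem isOpen_realComponent (h : AssumptionXZ U X Z sr) : IsOpen (realComponent U sr) :=
  h.isOpen_real.connectedComponentIn

theorem continuousAt_sqrt_rhoSq (h : AssumptionXZ U X Z sr) (hx : (x : ℂ) ∈ U) :
    ContinuousAt (fun u : ℝ => √(rhoSq X Z u).re) x := by
  have hX := (h.analyticAt_X_ofReal hx).continuousAt.comp continuous_ofReal.continuousAt
  have hZ := (h.analyticAt_Z_ofReal hx).continuousAt.comp continuous_ofReal.continuousAt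
  exact (continuous_re.continuousAt.comp ((hX.pow 2).add (hZ.pow 2))).sqrt

theorem hasStrictDerivAt_realTime (h : AssumptionXZ U X Z sr) (hx : x ∈ realComponent U sr) :
    HasStrictDerivAt (realTime X Z sr) (2 * √(rhoSq X Z x).re) x := by
  have hcont : ∀ y ∈ realComponent U sr, ContinuousAt (fun u : ℝ => √(rhoSq X Z u).re) y :=
    fun y hy => h.continuousAt_sqrt_rhoSq (ofReal_mem_of_mem_realComponent hy)
  have hcontOn := continuousOn_of_forall_continuousAt hcont
  have hint : IntervalIntegrable (fun u : ℝ => √(rhoSq X Z u).re) volume sr x :=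
    (hcontOn.mono
      (ordConnected_realComponent.uIcc_subset h.mem_realComponent hx)).intervalIntegrable
  exact (intervalIntegral.integral_hasStrictDerivAt_right hint
    (hcontOn.stronglyMeasurableAtFilter h.isOpen_realComponent x hx) (hcont x hx)).const_mul 2

theorem injOn_realTime (h : AssumptionXZ U X Z sr) :
    InjOn (realTime X Z sr) (realComponent U sr) := by
  refine (strictMonoOn_of_deriv_pos ordConnected_realComponent.convex (fun x hx =>
    (h.hasStrictDerivAt_realTime hx).hasDerivAt.continuousAt.continuousWithinAt)
    fun x hx => ?_).injOn
  have hx' := interior_subset hx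
  rw [(h.hasStrictDerivAt_realTime hx').hasDerivAt.deriv]
  exact mul_pos two_pos
    (Real.sqrt_pos.2 (h.rhoSq_re_pos (ofReal_mem_of_mem_realComponent hx')))

end AssumptionXZ

end RealAxis

/-! ### The natural time -/

section NaturalTime

theorem inter_connectedComponentIn_eq {S V : Set ℂ} {a x : ℂ} (hV : IsPreconnected (V ∩ S))
    (hxV : x ∈ V) (hx : x ∈ connectedComponentIn S a) :
    V ∩ connectedComponentIn S a = V ∩ S := by
  refine (inter_subset_inter_right V (connectedComponentIn_subset S a)).antisymm
    (subset_inter inter_subset_left ?_)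
  rw [connectedComponentIn_eq hx]
  exact hV.subset_connectedComponentIn ⟨hxV, connectedComponentIn_subset S a hx⟩ inter_subset_right

variable {U : Set ℂ} {X Z : ℂ → ℂ} {sr : ℝ} {B : ℂ → Set ℂ} {τ φ : ℂ → ℂ} {R : ℝ} {s s₀ : ℂ}

theorem slitDomain_subset_slitSet : slitDomain U X Z sr B ⊆ slitSet U X Z B :=
  connectedComponentIn_subset _ _

theorem mem_of_mem_slitDomain (hs : s ∈ slitDomain U X Z sr B) : s ∈ U :=
  (slitDomain_subset_slitSet hs).1

theorem notMem_criticalPoints_of_mem_slitDomain (hs : s ∈ slitDomain U X Z sr B) :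
    s ∉ criticalPoints U X Z :=
  fun hc => (slitDomain_subset_slitSet hs).2 (mem_iUnion₂.2 ⟨s, hc, mem_insert _ _⟩)

namespace IsBranchCutSystem

theorem isOpen_slitDomain (hB : IsBranchCutSystem U X Z sr B) : IsOpen (slitDomain U X Z sr B) :=
  hB.isOpen_slit.connectedComponentIn

theorem ofReal_mem_slitDomain (hB : IsBranchCutSystem U X Z sr B) (h : AssumptionXZ U X Z sr) :
    (sr : ℂ) ∈ slitDomain U X Z sr B := by
  refine mem_connectedComponentIn ⟨h.mem, fun hcut => ?_⟩
  obtain ⟨s₀, hs₀, rfl | hs⟩ := mem_iUnion₂.1 hcut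
  · exact h.ofReal_notMem_criticalPoints h.mem hs₀
  · exact hB.not_mem s₀ hs₀ hs

theorem eventually_ofReal_mem_slitDomain (hB : IsBranchCutSystem U X Z sr B)
    (h : AssumptionXZ U X Z sr) : ∀ᶠ x : ℝ in 𝓝 sr, (x : ℂ) ∈ slitDomain U X Z sr B :=
  continuous_ofReal.continuousAt (hB.isOpen_slitDomain.mem_nhds (hB.ofReal_mem_slitDomain h))

theorem exists_isPreconnected_inter_slitDomain (hB : IsBranchCutSystem U X Z sr B)
    (hs₀ : s₀ ∈ criticalPoints U X Z) (hcl : s₀ ∈ closure (slitDomain U X Z sr B)) :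
    ∀ W ∈ 𝓝 s₀, ∃ V ∈ 𝓝 s₀, V ⊆ W ∧ IsPreconnected (V ∩ slitDomain U X Z sr B) := by
  intro W hW
  obtain ⟨V, hV, hVW, hconn⟩ := hB.tip s₀ hs₀ W hW
  obtain ⟨x, hxV, hx⟩ := mem_closure_iff_nhds.1 hcl V hV
  have hinter : V ∩ slitDomain U X Z sr B = V ∩ slitSet U X Z B :=
    inter_connectedComponentIn_eq hconn hxV hx
  exact ⟨V, hV, hVW, hinter ▸ hconn⟩

end IsBranchCutSystem

theorem AssumptionXZ.analyticOnNhd_rhoSq (h : AssumptionXZ U X Z sr) :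
    AnalyticOnNhd ℂ (rhoSq X Z) (slitDomain U X Z sr B) := fun s hs => by
  have hU := mem_of_mem_slitDomain hs
  have hc := notMem_criticalPoints_of_mem_slitDomain hs
  exact ((h.analyticAt_X hU hc).pow 2).add ((h.analyticAt_Z hU hc).pow 2)

theorem AssumptionXZ.analyticOnNhd_angleDeriv (h : AssumptionXZ U X Z sr) :
    AnalyticOnNhd ℂ (angleDeriv X Z) (slitDomain U X Z sr B) := fun s hs => by
  have hU := mem_of_mem_slitDomain hs
  have hc := notMem_criticalPoints_of_mem_slitDomain hs
  have hX := h.analyticAt_X hU hc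
  have hZ := h.analyticAt_Z hU hc
  exact ((hX.deriv.mul hZ).sub (hX.mul hZ.deriv)).div (h.analyticOnNhd_rhoSq s hs)
    (rhoSq_ne_zero hU hc)

theorem IsTimeInverse.eventually_ofReal_mem_ball {U₀ : Set ℂ}
    (hφ : IsTimeInverse U₀ τ sr R φ) : ∀ᶠ t : ℝ in 𝓝 0, (t : ℂ) ∈ ball (0 : ℂ) R :=
  continuous_ofReal.continuousAt
    (isOpen_ball.mem_nhds (by simpa only [ofReal_zero] using mem_ball_self hφ.radius_pos))

/-- The adiabatic coupling as a function of complex time: `θ' = θ̃' / τ'` at the point `φ t`, where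
`φ` is the inverse of the natural time `τ`. -/
noncomputable def complexCoupling (X Z τ φ : ℂ → ℂ) (t : ℂ) : ℂ :=
  angleDeriv X Z (φ t) / deriv τ (φ t)

namespace IsNaturalTime

theorem apply_self (hτ : IsNaturalTime U X Z sr B τ) : τ sr = 0 := by
  rw [hτ.2.self_of_nhds, realTime_self, ofReal_zero]

theorem deriv_sq (hτ : IsNaturalTime U X Z sr B τ) (h : AssumptionXZ U X Z sr)
    (hB : IsBranchCutSystem U X Z sr B) :
    ∀ s ∈ slitDomain U X Z sr B, deriv τ s ^ 2 = 4 * rhoSq X Z s := by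
  refine eqOn_of_eventually_eq_ofReal (hτ.1.deriv.pow 2)
    (analyticOnNhd_const.mul h.analyticOnNhd_rhoSq) isPreconnected_connectedComponentIn
    (hB.ofReal_mem_slitDomain h) ?_
  filter_upwards [hτ.2.eventually_nhds, h.isOpen_realComponent.mem_nhds h.mem_realComponent,
    hB.eventually_ofReal_mem_slitDomain h] with x hτx hxJ hxU₀
  have hxU := ofReal_mem_of_mem_realComponent hxJ
  have hderiv : deriv τ x = (2 * √(rhoSq X Z x).re : ℝ) :=
    (hτ.1 x hxU₀).differentiableAt.hasDerivAt.comp_ofReal.unique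
      ((h.hasStrictDerivAt_realTime hxJ).hasDerivAt.ofReal_comp.congr_of_eventuallyEq hτx)
  have hreal : rhoSq X Z x = (rhoSq X Z x).re := by
    rw [h.rhoSq_eq_ofReal hxU, ofReal_re]
  rw [hderiv, ← ofReal_pow, mul_pow, Real.sq_sqrt (h.rhoSq_re_pos hxU).le, ofReal_mul, ← hreal]
  norm_num

theorem isLocallyBiholomorphic (hτ : IsNaturalTime U X Z sr B τ) (h : AssumptionXZ U X Z sr)
    (hB : IsBranchCutSystem U X Z sr B) : IsLocallyBiholomorphic τ (slitDomain U X Z sr B) where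
  isOpen := hB.isOpen_slitDomain
  analyticOnNhd := hτ.1
  deriv_ne_zero s hs h₀ := by
    have hsq := hτ.deriv_sq h hB s hs
    rw [h₀] at hsq
    exact rhoSq_ne_zero (mem_of_mem_slitDomain hs) (notMem_criticalPoints_of_mem_slitDomain hs)
      (by simpa using hsq.symm)

theorem analyticOnNhd_complexCoupling {D : Set ℂ} (hτ : IsNaturalTime U X Z sr B τ)
    (h : AssumptionXZ U X Z sr) (hB : IsBranchCutSystem U X Z sr B)
    (hφ : IsLift (slitDomain U X Z sr B) τ φ D) :
    AnalyticOnNhd ℂ (complexCoupling X Z τ φ) D := fun t ht =>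
  have hs := hφ.mem t ht
  ((h.analyticOnNhd_angleDeriv _ hs).fun_comp (hφ.analyticOnNhd t ht)).div
    ((hτ.1 _ hs).deriv.fun_comp (hφ.analyticOnNhd t ht))
    ((hτ.isLocallyBiholomorphic h hB).deriv_ne_zero _ hs)

theorem eventually_inverse_realTime (hτ : IsNaturalTime U X Z sr B τ) (h : AssumptionXZ U X Z sr)
    (hB : IsBranchCutSystem U X Z sr B) (hφ : IsTimeInverse (slitDomain U X Z sr B) τ sr R φ) :
    ∀ᶠ x : ℝ in 𝓝 sr, φ (realTime X Z sr x) = x := by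
  have hbi := hτ.isLocallyBiholomorphic h hB
  have hmem := hB.ofReal_mem_slitDomain h
  have hsub : (sr : ℂ) ∈ sublevel (slitDomain U X Z sr B) τ sr R :=
    mem_connectedComponentIn ⟨hmem, by simpa using hφ.radius_pos⟩
  filter_upwards [continuous_ofReal.continuousAt ((hbi.isOpen_sublevel R).mem_nhds hsub),
    hτ.2] with x hx hτx
  rw [← hτx, hφ.leftInvOn hbi hx]

variable {θt : ℝ → ℝ}

theorem eventually_thetaOf_eq (hτ : IsNaturalTime U X Z sr B τ) (h : AssumptionXZ U X Z sr)
    (hB : IsBranchCutSystem U X Z sr B) (hφ : IsTimeInverse (slitDomain U X Z sr B) τ sr R φ)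
    (θt : ℝ → ℝ) :
    ∀ᶠ t : ℝ in 𝓝 0, ∃ x : ℝ, (x : ℂ) ∈ U ∧ φ t = x ∧ thetaOf U X Z sr θt t = θt x := by
  have hmap : map (realTime X Z sr) (𝓝 sr) = 𝓝 0 := by
    rw [(h.hasStrictDerivAt_realTime h.mem_realComponent).map_nhds_eq
      (mul_pos two_pos (Real.sqrt_pos.2 (h.rhoSq_re_pos h.mem))).ne', realTime_self]
  rw [← hmap, eventually_map]
  filter_upwards [h.isOpen_realComponent.mem_nhds h.mem_realComponent,
    hτ.eventually_inverse_realTime h hB hφ] with x hx hφx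
  exact ⟨x, ofReal_mem_of_mem_realComponent hx, hφx,
    congrArg θt (h.injOn_realTime.leftInvOn_invFunOn hx)⟩

theorem eventually_im_inverse_eq_zero (hτ : IsNaturalTime U X Z sr B τ)
    (h : AssumptionXZ U X Z sr) (hB : IsBranchCutSystem U X Z sr B)
    (hφ : IsTimeInverse (slitDomain U X Z sr B) τ sr R φ) :
    ∀ᶠ t : ℝ in 𝓝 0, (φ t).im = 0 := by
  filter_upwards [hτ.eventually_thetaOf_eq h hB hφ 0] with t ⟨x, _, hx, _⟩
  rw [hx, ofReal_im]

theorem eventually_thetaOf_eventuallyEq (hτ : IsNaturalTime U X Z sr B τ)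
    (h : AssumptionXZ U X Z sr) (hB : IsBranchCutSystem U X Z sr B)
    (hφ : IsTimeInverse (slitDomain U X Z sr B) τ sr R φ) (θt : ℝ → ℝ) :
    ∀ᶠ t : ℝ in 𝓝 0, thetaOf U X Z sr θt =ᶠ[𝓝 t] fun y => θt (φ y).re := by
  filter_upwards [(hτ.eventually_thetaOf_eq h hB hφ θt).eventually_nhds] with t ht
  filter_upwards [ht] with y ⟨x, _, hx, hθ⟩
  rw [hθ, hx, ofReal_re]

theorem eventually_contDiffAt_thetaOf (hτ : IsNaturalTime U X Z sr B τ)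
    (h : AssumptionXZ U X Z sr) (hB : IsBranchCutSystem U X Z sr B)
    (hφ : IsTimeInverse (slitDomain U X Z sr B) τ sr R φ) (hθ : IsAngle U X Z θt) :
    ∀ᶠ t : ℝ in 𝓝 0, ContDiffAt ℝ ∞ (thetaOf U X Z sr θt) t := by
  filter_upwards [hτ.eventually_thetaOf_eventuallyEq h hB hφ θt,
    hτ.eventually_thetaOf_eq h hB hφ θt, hφ.eventually_ofReal_mem_ball]
    with t heq ⟨x, hxU, hx, _⟩ ht
  have hφt := reCLM.contDiff.contDiffAt.comp t
    (contDiffAt_comp_ofReal (hφ.isLift.analyticOnNhd t ht))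
  refine ContDiffAt.congr_of_eventuallyEq (ContDiffAt.comp t ?_ hφt) heq
  simpa only [Function.comp_apply, reCLM_apply, hx, ofReal_re] using hθ.contDiffAt h hxU

theorem eventually_couplingOf_eq (hτ : IsNaturalTime U X Z sr B τ)
    (h : AssumptionXZ U X Z sr) (hB : IsBranchCutSystem U X Z sr B)
    (hφ : IsTimeInverse (slitDomain U X Z sr B) τ sr R φ) (hθ : IsAngle U X Z θt) :
    ∀ᶠ t : ℝ in 𝓝 0, couplingOf U X Z sr θt t = complexCoupling X Z τ φ t := by
  filter_upwards [hτ.eventually_thetaOf_eventuallyEq h hB hφ θt,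
    hτ.eventually_thetaOf_eq h hB hφ θt, hφ.eventually_ofReal_mem_ball,
    (hτ.eventually_im_inverse_eq_zero h hB hφ).eventually_nhds] with t heq ⟨x, hxU, hx, _⟩ ht him
  have hθx : HasDerivAt θt (angleDeriv X Z x).re (φ t).re := by
    simpa only [hx, ofReal_re] using hθ.hasDerivAt h hxU
  have hderiv : HasDerivAt (thetaOf U X Z sr θt)
      ((angleDeriv X Z x).re * (deriv φ t).re) t :=
    (hθx.comp t (hφ.isLift.analyticOnNhd t ht).differentiableAt.hasDerivAt.real_of_complex
      ).congr_of_eventuallyEq heq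
  have hφ' : deriv φ t = (deriv φ t).re := Complex.ext rfl (im_deriv_eq_zero him)
  have hangle : angleDeriv X Z x = (angleDeriv X Z x).re := by
    rw [h.angleDeriv_eq_ofReal hxU, ofReal_re]
  rw [couplingOf, complexCoupling, hderiv.deriv, ofReal_mul, ← hφ', ← hangle,
    hφ.isLift.deriv_eq hτ.1 isOpen_ball ht, hx, div_eq_mul_inv]

end IsNaturalTime

end NaturalTime

/-! ### Boundary singularities of the coupling -/

section Coupling

variable {U : Set ℂ} {X Z : ℂ → ℂ} {sr : ℝ} {B : ℂ → Set ℂ} {τ φ : ℂ → ℂ} {R : ℝ}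

theorem IsRadius.pos {U₀ : Set ℂ} (hR : IsRadius U₀ τ sr R) : 0 < R :=
  have ⟨_, hr⟩ := hR.nonempty
  hr.1.trans_le (hR.1 hr)

theorem IsRadius.closure_sublevel_subset {U₀ : Set ℂ} (hR : IsRadius U₀ τ sr R) {r : ℝ}
    (hr : r < R) : closure (sublevel U₀ τ sr r) ⊆ U₀ :=
  have ⟨_, hr', hlt⟩ := (lt_isLUB_iff hR).1 hr
  (closure_mono (sublevel_mono hlt.le)).trans hr'.2

namespace IsNaturalTime

theorem exists_isTimeInverse (hτ : IsNaturalTime U X Z sr B τ) (h : AssumptionXZ U X Z sr)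
    (hB : IsBranchCutSystem U X Z sr B) (hR : IsRadius (slitDomain U X Z sr B) τ sr R)
    (hb : Bornology.IsBounded (sublevel (slitDomain U X Z sr B) τ sr R)) :
    ∃ φ, IsTimeInverse (slitDomain U X Z sr B) τ sr R φ :=
  (hτ.isLocallyBiholomorphic h hB).exists_isTimeInverse (hB.ofReal_mem_slitDomain h)
    hτ.apply_self hR.pos fun _ hr =>
      ⟨(hb.subset (sublevel_mono hr.le)).isCompact_closure, hR.closure_sublevel_subset hr⟩

variable {s₀ t₀ p : ℂ} {m : ℤ} {n : ℕ} {ε : ℤ}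

theorem exists_hasBranchPoint (hτ : IsNaturalTime U X Z sr B τ) (h : AssumptionXZ U X Z sr)
    (hB : IsBranchCutSystem U X Z sr B) (hs₀ : s₀ ∈ criticalPoints U X Z)
    (hcl : s₀ ∈ closure (slitDomain U X Z sr B)) (hform : HasCriticalForm X Z s₀ m n ε) {M : ℕ}
    (hM : (M : ℤ) = 2 * m + n + 2) :
    ∃ t₀, HasBranchPoint τ (slitDomain U X Z sr B) s₀ t₀ M := by
  obtain ⟨q, hq, hq₀, hrho⟩ := hform.exists_rhoSq_eq
  exact SuperAdiabatic.exists_hasBranchPoint hB.isOpen_slitDomain hτ.1 (hτ.deriv_sq h hB)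
    (by have := hform.order_pos; lia) hM hq hq₀
    (fun hs => notMem_criticalPoints_of_mem_slitDomain hs hs₀) hcl hrho
    (hB.exists_isPreconnected_inter_slitDomain hs₀ hcl)

theorem exists_tendsto (hτ : IsNaturalTime U X Z sr B τ) (h : AssumptionXZ U X Z sr)
    (hB : IsBranchCutSystem U X Z sr B) (hs₀ : s₀ ∈ criticalPoints U X Z)
    (hcl : s₀ ∈ closure (slitDomain U X Z sr B)) :
    ∃ t₀, Tendsto τ (𝓝[slitDomain U X Z sr B] s₀) (𝓝 t₀) := by
  obtain ⟨m, n, ε, hform⟩ := h.form s₀ hs₀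
  obtain ⟨M, hM⟩ := Int.eq_ofNat_of_zero_le hform.order_pos.le
  obtain ⟨t₀, ht₀⟩ := hτ.exists_hasBranchPoint h hB hs₀ hcl hform hM.symm
  exact ⟨t₀, ht₀.tendsto (by have := hform.order_pos; lia)⟩

theorem hasBranchedPole_complexCoupling (hτ : IsNaturalTime U X Z sr B τ)
    (h : AssumptionXZ U X Z sr) (hB : IsBranchCutSystem U X Z sr B)
    (hφ : IsTimeInverse (slitDomain U X Z sr B) τ sr R φ) (hs₀ : s₀ ∈ criticalPoints U X Z)
    (hp : ‖p‖ = R) (hlim : Tendsto φ (𝓝[ball 0 R] p) (𝓝 s₀))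
    (hform : HasCriticalForm X Z s₀ m n ε) :
    HasBranchedPole (complexCoupling X Z τ φ) (ball 0 R) p (2 / (2 * m + n + 2))
      (I * (ε * n / (2 * m + n + 2) : ℝ)) := by
  have := nhdsWithin_ball_neBot hφ.radius_pos hp
  have hcl : s₀ ∈ closure (slitDomain U X Z sr B) :=
    mem_closure_of_tendsto hlim (eventually_mem_nhdsWithin.mono hφ.isLift.mem)
  obtain ⟨M, hM⟩ := Int.eq_ofNat_of_zero_le hform.order_pos.le
  have hM₀ : M ≠ 0 := by have := hform.order_pos; lia
  obtain ⟨t₀, ht₀⟩ := hτ.exists_hasBranchPoint h hB hs₀ hcl hform hM.symm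
  obtain rfl := hφ.eq_of_tendsto hp hlim (ht₀.tendsto hM₀)
  obtain ⟨g, hg, hg₀, hG⟩ := hform.exists_angleDeriv_eq
  have hMr : 2 * (m : ℝ) + n + 2 = M := by exact_mod_cast hM
  have hres : I * (ε * n / M : ℝ) = 2 * g 0 / M := by
    rw [hg₀]
    push_cast
    ring
  rw [hMr, hres]
  exact ht₀.hasBranchedPole hM₀ hφ.isLift hφ.radius_pos hp hlim hg hG

theorem extendsAnalyticallyAt_complexCoupling (hτ : IsNaturalTime U X Z sr B τ)
    (h : AssumptionXZ U X Z sr) (hB : IsBranchCutSystem U X Z sr B)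
    (hφ : IsTimeInverse (slitDomain U X Z sr B) τ sr R φ) (hp : ‖p‖ = R)
    (hs₀ : s₀ ∈ slitDomain U X Z sr B) (hlim : Tendsto φ (𝓝[ball 0 R] p) (𝓝 s₀)) :
    ExtendsAnalyticallyAt (complexCoupling X Z τ φ) (ball 0 R) p := by
  have := nhdsWithin_ball_neBot hφ.radius_pos hp
  obtain ⟨ψ, δ, hδ, hψ, -, hψφ⟩ :=
    (hτ.isLocallyBiholomorphic h hB).exists_extension_of_mapClusterPt hφ.isLift isOpen_ball
      (convex_ball _ _) hs₀ hlim.mapClusterPt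
  refine ⟨_, hτ.analyticOnNhd_complexCoupling h hB hψ p (mem_ball_self hδ), ?_⟩
  filter_upwards [self_mem_nhdsWithin, mem_nhdsWithin_of_mem_nhds (ball_mem_nhds p hδ)]
    with t ht htp
  rw [complexCoupling, complexCoupling, hψφ ⟨htp, ht⟩]

theorem extendsAnalyticallyAt_or_exists_tendsto (hτ : IsNaturalTime U X Z sr B τ)
    (h : AssumptionXZ U X Z sr) (hB : IsBranchCutSystem U X Z sr B)
    (hφ : IsTimeInverse (slitDomain U X Z sr B) τ sr R φ)
    (hb : Bornology.IsBounded (sublevel (slitDomain U X Z sr B) τ sr R))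
    (hfin : (frontier (sublevel (slitDomain U X Z sr B) τ sr R) ∩
      frontier (slitDomain U X Z sr B)).Finite) (hp : ‖p‖ = R) :
    ExtendsAnalyticallyAt (complexCoupling X Z τ φ) (ball 0 R) p ∨
      ∃ s ∈ frontier (sublevel (slitDomain U X Z sr B) τ sr R) ∩
        frontier (slitDomain U X Z sr B), Tendsto φ (𝓝[ball 0 R] p) (𝓝 s) := by
  have hbi := hτ.isLocallyBiholomorphic h hB
  obtain ⟨s, hs, hlim⟩ := hφ.exists_tendsto hbi hb hfin hp
  by_cases hsU : s ∈ slitDomain U X Z sr B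
  · exact .inl (hτ.extendsAnalyticallyAt_complexCoupling h hB hφ hp hsU hlim)
  · exact .inr ⟨s, hbi.mem_frontier_inter_frontier hs hsU, hlim⟩

theorem exists_hasBranchedPoles (hτ : IsNaturalTime U X Z sr B τ) (h : AssumptionXZ U X Z sr)
    (hB : IsBranchCutSystem U X Z sr B) (hφ : IsTimeInverse (slitDomain U X Z sr B) τ sr R φ)
    (hR2 : AssumptionR2 (slitDomain U X Z sr B) (criticalPoints U X Z) τ sr R) :
    ∃ P β c, HasBranchedPoles (complexCoupling X Z τ φ) R P β c := by
  obtain ⟨hb, hfin, hcrit⟩ := hR2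
  set F := frontier (sublevel (slitDomain U X Z sr B) τ sr R) ∩ frontier (slitDomain U X Z sr B)
  have htime : ∀ s ∈ F, ∃ t, Tendsto τ (𝓝[slitDomain U X Z sr B] s) (𝓝 t) := fun s hs =>
    hτ.exists_tendsto h hB (hcrit hs) (frontier_subset_closure hs.2)
  choose! t ht using htime
  set P := {p : ℂ | ‖p‖ = R ∧ ∃ s ∈ F, Tendsto φ (𝓝[ball 0 R] p) (𝓝 s)}
  have hP : P.Finite := (hfin.image t).subset fun p ⟨hp, s, hs, hlim⟩ =>
    ⟨s, hs, (hφ.eq_of_tendsto hp hlim (ht s hs)).symm⟩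
  have hpole : ∀ p ∈ P, ∃ (β : ℝ) (c : ℂ), 0 < β ∧
      HasBranchedPole (complexCoupling X Z τ φ) (ball 0 R) p β c := by
    rintro p ⟨hp, s, hs, hlim⟩
    obtain ⟨m, n, ε, hform⟩ := h.form s (hcrit hs)
    exact ⟨_, _, div_pos two_pos (by exact_mod_cast hform.order_pos),
      hτ.hasBranchedPole_complexCoupling h hB hφ (hcrit hs) hp hlim hform⟩
  choose! β c hβ hc using hpole
  refine ⟨hP.toFinset, β, c, ⟨hφ.radius_pos, ?_, ?_,
    hτ.analyticOnNhd_complexCoupling h hB hφ.isLift, fun p hp hpP => ?_, ?_⟩⟩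
  · exact fun p hp => (hP.mem_toFinset.1 hp).1
  · exact fun p hp => hβ p (hP.mem_toFinset.1 hp)
  · exact (hτ.extendsAnalyticallyAt_or_exists_tendsto h hB hφ hb hfin hp).resolve_right
      fun hs => hpP (hP.mem_toFinset.2 ⟨hp, hs⟩)
  · exact fun p hp => hc p (hP.mem_toFinset.1 hp)

theorem couplingOf_mem_FSpace_one {θt : ℝ → ℝ} (hτ : IsNaturalTime U X Z sr B τ)
    (h : AssumptionXZ U X Z sr) (hB : IsBranchCutSystem U X Z sr B)
    (hφ : IsTimeInverse (slitDomain U X Z sr B) τ sr R φ) (hθ : IsAngle U X Z θt)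
    (hR2 : AssumptionR2 (slitDomain U X Z sr B) (criticalPoints U X Z) τ sr R) :
    couplingOf U X Z sr θt ∈ FSpace 1 R {0} := by
  obtain ⟨P, β, c, hh⟩ := hτ.exists_hasBranchedPoles h hB hφ hR2
  refine mem_FSpace_of_eventuallyEq hh.mem_FSpace_one fun t ht => ?_
  rw [mem_singleton_iff.1 ht]
  exact hτ.eventually_couplingOf_eq h hB hφ hθ

end IsNaturalTime

end Coupling

/-! ### A pair of conjugate singularities -/

section Conjugation

variable {f : ℂ → ℂ} {R : ℝ} {p : ℂ}

theorem conj_mem_ball_zero {t : ℂ} : conj t ∈ ball (0 : ℂ) R ↔ t ∈ ball 0 R := by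
  rw [mem_ball_zero_iff, norm_conj, mem_ball_zero_iff]

theorem tendsto_conj_nhdsWithin_ball (p : ℂ) :
    Tendsto conj (𝓝[ball 0 R] (conj p)) (𝓝[ball 0 R] p) := by
  have hconj : Tendsto conj (𝓝 (conj p)) (𝓝 p) := by
    simpa only [conj_conj] using continuous_conj.tendsto (conj p)
  exact tendsto_nhdsWithin_iff.2 ⟨hconj.mono_left nhdsWithin_le_nhds,
    eventually_mem_nhdsWithin.mono fun _ => conj_mem_ball_zero.2⟩

theorem conj_apply_conj_of_eventually_im_eq_zero (hf : AnalyticOnNhd ℂ f (ball 0 R))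
    (hreal : ∀ᶠ x : ℝ in 𝓝 0, (f x).im = 0) {t : ℂ} (ht : t ∈ ball 0 R) :
    conj (f (conj t)) = f t := by
  have hg : AnalyticOnNhd ℂ (fun w => conj (f (conj w))) (ball 0 R) := fun z hz => by
    simpa only [conj_conj] using analyticAt_conj_conj (hf _ (conj_mem_ball_zero.2 hz))
  refine eqOn_of_eventually_eq_ofReal hg hf (convex_ball _ _).isPreconnected (x := 0) ?_ ?_ ht
  · simpa only [ofReal_zero] using mem_ball_self (nonempty_ball.1 ⟨t, ht⟩)
  · filter_upwards [hreal] with x hx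
    rw [conj_ofReal, conj_eq_iff_im.2 hx]

theorem HasBranchedPole.conj {β : ℝ} {c : ℂ} (h : HasBranchedPole f (ball 0 R) p β c) (hR : 0 < R)
    (hp : ‖p‖ = R) (hf : ∀ t ∈ ball 0 R, conj (f (conj t)) = f t) :
    HasBranchedPole f (ball 0 R) (conj p) β (conj c) := by
  obtain ⟨L, hL, rfl, hev⟩ := h
  refine ⟨fun w => conj (L (conj w)), by simpa only [map_zero] using analyticAt_conj_conj hL,
    by simp only [map_mul, map_neg, map_zero], ?_⟩
  filter_upwards [(tendsto_conj_nhdsWithin_ball p).eventually hev, self_mem_nhdsWithin]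
    with t ht htR
  have hslit : 1 - conj t / p ∈ slitPlane :=
    one_sub_div_mem_slitPlane (t := 0) (norm_pos_iff.1 (hp ▸ hR))
      (norm_zero.trans_le (norm_nonneg p))
      (by simpa only [sub_zero, hp] using mem_ball_zero_iff.1 (conj_mem_ball_zero.2 htR))
  have hconj : 1 - t / conj p = conj (1 - conj t / p) := by
    rw [map_sub, map_div₀, conj_conj, map_one]
  have hpow : conj ((1 - t / conj p) ^ (β : ℂ)) = (1 - conj t / p) ^ (β : ℂ) := by
    rw [hconj, conj_cpow _ _ (mem_slitPlane_iff_arg.1 hslit).1, conj_conj, conj_ofReal]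
  rw [← hf t htR, ht, map_div₀, hpow, hconj]

theorem polarPart_pair {γ : ℝ} (hp : conj p ≠ p) (t : ℝ) :
    polarPart {p, conj p} (fun q => if q = p then I * γ else -(I * γ)) t = polePair γ p t := by
  rw [polarPart, Finset.sum_pair hp.symm, if_pos rfl, if_neg hp, polePair]
  ring

theorem polePair_conj (γ : ℝ) (p : ℂ) : polePair γ (conj p) = polePair (-γ) p := by
  funext t
  simp only [polePair, conj_conj, ofReal_neg]
  ring

theorem exists_polePair_eq_of_re_eq_zero (hre : p.re = 0) (γ : ℝ) :
    ∃ γ', polePair γ' ((0 : ℝ) - I * ‖p‖) = polePair γ p := by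
  have hnorm : ‖p‖ = |p.im| := by rw [norm_eq_sqrt_sq_add_sq, hre, zero_pow two_ne_zero, zero_add,
    Real.sqrt_sq_eq_abs]
  rcases abs_choice p.im with him | him
  · refine ⟨-γ, ?_⟩
    rw [← polePair_conj]
    congr 1
    apply Complex.ext <;> simp [hre, hnorm, him]
  · refine ⟨γ, ?_⟩
    congr 1
    apply Complex.ext <;> simp [hre, hnorm, him]

end Conjugation

theorem HasStokesLine.re_eq {U₀ : Set ℂ} {τ : ℂ → ℂ} {s₀ t₀ : ℂ} {sr : ℝ}
    (h : HasStokesLine U₀ τ s₀ sr) (ht₀ : Tendsto τ (𝓝[U₀] s₀) (𝓝 t₀)) :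
    t₀.re = (τ sr).re := by
  obtain ⟨σ, hσ, rfl, -, hσU⟩ := h
  have : (𝓝[Ioc 0 1] (0 : ℝ)).NeBot := left_nhdsWithin_Ioc_neBot zero_lt_one
  have hlim : Tendsto σ (𝓝[Ioc 0 1] 0) (𝓝[U₀] (σ 0)) :=
    tendsto_nhdsWithin_iff.2
      ⟨(hσ 0 ⟨le_rfl, zero_le_one⟩).tendsto.mono_left (nhdsWithin_mono _ Ioc_subset_Icc_self),
        eventually_mem_nhdsWithin.mono fun u hu => (hσU u hu).1⟩
  exact tendsto_nhds_unique ((continuous_re.tendsto t₀).comp (ht₀.comp hlim))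
    (tendsto_const_nhds.congr' (eventually_mem_nhdsWithin.mono fun u hu => (hσU u hu).2.symm))

theorem HasCriticalForm.exists_exponent {X Z : ℂ → ℂ} {s₀ : ℂ} {m : ℤ} {n : ℕ} {ε : ℤ}
    (h : HasCriticalForm X Z s₀ m n ε) :
    ∃ α : ℝ, 0 < α ∧ α < 1 ∧ (2 * (m : ℝ) + n) / (2 * m + n + 2) ≤ α := by
  have hpos : (0 : ℝ) < 2 * m + n + 2 := by exact_mod_cast h.order_pos
  exact ⟨max (1 / 2) _, lt_max_of_lt_left one_half_pos,
    max_lt one_half_lt_one ((div_lt_one hpos).2 (by linarith)), le_max_right _ _⟩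

namespace IsNaturalTime

variable {U : Set ℂ} {X Z : ℂ → ℂ} {sr : ℝ} {B : ℂ → Set ℂ} {τ φ : ℂ → ℂ} {R : ℝ}
  {s₀ t₀ : ℂ} {m : ℤ} {n : ℕ} {ε : ℤ}

theorem norm_eq_and_tendsto_of_assumptionR1 (hτ : IsNaturalTime U X Z sr B τ)
    (h : AssumptionXZ U X Z sr) (hB : IsBranchCutSystem U X Z sr B)
    (hφ : IsTimeInverse (slitDomain U X Z sr B) τ sr R φ)
    (hR1 : AssumptionR1 (slitDomain U X Z sr B) (criticalPoints U X Z) τ sr R s₀)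
    (ht₀ : Tendsto τ (𝓝[slitDomain U X Z sr B] s₀) (𝓝 t₀)) :
    ‖t₀‖ = R ∧ Tendsto φ (𝓝[ball 0 R] t₀) (𝓝 s₀) := by
  obtain ⟨hs₀, -, hb, hF⟩ := hR1
  have hs₀U : s₀ ∉ slitDomain U X Z sr B := fun hs => notMem_criticalPoints_of_mem_slitDomain hs hs₀
  have hcl : s₀ ∈ closure (sublevel (slitDomain U X Z sr B) τ sr R) :=
    frontier_subset_closure (hF.ge (mem_insert s₀ _)).1
  have hbi := hτ.isLocallyBiholomorphic h hB
  exact ⟨hφ.norm_eq_of_tendsto hbi hcl hs₀U ht₀,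
    hφ.tendsto_of_tendsto hbi hb (hF ▸ toFinite _) hcl hs₀U ht₀⟩

theorem conj_apply_conj_inverse (hτ : IsNaturalTime U X Z sr B τ) (h : AssumptionXZ U X Z sr)
    (hB : IsBranchCutSystem U X Z sr B) (hφ : IsTimeInverse (slitDomain U X Z sr B) τ sr R φ)
    {t : ℂ} (ht : t ∈ ball 0 R) : conj (φ (conj t)) = φ t :=
  conj_apply_conj_of_eventually_im_eq_zero hφ.isLift.analyticOnNhd
    (hτ.eventually_im_inverse_eq_zero h hB hφ) ht

theorem conj_apply_conj_complexCoupling {θt : ℝ → ℝ} (hτ : IsNaturalTime U X Z sr B τ)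
    (h : AssumptionXZ U X Z sr) (hB : IsBranchCutSystem U X Z sr B)
    (hφ : IsTimeInverse (slitDomain U X Z sr B) τ sr R φ) (hθ : IsAngle U X Z θt)
    {t : ℂ} (ht : t ∈ ball 0 R) :
    conj (complexCoupling X Z τ φ (conj t)) = complexCoupling X Z τ φ t := by
  refine conj_apply_conj_of_eventually_im_eq_zero
    (hτ.analyticOnNhd_complexCoupling h hB hφ.isLift) ?_ ht
  filter_upwards [hτ.eventually_couplingOf_eq h hB hφ hθ] with x hx
  rw [← hx, couplingOf, ofReal_im]

theorem eq_or_eq_conj_of_tendsto (hτ : IsNaturalTime U X Z sr B τ) (h : AssumptionXZ U X Z sr)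
    (hB : IsBranchCutSystem U X Z sr B) (hφ : IsTimeInverse (slitDomain U X Z sr B) τ sr R φ)
    (ht₀ : Tendsto τ (𝓝[slitDomain U X Z sr B] s₀) (𝓝 t₀)) {p s : ℂ} (hp : ‖p‖ = R)
    (hlim : Tendsto φ (𝓝[ball 0 R] p) (𝓝 s)) (hs : s = s₀ ∨ s = conj s₀) :
    p = t₀ ∨ p = conj t₀ := by
  rcases hs with rfl | rfl
  · exact .inl (hφ.eq_of_tendsto hp hlim ht₀)
  · right
    have hlim' : Tendsto φ (𝓝[ball 0 R] (conj p)) (𝓝 s₀) := by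
      have hconj := (continuous_conj.tendsto _).comp (hlim.comp (tendsto_conj_nhdsWithin_ball p))
      rw [conj_conj] at hconj
      exact hconj.congr'
        (eventually_mem_nhdsWithin.mono fun t ht => hτ.conj_apply_conj_inverse h hB hφ ht)
    rw [← hφ.eq_of_tendsto (by rw [norm_conj, hp]) hlim' ht₀, conj_conj]

theorem hasBranchedPoles_of_assumptionR1 {θt : ℝ → ℝ} (hτ : IsNaturalTime U X Z sr B τ)
    (h : AssumptionXZ U X Z sr) (hB : IsBranchCutSystem U X Z sr B)
    (hφ : IsTimeInverse (slitDomain U X Z sr B) τ sr R φ) (hθ : IsAngle U X Z θt)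
    (hR1 : AssumptionR1 (slitDomain U X Z sr B) (criticalPoints U X Z) τ sr R s₀)
    (hform : HasCriticalForm X Z s₀ m n ε)
    (ht₀ : Tendsto τ (𝓝[slitDomain U X Z sr B] s₀) (𝓝 t₀)) (hconj : conj t₀ ≠ t₀) :
    HasBranchedPoles (complexCoupling X Z τ φ) R {t₀, conj t₀} (fun _ => 2 / (2 * m + n + 2))
      fun q => if q = t₀ then I * (ε * n / (2 * m + n + 2) : ℝ)
        else -(I * (ε * n / (2 * m + n + 2) : ℝ)) := by
  obtain ⟨hR, hlim⟩ := hτ.norm_eq_and_tendsto_of_assumptionR1 h hB hφ hR1 ht₀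
  obtain ⟨hs₀, -, hb, hF⟩ := hR1
  have hpole := hτ.hasBranchedPole_complexCoupling h hB hφ hs₀ hR hlim hform
  refine ⟨hφ.radius_pos, ?_, fun _ _ => div_pos two_pos (by exact_mod_cast hform.order_pos),
    hτ.analyticOnNhd_complexCoupling h hB hφ.isLift, fun p hp hpP => ?_, ?_⟩
  · simp only [Finset.mem_insert, Finset.mem_singleton, forall_eq_or_imp, forall_eq, norm_conj,
      hR, and_self]
  · have hext := hτ.extendsAnalyticallyAt_or_exists_tendsto h hB hφ hb (hF ▸ toFinite _) hp
    refine hext.resolve_right fun ⟨s, hs, hps⟩ => hpP ?_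
    simpa only [Finset.mem_insert, Finset.mem_singleton] using
      hτ.eq_or_eq_conj_of_tendsto h hB hφ ht₀ hp hps (hF.le hs)
  · simp only [Finset.mem_insert, Finset.mem_singleton, forall_eq_or_imp, forall_eq, if_true,
      if_neg hconj]
    refine ⟨hpole, ?_⟩
    have hpole' := hpole.conj hφ.radius_pos hR
      fun t ht => hτ.conj_apply_conj_complexCoupling h hB hφ hθ ht
    rwa [map_mul, conj_I, conj_ofReal, neg_mul] at hpole'

theorem exists_sub_polePair_mem_FSpace {θt : ℝ → ℝ} (hτ : IsNaturalTime U X Z sr B τ)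
    (h : AssumptionXZ U X Z sr) (hB : IsBranchCutSystem U X Z sr B)
    (hφ : IsTimeInverse (slitDomain U X Z sr B) τ sr R φ) (hθ : IsAngle U X Z θt)
    (hR1 : AssumptionR1 (slitDomain U X Z sr B) (criticalPoints U X Z) τ sr R s₀)
    (hform : HasCriticalForm X Z s₀ m n ε)
    (ht₀ : Tendsto τ (𝓝[slitDomain U X Z sr B] s₀) (𝓝 t₀)) (hre : t₀.re = 0) :
    ∃ η, 0 < η ∧ η ≤ R ∧ (∀ t ∈ Icc (-η) η, ContDiffAt ℝ ∞ (thetaOf U X Z sr θt) t) ∧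
      ∀ α > 0, (2 * (m : ℝ) + n) / (2 * m + n + 2) ≤ α →
        (fun t => couplingOf U X Z sr θt t - polePair (ε * n / (2 * m + n + 2)) t₀ t) ∈
          FSpace α R (Icc (-η) η) := by
  have hR := (hτ.norm_eq_and_tendsto_of_assumptionR1 h hB hφ hR1 ht₀).1
  have hconj : conj t₀ ≠ t₀ := fun heq => by
    have hzero : t₀ = 0 := Complex.ext hre (conj_eq_iff_im.1 heq)
    exact hφ.radius_pos.ne (by rw [← hR, hzero, norm_zero])
  have hh := hτ.hasBranchedPoles_of_assumptionR1 h hB hφ hθ hR1 hform ht₀ hconj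
  obtain ⟨δ, hδ, hmem⟩ := hh.exists_sub_polarPart_mem_FSpace (by
    simp only [Finset.mem_insert, Finset.mem_singleton, forall_eq_or_imp, forall_eq, conj_re, hre,
      and_self])
  obtain ⟨δ', hδ', hev⟩ := eventually_nhds_iff_ball.1
    ((hτ.eventually_contDiffAt_thetaOf h hB hφ hθ).and
      (hτ.eventually_couplingOf_eq h hB hφ hθ))
  obtain ⟨η, hη, hηlt⟩ := exists_between (lt_min (lt_min hδ hδ') hφ.radius_pos)
  obtain ⟨⟨hηδ, hηδ'⟩, hηR⟩ := by simpa only [lt_min_iff] using hηlt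
  have hball : ∀ t ∈ Icc (-η) η, t ∈ ball 0 δ' := fun t ht =>
    mem_ball_zero_iff.2 ((abs_le.2 ht).trans_lt hηδ')
  refine ⟨η, hη, hηR.le, fun t ht => (hev t (hball t ht)).1, fun α hα hα' => ?_⟩
  have hβ : 1 - 2 / (2 * (m : ℝ) + n + 2) ≤ α := by
    have hpos : (0 : ℝ) < 2 * m + n + 2 := by exact_mod_cast hform.order_pos
    rwa [one_sub_div hpos.ne', add_sub_cancel_right]
  refine mem_FSpace_of_eventuallyEq (hmem _ isCompact_Icc
    (fun t ht => (abs_le.2 ht).trans_lt hηδ) α hα fun _ _ => hβ) fun t ht => ?_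
  filter_upwards [isOpen_ball.mem_nhds (hball t ht)] with x hx
  rw [(hev x hx).2, polarPart_pair hconj]

end IsNaturalTime

end SuperAdiabatic

theorem theorem6 (U : Set ℂ) (X Z : ℂ → ℂ) (sr : ℝ) (θt : ℝ → ℝ) (B : ℂ → Set ℂ)
    (τ : ℂ → ℂ) (R : ℝ)
    (hXZ : SuperAdiabatic.AssumptionXZ U X Z sr)
    (hθ : SuperAdiabatic.IsAngle U X Z θt)
    (hB : SuperAdiabatic.IsBranchCutSystem U X Z sr B)
    (hτ : SuperAdiabatic.IsNaturalTime U X Z sr B τ)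
    (hR : SuperAdiabatic.IsRadius (SuperAdiabatic.slitDomain U X Z sr B) τ sr R) :
    (SuperAdiabatic.AssumptionR2 (SuperAdiabatic.slitDomain U X Z sr B)
        (SuperAdiabatic.criticalPoints U X Z) τ sr R →
      ContDiffAt ℝ ∞ (SuperAdiabatic.thetaOf U X Z sr θt) (SuperAdiabatic.realTime X Z sr sr) ∧
      SuperAdiabatic.couplingOf U X Z sr θt ∈
        SuperAdiabatic.FSpace 1 R {SuperAdiabatic.realTime X Z sr sr} ∧
      SuperAdiabatic.Assumption2 (SuperAdiabatic.couplingOf U X Z sr θt) R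
        {SuperAdiabatic.realTime X Z sr sr}) ∧
    (∀ s₀ : ℂ,
      SuperAdiabatic.AssumptionR1 (SuperAdiabatic.slitDomain U X Z sr B)
        (SuperAdiabatic.criticalPoints U X Z) τ sr R s₀ →
      ∀ (m : ℤ) (n : ℕ) (ε : ℤ), SuperAdiabatic.HasCriticalForm X Z s₀ m n ε →
      ∃ t₀ : ℂ, Tendsto τ (𝓝[SuperAdiabatic.slitDomain U X Z sr B] s₀) (𝓝 t₀) ∧
        ∃ a b : ℝ, a < SuperAdiabatic.realTime X Z sr sr ∧
          SuperAdiabatic.realTime X Z sr sr < b ∧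
          (∀ t ∈ Icc a b, ContDiffAt ℝ ∞ (SuperAdiabatic.thetaOf U X Z sr θt) t) ∧
          (∃ Δ : ℝ → ℂ,
            (∀ t ∈ Icc a b, SuperAdiabatic.couplingOf U X Z sr θt t =
              SuperAdiabatic.polePair (ε * n / (2 * m + n + 2)) t₀ t + Δ t) ∧
            ∀ α : ℝ, 0 < α → α < 1 → (2 * (m : ℝ) + n) / (2 * m + n + 2) ≤ α →
              Δ ∈ SuperAdiabatic.FSpace α R (Icc a b)) ∧
          SuperAdiabatic.Assumption1 (SuperAdiabatic.couplingOf U X Z sr θt)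
            (SuperAdiabatic.realTime X Z sr sr) R (Icc a b)) := by
  rw [SuperAdiabatic.realTime_self]
  refine ⟨fun hR2 => ?_, fun s₀ hR1 m n ε hform => ?_⟩
  · obtain ⟨φ, hφ⟩ := hτ.exists_isTimeInverse hXZ hB hR hR2.1
    have hmem := hτ.couplingOf_mem_FSpace_one hXZ hB hφ hθ hR2
    exact ⟨(hτ.eventually_contDiffAt_thetaOf hXZ hB hφ hθ).self_of_nhds, hmem, hR.pos,
      ⟨0, 0, le_rfl, (Icc_self 0).symm⟩, R, le_rfl, hmem⟩
  · obtain ⟨φ, hφ⟩ := hτ.exists_isTimeInverse hXZ hB hR hR1.2.2.1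
    obtain ⟨t₀, ht₀⟩ := hτ.exists_tendsto hXZ hB hR1.1
      (frontier_subset_closure (hR1.2.2.2.ge (mem_insert s₀ _)).2)
    have hnorm := (hτ.norm_eq_and_tendsto_of_assumptionR1 hXZ hB hφ hR1 ht₀).1
    have hre : t₀.re = 0 := by rw [hR1.2.1.re_eq ht₀, hτ.apply_self, Complex.zero_re]
    obtain ⟨η, hη, hηR, hsmooth, hmem⟩ :=
      hτ.exists_sub_polePair_mem_FSpace hXZ hB hφ hθ hR1 hform ht₀ hre
    obtain ⟨γ, hγ⟩ :=
      SuperAdiabatic.exists_polePair_eq_of_re_eq_zero hre (ε * n / (2 * m + n + 2))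
    obtain ⟨α, hα, hα₁, hle⟩ := hform.exists_exponent
    refine ⟨t₀, ht₀, -η, η, neg_lt_zero.2 hη, hη, hsmooth,
      ⟨_, fun t _ => (add_sub_cancel _ _).symm, fun α hα _ => hmem α hα⟩,
      hR.pos, ⟨-η, η, rfl⟩, Icc_subset_Icc (by linarith) (by linarith),
      ⟨neg_nonpos.2 hη.le, hη.le⟩, γ, α, hα, hα₁, ?_⟩
    rw [← hnorm, hγ, hnorm]
    exact hmem α hα hle
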